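/- Let $R=\mathbb Z[z_0,z_1,z_2,\dots]$ and $n\ge 2$. Order $V_n=\{0,1\}\times\{1,\dots,n\}$ by $(0,1)<\cdots<(0,n)<(1,n)<\cdots<(1,1)$. A *flat virtual $n$-tangle* is a partition $E$ of $V_n$ into pairs; an *arrow flat $n$-tangle* is such an $E$ with a labeling $f:E\to\mathbb Z$ such that $f(\{(a,b),(c,d)\})$ is odd if $a=c$ and even if $a\ne c$. Let $\mathrm{ATL}_n$ be the free $R$-module on the set of arrow flat $n$-tangles, with the following bilinear multiplication. For $F=(E,f)$ and $F'=(E',f')$, glue, for each $b$, the point $(1,b)$ of $E$ to the point $(0,b)$ of $E'$. The pairs of $E\sqcup E'$ then form $n$ arcs, which join the points $(0,b)$ of $E$ and $(1,b)$ of $E'$ in pairs, and a number of closed cycles. The boundaries of the arcs form a flat virtual $n$-tangle $E*E'$. The parity $\varpi(\alpha)$ of a pair $\alpha=\{(a,b),(c,d)\}$ is $-1$ if $a=c$ and $1$ if $a\ne c$. To a path running successively through the pairs $\alpha_1,\dots,\alpha_\ell$ with labels $m_1,\dots,m_\ell$ associate $\sum_i\varpi^c_i m_i$, where $\varpi^c_i=\prod_{j<i}\varpi(\alpha_j)$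 if the path runs through $\alpha_i$ from its smaller to its larger element, and $\varpi^c_i=\prod_{j\le i}\varpi(\alpha_j)$ otherwise. Label each pair of $E*E'$ by this sum for the corresponding arc, run through from the smaller to the larger end; this gives an arrow flat tangle $F*F'$. For a cycle $\gamma$ let $h(\gamma)$ be this sum (an even number), where $\gamma$ is run through from the point $(1,b)$ of $E$ with $b$ smallest on $\gamma$, starting with a pair of $E$, and let $\zeta(\gamma)=|h(\gamma)|/2$. Then $FF'=\big(\prod_\gamma z_{\zeta(\gamma)}\big)\,F*F'$, where $\gamma$ runs over the cycles of $E\sqcup E'$. In $\mathrm{ATL}_n$ let $F_i$ ($1\le i\le n-1$) be the tangle with pairs $\{(0,i),(0,i+1)\}$ and $\{(1,i),(1,i+1)\}$ labeled $1$ and pairs $\{(0,b),(1,b)\}$, $b\neq i,i+1$, labeled $0$; let $w_i$ ($1\le i\le n-1$) be the tangle with pairs $\{(0,i),(1,i+1)\}$, $\{(0,i+1),(1,i)\}$ and $\{(0,b),(1,b)\}$, $b\ne i,i+1$, all labeled $0$; and let $t_j^{\pm1}$ ($1\le j\le n$) be the tangle with pairs $\{(0,b),(1,b)\}$, labeled $\pm2$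 for $b=j$ and $0$ for $b\ne j$. **Proposition.** $\mathrm{ATL}_n$ is an associative unital $R$-algebra, whose unit is the tangle with pairs $\{(0,b),(1,b)\}$, all labeled $0$, and it has a presentation (as an associative unital $R$-algebra) with generators $F_1,\dots,F_{n-1}$, $w_1,\dots,w_{n-1}$, $t_1,\dots,t_n$, $t_1^{-1},\dots,t_n^{-1}$ and relations - $t_it_i^{-1}=t_i^{-1}t_i=1$ for $1\le i\le n$; $t_it_j=t_jt_i$ for $1\le i<j\le n$; - $w_i^2=1$ for $1\le i\le n-1$; $w_iw_j=w_jw_i$ for $|i-j|\ge2$; $w_iw_jw_i=w_jw_iw_j$ for $|i-j|=1$; - $w_it_i=t_{i+1}w_i$ and $w_it_{i+1}=t_iw_i$ for $1\le i\le n-1$; $w_it_j=t_jw_i$ for $j\ne i,i+1$; - $F_it_i^mF_i=z_{|m|}F_i$ for $1\le i\le n-1$ and $m\in\mathbb Z$; - $F_iw_i=F_it_i=F_it_{i+1}^{-1}$ and $w_iF_i=t_i^{-1}F_i=t_{i+1}F_i$ for $1\le i\le n-1$; - $F_iF_j=F_jF_i$ and $F_iw_j=w_jF_i$ for $|i-j|\ge2$;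 $F_it_j=t_jF_i$ for $j\ne i,i+1$; - $F_iw_jF_i=F_i$ and $w_iw_jF_i=F_jw_iw_j$ for $|i-j|=1$. That is, the homomorphism to $\mathrm{ATL}_n$ from the $R$-algebra defined by these generators and relations, sending each generator to the tangle of the same name, is an isomorphism. -/

import Mathlib

namespace ArrowTL

/-- The ground ring `ℤ[z₀, z₁, z₂, …]`; the variable `z_k` is `MvPolynomial.X k`. -/
abbrev R0a : Type := MvPolynomial ℕ ℤ

/-- The set `{0,1} × {1,…,n}` of end points of an `n`-tangle
(`false` is the side `0`, `true` is the side `1`, and positions are counted from `0`). -/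
abbrev Vertex (n : ℕ) : Type := Bool × Fin n

/-- The rank of an end point in the order
`(0,1) < (0,2) < ⋯ < (0,n) < (1,n) < ⋯ < (1,2) < (1,1)`. -/
def pos {n : ℕ} (v : Vertex n) : ℕ :=
  if v.1 = true then 2 * n - 1 - (v.2 : ℕ) else (v.2 : ℕ)

/-- A flat virtual `n`-tangle: a partition of `{0,1} × {1,…,n}` into pairs, recorded by the
fixed point free involution that exchanges the two elements of each pair. -/
@[ext] structure FlatTangle (n : ℕ) where
  partner : Vertex n → Vertex n
  partner_partner : ∀ v, partner (partner v) = v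
  partner_ne : ∀ v, partner v ≠ v

/-- An arrow flat `n`-tangle: a flat virtual `n`-tangle with an integer label on each of its
pairs (recorded on both elements of the pair), odd if the two elements of the pair are on the
same side and even otherwise. -/
@[ext] structure ArrowTangle (n : ℕ) extends FlatTangle n where
  label : Vertex n → ℤ
  label_partner : ∀ v, label (partner v) = label v
  odd_label_iff : ∀ v, Odd (label v) ↔ (partner v).1 = v.1

/-! ### Concatenation of two tangles -/

/-- An end point of one of two concatenated tangles `E`, `E'`:
`(false, v)` is the end point `v` of `E`, and `(true, v)` is the end point `v` of `E'`. -/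
abbrev Point (n : ℕ) : Type := Bool × Vertex n

/-- The points that remain free in the concatenation: those on the side `0` of `E` and those on
the side `1` of `E'`. -/
def IsOuter {n : ℕ} (p : Point n) : Prop := p.1 = p.2.1

instance {n : ℕ} : DecidablePred (IsOuter (n := n)) := fun p =>
  inferInstanceAs (Decidable (p.1 = p.2.1))

/-- The free point of the concatenation that becomes the end point `v` of the composition. -/
def outerPoint {n : ℕ} (v : Vertex n) : Point n := (v.1, v)

/-- The point `(1,b)` of `E` is glued with the point `(0,b)` of `E'`; free points are left
where they are. -/
def glue {n : ℕ} (p : Point n) : Point n :=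
  if IsOuter p then p else (!p.1, (!p.2.1, p.2.2))

namespace FlatTangle

variable {n : ℕ}

/-- The other end point of the pair of `E ⊔ E'` that contains `p`. -/
def opposite (E E' : FlatTangle n) (p : Point n) : Point n :=
  (p.1, if p.1 = true then E'.partner p.2 else E.partner p.2)

/-- If `p` is the point at which a path enters a pair of `E ⊔ E'`, then `next E E' p` is the point
at which it enters the following pair, or the free point at which the path ends. The pairs
met by the path that starts at `p` are entered at `p, next p, next (next p), …` -/
def next (E E' : FlatTangle n) (p : Point n) : Point n := glue (opposite E E' p)

theorem glue_glue (p : Point n) : glue (glue p) = p := by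
  rcases p with ⟨k, s, b⟩
  cases k <;> cases s <;> simp [glue, IsOuter]

theorem isOuter_glue (p : Point n) : IsOuter (glue p) ↔ IsOuter p := by
  rcases p with ⟨k, s, b⟩
  cases k <;> cases s <;> simp [glue, IsOuter]

theorem glue_of_isOuter {p : Point n} (h : IsOuter p) : glue p = p := by
  simp [glue, h]

theorem opposite_opposite (E E' : FlatTangle n) (p : Point n) :
    opposite E E' (opposite E E' p) = p := by
  rcases p with ⟨k, v⟩
  cases k <;> simp [opposite, partner_partner]

theorem opposite_ne (E E' : FlatTangle n) (p : Point n) : opposite E E' p ≠ p := by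
  rcases p with ⟨k, v⟩
  cases k <;> simp [opposite, partner_ne]

theorem next_injective (E E' : FlatTangle n) : Function.Injective (next E E') := by
  intro p q h
  have h1 := congrArg glue h
  simp only [next, glue_glue] at h1
  have h2 := congrArg (opposite E E') h1
  simpa only [opposite_opposite] using h2

theorem glue_next (E E' : FlatTangle n) (p : Point n) :
    next E E' (glue (next E E' p)) = glue p := by
  simp only [next, glue_glue, opposite_opposite]

theorem outerPoint_snd {p : Point n} (h : IsOuter p) : outerPoint p.2 = p := by
  rcases p with ⟨k, s, b⟩
  simp only [IsOuter] at h
  subst h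
  rfl

theorem isOuter_outerPoint (v : Vertex n) : IsOuter (outerPoint v) := rfl

/-- A path that starts at a free point reaches a free point again. -/
theorem exists_isOuter (E E' : FlatTangle n) (v : Vertex n) :
    ∃ k, 0 < k ∧ IsOuter ((next E E')^[k] (outerPoint v)) := by
  obtain ⟨k, hk, h⟩ := (next_injective E E').mem_periodicPts (outerPoint v)
  refine ⟨k, hk, ?_⟩
  rw [h.eq]
  exact isOuter_outerPoint v

/-- The number of pairs in the arc of `E ⊔ E'` that starts at the free point `v`. -/
def arcLength (E E' : FlatTangle n) (v : Vertex n) : ℕ := Nat.find (exists_isOuter E E' v)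

/-- The free point at which the arc of `E ⊔ E'` that starts at the free point `v` ends. -/
def arcEnd (E E' : FlatTangle n) (v : Vertex n) : Vertex n :=
  ((next E E')^[arcLength E E' v] (outerPoint v)).2

theorem arcLength_pos (E E' : FlatTangle n) (v : Vertex n) : 0 < arcLength E E' v :=
  (Nat.find_spec (exists_isOuter E E' v)).1

theorem outerPoint_arcEnd (E E' : FlatTangle n) (v : Vertex n) :
    outerPoint (arcEnd E E' v) = (next E E')^[arcLength E E' v] (outerPoint v) :=
  outerPoint_snd (Nat.find_spec (exists_isOuter E E' v)).2

theorem not_isOuter_of_lt (E E' : FlatTangle n) (v : Vertex n) {k : ℕ} (h0 : 0 < k)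
    (hk : k < arcLength E E' v) : ¬ IsOuter ((next E E')^[k] (outerPoint v)) := fun h =>
  Nat.find_min (exists_isOuter E E' v) hk ⟨h0, h⟩

theorem iterate_arcEnd (E E' : FlatTangle n) (v : Vertex n) (j : ℕ)
    (hj : j ≤ arcLength E E' v) :
    (next E E')^[j] (outerPoint (arcEnd E E' v)) =
      glue ((next E E')^[arcLength E E' v - j] (outerPoint v)) := by
  induction j with
  | zero =>
    rw [Function.iterate_zero, id, Nat.sub_zero, ← outerPoint_arcEnd,
      glue_of_isOuter (isOuter_outerPoint _)]
  | succ j ih =>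
    rw [Function.iterate_succ_apply', ih (by omega)]
    obtain ⟨m, hm⟩ : ∃ m, arcLength E E' v - j = m + 1 := ⟨arcLength E E' v - j - 1, by omega⟩
    have hm' : arcLength E E' v - (j + 1) = m := by omega
    rw [hm, hm', Function.iterate_succ_apply', glue_next]

theorem arcLength_arcEnd (E E' : FlatTangle n) (v : Vertex n) :
    arcLength E E' (arcEnd E E' v) = arcLength E E' v := by
  unfold arcLength
  rw [Nat.find_eq_iff]
  refine ⟨⟨arcLength_pos E E' v, ?_⟩, ?_⟩
  · have := iterate_arcEnd E E' v (arcLength E E' v) le_rfl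
    change IsOuter ((next E E')^[arcLength E E' v] _)
    rw [this, isOuter_glue, Nat.sub_self]
    exact isOuter_outerPoint v
  · rintro k hk ⟨h0, h⟩
    change k < arcLength E E' v at hk
    rw [iterate_arcEnd E E' v k hk.le, isOuter_glue] at h
    exact not_isOuter_of_lt E E' v (by omega) (by omega) h

theorem arcEnd_arcEnd (E E' : FlatTangle n) (v : Vertex n) :
    arcEnd E E' (arcEnd E E' v) = v := by
  have h := iterate_arcEnd E E' v (arcLength E E' v) le_rfl
  rw [Nat.sub_self, Function.iterate_zero, id, glue_of_isOuter (isOuter_outerPoint v)] at h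
  rw [arcEnd, arcLength_arcEnd, h]
  rfl

theorem arcEnd_ne (E E' : FlatTangle n) (v : Vertex n) : arcEnd E E' v ≠ v := by
  intro hv
  have key : ∀ j ≤ arcLength E E' v, (next E E')^[j] (outerPoint v) =
      glue ((next E E')^[arcLength E E' v - j] (outerPoint v)) := by
    intro j hj
    have := iterate_arcEnd E E' v j hj
    rwa [hv] at this
  have hpos := arcLength_pos E E' v
  rcases Nat.even_or_odd' (arcLength E E' v) with ⟨c, hc | hc⟩
  · have h := key c (by omega)
    rw [show arcLength E E' v - c = c by omega] at h
    refine not_isOuter_of_lt E E' v (k := c) (by omega) (by omega) ?_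
    by_contra hcon
    revert h hcon
    generalize (next E E')^[c] (outerPoint v) = q
    intro h hcon
    rw [glue, if_neg hcon] at h
    have := congrArg Prod.fst h
    simp at this
  · have h := key c (by omega)
    rw [show arcLength E E' v - c = c + 1 by omega, Function.iterate_succ_apply', next,
      glue_glue] at h
    exact opposite_ne E E' _ h.symm

/-- The flat virtual tangle `E * E'`: its pairs are the boundaries of the arcs of `E ⊔ E'`. -/
def comp (E E' : FlatTangle n) : FlatTangle n where
  partner := arcEnd E E'
  partner_partner := arcEnd_arcEnd E E'
  partner_ne := arcEnd_ne E E'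

/-- The cycles of `E ⊔ E'`. A cycle is represented by the smallest of its positions `b`: the path
that starts at the point `(1,b)` of `E`, and runs first through a pair of `E`, never meets a free
point, and `b` is the smallest position on it. -/
noncomputable def cycles (E E' : FlatTangle n) : Finset (Fin n) :=
  open scoped Classical in
  Finset.univ.filter fun b => ∀ k : ℕ,
    ¬ IsOuter ((next E E')^[k] (false, (true, b))) ∧
      b ≤ ((next E E')^[k] (false, (true, b))).2.2

/-- The number of pairs in the cycle represented by `b`. -/
noncomputable def cycleLength (E E' : FlatTangle n) (b : Fin n) : ℕ :=
  Function.minimalPeriod (next E E') (false, (true, b))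

/-- The parity `ϖ` of the pair of `E ⊔ E'` that contains `p`: it is `-1` if the two elements of the
pair are on the same side of their tangle, and `1` otherwise. -/
def parity (E E' : FlatTangle n) (p : Point n) : ℤ :=
  if (opposite E E' p).2.1 = p.2.1 then -1 else 1

/-- The cumulated parity of the `(i+1)`-st pair on the path that starts at `p`: the product of the
parities of the pairs that precede it, and of its own parity if the path runs through it from its
larger element to its smaller element. -/
def cumulatedParity (E E' : FlatTangle n) (p : Point n) (i : ℕ) : ℤ :=
  ∏ j ∈ Finset.range
      (if pos ((next E E')^[i] p).2 < pos (opposite E E' ((next E E')^[i] p)).2 then i else i + 1),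
    parity E E' ((next E E')^[j] p)

end FlatTangle

namespace ArrowTangle

open FlatTangle

variable {n : ℕ}

/-- The label of the pair of `F ⊔ F'` that contains `p`. -/
def labelAt (F F' : ArrowTangle n) (p : Point n) : ℤ :=
  if p.1 = true then F'.label p.2 else F.label p.2

/-- The sum of the labels of the first `l` pairs on the path that starts at `p`, weighted by the
cumulated parities. -/
def pathSum (F F' : ArrowTangle n) (p : Point n) (l : ℕ) : ℤ :=
  ∑ i ∈ Finset.range l,
    cumulatedParity F.toFlatTangle F'.toFlatTangle p i *
      labelAt F F' ((next F.toFlatTangle F'.toFlatTangle)^[i] p)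

/-- The sum of the labels on the arc of `F ⊔ F'` that starts at the free point `v`. -/
def arcSum (F F' : ArrowTangle n) (v : Vertex n) : ℤ :=
  pathSum F F' (outerPoint v) (arcLength F.toFlatTangle F'.toFlatTangle v)

theorem odd_labelAt_iff (F F' : ArrowTangle n) (p : Point n) :
    Odd (labelAt F F' p) ↔
      (opposite F.toFlatTangle F'.toFlatTangle p).2.1 = p.2.1 := by
  rcases p with ⟨k, v⟩
  cases k <;> simp [labelAt, opposite, odd_label_iff]

theorem odd_cumulatedParity (E E' : FlatTangle n) (p : Point n) (i : ℕ) :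
    Odd (cumulatedParity E E' p i) := by
  unfold cumulatedParity
  refine Finset.prod_induction _ Odd (fun _ _ => Odd.mul) odd_one fun j _ => ?_
  unfold parity
  split_ifs
  · exact odd_neg_one
  · exact odd_one

theorem odd_pathSum_succ (F F' : ArrowTangle n) (p : Point n) (l : ℕ) :
    Odd (pathSum F F' p (l + 1)) ↔
      (Odd (pathSum F F' p l) ↔ ¬ (opposite F.toFlatTangle F'.toFlatTangle
        ((next F.toFlatTangle F'.toFlatTangle)^[l] p)).2.1 =
          ((next F.toFlatTangle F'.toFlatTangle)^[l] p).2.1) := by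
  rw [pathSum, Finset.sum_range_succ, Int.odd_add, ← pathSum, ← odd_labelAt_iff,
    ← Int.not_odd_iff_even, Int.odd_mul]
  have := odd_cumulatedParity F.toFlatTangle F'.toFlatTangle p l
  tauto

theorem glue_side {q : Point n} (h : ¬ IsOuter (glue q)) : (glue q).2.1 = !q.2.1 := by
  rw [isOuter_glue] at h
  simp [glue, h]

theorem odd_pathSum_iff (F F' : ArrowTangle n) (v : Vertex n) (l : ℕ)
    (hl : l < arcLength F.toFlatTangle F'.toFlatTangle v) :
    Odd (pathSum F F' (outerPoint v) l) ↔
      ((next F.toFlatTangle F'.toFlatTangle)^[l] (outerPoint v)).2.1 ≠ v.1 := by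
  induction l with
  | zero => simp [pathSum, outerPoint]
  | succ l ih =>
    rw [odd_pathSum_succ, ih (by omega)]
    have h := not_isOuter_of_lt F.toFlatTangle F'.toFlatTangle v (by omega) hl
    rw [Function.iterate_succ_apply'] at h ⊢
    have h2 := glue_side h
    rw [show next F.toFlatTangle F'.toFlatTangle _ = glue _ from rfl, h2]
    generalize ((next F.toFlatTangle F'.toFlatTangle)^[l] (outerPoint v)) = q
    generalize (opposite F.toFlatTangle F'.toFlatTangle q).2.1 = a
    generalize q.2.1 = b
    generalize v.1 = c
    revert a b c
    decide

theorem odd_arcSum_iff (F F' : ArrowTangle n) (v : Vertex n) :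
    Odd (arcSum F F' v) ↔ (arcEnd F.toFlatTangle F'.toFlatTangle v).1 = v.1 := by
  obtain ⟨l, hl⟩ : ∃ l, arcLength F.toFlatTangle F'.toFlatTangle v = l + 1 :=
    ⟨_, (Nat.succ_pred_eq_of_pos (arcLength_pos F.toFlatTangle F'.toFlatTangle v)).symm⟩
  have ho : IsOuter ((next F.toFlatTangle F'.toFlatTangle)^[l + 1] (outerPoint v)) := by
    rw [← hl, ← outerPoint_arcEnd]
    exact isOuter_outerPoint _
  rw [arcSum, arcEnd, hl, odd_pathSum_succ, odd_pathSum_iff F F' v l (by omega)]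
  rw [Function.iterate_succ_apply'] at ho ⊢
  rw [next, isOuter_glue] at ho
  rw [next, glue_of_isOuter ho]
  generalize ((next F.toFlatTangle F'.toFlatTangle)^[l] (outerPoint v)) = q
  generalize (opposite F.toFlatTangle F'.toFlatTangle q).2.1 = a
  generalize q.2.1 = b
  generalize v.1 = c
  revert a b c
  decide

/-- The smaller of the two elements `v` and `E.partner v`. -/
def _root_.ArrowTL.FlatTangle.lower (E : FlatTangle n) (v : Vertex n) : Vertex n :=
  if pos v < pos (E.partner v) then v else E.partner v

theorem pos_injective : Function.Injective (pos (n := n)) := by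
  rintro ⟨a, b⟩ ⟨c, d⟩ h
  have hb := b.isLt
  have hd := d.isLt
  cases a <;> cases c <;> simp [pos, Fin.ext_iff] at h ⊢ <;> omega

theorem lower_partner (E : FlatTangle n) (v : Vertex n) :
    E.lower (E.partner v) = E.lower v := by
  have h : pos (E.partner v) ≠ pos v := fun h => E.partner_ne v (pos_injective h)
  unfold FlatTangle.lower
  rw [E.partner_partner]
  split_ifs <;> first | rfl | omega

/-- The arrow flat tangle `F * F'`: the underlying flat tangle is that of the concatenation, and the
label of a pair is the weighted sum of the labels on the corresponding arc, the arc being run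
through from its smaller to its larger end. -/
def comp (F F' : ArrowTangle n) : ArrowTangle n where
  toFlatTangle := F.toFlatTangle.comp F'.toFlatTangle
  label v := arcSum F F' ((F.toFlatTangle.comp F'.toFlatTangle).lower v)
  label_partner v := by rw [lower_partner]
  odd_label_iff v := by
    rw [odd_arcSum_iff, FlatTangle.lower]
    split_ifs with h
    · rfl
    · change (arcEnd _ _ (arcEnd _ _ v)).1 = (arcEnd _ _ v).1 ↔ (arcEnd _ _ v).1 = v.1
      rw [arcEnd_arcEnd]
      exact eq_comm

/-- The number of zigzags `|h| / 2` of the cycle of `F ⊔ F'` represented by `b`, where `h` is the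
weighted sum of the labels on the cycle (an even number). -/
noncomputable def zigzag (F F' : ArrowTangle n) (b : Fin n) : ℕ :=
  (pathSum F F' (false, (true, b))
    (cycleLength F.toFlatTangle F'.toFlatTangle b)).natAbs / 2

/-- The monomial `∏ z_{ζ(γ)}` over the cycles `γ` of `F ⊔ F'`. -/
noncomputable def loopWeight (F F' : ArrowTangle n) : R0a :=
  ∏ b ∈ cycles F.toFlatTangle F'.toFlatTangle, MvPolynomial.X (zigzag F F' b)

/-- The arrow flat tangle that connects `(0,b)` to `(1, e b)` by a pair with label `2 * c b`,
for each `b`. -/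
def strands (e : Equiv.Perm (Fin n)) (c : Fin n → ℤ) : ArrowTangle n where
  partner v := if v.1 = true then (false, e.symm v.2) else (true, e v.2)
  partner_partner := by
    rintro ⟨a, b⟩
    cases a <;> simp
  partner_ne := by
    rintro ⟨a, b⟩
    cases a <;> simp
  label v := if v.1 = true then 2 * c (e.symm v.2) else 2 * c v.2
  label_partner := by
    rintro ⟨a, b⟩
    cases a <;> simp
  odd_label_iff := by
    rintro ⟨a, b⟩
    cases a <;> simp

/-- The unit tangle. -/
def idTangle (n : ℕ) : ArrowTangle n := strands 1 0

/-- The position `i` in `{1,…,n}`, for `i` in `{1,…,n-1}`. -/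
def lo (i : Fin (n - 1)) : Fin n := ⟨i, by omega⟩

/-- The position `i + 1` in `{1,…,n}`, for `i` in `{1,…,n-1}`. -/
def hi (i : Fin (n - 1)) : Fin n := ⟨i + 1, by omega⟩

/-- The tangle `w_i`: strands `i` and `i + 1` are exchanged, all labels are `0`. -/
def wTangle (i : Fin (n - 1)) : ArrowTangle n := strands (Equiv.swap (lo i) (hi i)) 0

/-- The tangle `t_j`: vertical strands, with label `2` on the `j`-th and `0` on the others. -/
def tTangle (j : Fin n) : ArrowTangle n := strands 1 (Pi.single j 1)

/-- The tangle `t_j⁻¹`: vertical strands, with label `-2` on the `j`-th and `0` on the others. -/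
def tInvTangle (j : Fin n) : ArrowTangle n := strands 1 (Pi.single j (-1))

/-- The tangle `F_i`: the pairs `{(0,i),(0,i+1)}` and `{(1,i),(1,i+1)}` with label `1`, and
vertical strands with label `0` at the other positions. -/
def FTangle (i : Fin (n - 1)) : ArrowTangle n where
  partner v := if v.2 = lo i ∨ v.2 = hi i then (v.1, Equiv.swap (lo i) (hi i) v.2) else (!v.1, v.2)
  partner_partner := by
    have hne : lo i ≠ hi i := by simp [lo, hi, Fin.ext_iff]
    rintro ⟨a, b⟩
    by_cases h1 : b = lo i
    · subst h1; simp
    · by_cases h2 : b = hi i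
      · subst h2; simp
      · simp [h1, h2]
  partner_ne := by
    have hne : lo i ≠ hi i := by simp [lo, hi, Fin.ext_iff]
    rintro ⟨a, b⟩
    by_cases h1 : b = lo i
    · subst h1; simp [hne.symm]
    · by_cases h2 : b = hi i
      · subst h2; simp [hne]
      · simp [h1, h2]
  label v := if v.2 = lo i ∨ v.2 = hi i then 1 else 0
  label_partner := by
    rintro ⟨a, b⟩
    by_cases h1 : b = lo i
    · subst h1; simp
    · by_cases h2 : b = hi i
      · subst h2; simp
      · simp [h1, h2]
  odd_label_iff := by
    rintro ⟨a, b⟩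
    by_cases h : b = lo i ∨ b = hi i <;> simp [h]

end ArrowTangle

/-! ### The arrow Temperley--Lieb algebra -/

/-- `ATL_n`: the free `ℤ[z₀, z₁, …]`-module with basis the set of arrow flat `n`-tangles. -/
def ATL (n : ℕ) : Type := ArrowTangle n →₀ R0a

namespace ATL

variable {n : ℕ}

noncomputable instance : AddCommGroup (ATL n) := inferInstanceAs (AddCommGroup (ArrowTangle n →₀ R0a))

noncomputable instance : Module R0a (ATL n) := inferInstanceAs (Module R0a (ArrowTangle n →₀ R0a))

/-- The basis element of `ATL_n` given by an arrow flat tangle. -/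
noncomputable def of (F : ArrowTangle n) : ATL n := Finsupp.single F (1 : R0a)

/-- The bilinear multiplication of `ATL_n`, given on the basis by
`F F' = z_{ζ(γ₁)} ⋯ z_{ζ(γₘ)} (F * F')`, where `γ₁, …, γₘ` are the cycles of `F ⊔ F'`. -/
noncomputable def mulHom : ATL n →ₗ[R0a] ATL n →ₗ[R0a] ATL n :=
  Finsupp.linearCombination R0a fun F : ArrowTangle n =>
    (Finsupp.linearCombination R0a fun F' : ArrowTangle n =>
      F.loopWeight F' • of (F.comp F') : ATL n →ₗ[R0a] ATL n)

noncomputable instance : Mul (ATL n) := ⟨fun x y => mulHom x y⟩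

noncomputable instance : One (ATL n) := ⟨of (ArrowTangle.idTangle n)⟩

theorem of_mul_of (F F' : ArrowTangle n) :
    of F * of F' = F.loopWeight F' • of (F.comp F') := by
  have h1 : mulHom (of F) = (Finsupp.linearCombination R0a fun F' : ArrowTangle n =>
      F.loopWeight F' • of (F.comp F') : ATL n →ₗ[R0a] ATL n) :=
    (Finsupp.linearCombination_single R0a (1 : R0a) F).trans (one_smul R0a _)
  have h2 := (Finsupp.linearCombination_single R0a (v := fun F' : ArrowTangle n =>
      F.loopWeight F' • of (F.comp F')) (1 : R0a) F').trans (one_smul R0a _)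
  exact (congrArg (fun f : ATL n →ₗ[R0a] ATL n => f (of F')) h1).trans h2

end ATL

/-! ### The presentation -/

/-- The symbols `F_i`, `w_i` (`1 ≤ i ≤ n-1`) and `t_j`, `t_j⁻¹` (`1 ≤ j ≤ n`). -/
inductive Gen (n : ℕ) : Type
  | F (i : Fin (n - 1))
  | w (i : Fin (n - 1))
  | t (j : Fin n)
  | tInv (j : Fin n)

namespace Gen

variable {n : ℕ}

/-- `F_i` in the free algebra. -/
noncomputable def xF (i : Fin (n - 1)) : FreeAlgebra R0a (Gen n) := FreeAlgebra.ι R0a (Gen.F i)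

/-- `w_i` in the free algebra. -/
noncomputable def xw (i : Fin (n - 1)) : FreeAlgebra R0a (Gen n) := FreeAlgebra.ι R0a (Gen.w i)

/-- `t_j` in the free algebra. -/
noncomputable def xt (j : Fin n) : FreeAlgebra R0a (Gen n) := FreeAlgebra.ι R0a (Gen.t j)

/-- `t_j⁻¹` in the free algebra. -/
noncomputable def xtInv (j : Fin n) : FreeAlgebra R0a (Gen n) := FreeAlgebra.ι R0a (Gen.tInv j)

/-- The word `t_j ^ m`, for `m` in `ℤ`. -/
noncomputable def xtPow (j : Fin n) : ℤ → FreeAlgebra R0a (Gen n)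
  | Int.ofNat k => xt j ^ k
  | Int.negSucc k => xtInv j ^ (k + 1)

end Gen

/-- `|i - j| ≥ 2`. -/
def Far {m : ℕ} (i j : Fin m) : Prop := (i : ℕ) + 2 ≤ j ∨ (j : ℕ) + 2 ≤ i

/-- `|i - j| = 1`. -/
def Near {m : ℕ} (i j : Fin m) : Prop := (i : ℕ) + 1 = j ∨ (j : ℕ) + 1 = i

open Gen ArrowTangle in
/-- The defining relations. -/
inductive Rel (n : ℕ) : FreeAlgebra R0a (Gen n) → FreeAlgebra R0a (Gen n) → Prop
  | t_tInv (i : Fin n) : Rel n (xt i * xtInv i) 1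
  | tInv_t (i : Fin n) : Rel n (xtInv i * xt i) 1
  | t_t (i j : Fin n) (h : i < j) : Rel n (xt i * xt j) (xt j * xt i)
  | w_w (i : Fin (n - 1)) : Rel n (xw i * xw i) 1
  | w_w_far (i j : Fin (n - 1)) (h : Far i j) : Rel n (xw i * xw j) (xw j * xw i)
  | w_w_w (i j : Fin (n - 1)) (h : Near i j) : Rel n (xw i * xw j * xw i) (xw j * xw i * xw j)
  | w_t_lo (i : Fin (n - 1)) : Rel n (xw i * xt (lo i)) (xt (hi i) * xw i)
  | w_t_hi (i : Fin (n - 1)) : Rel n (xw i * xt (hi i)) (xt (lo i) * xw i)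
  | w_t (i : Fin (n - 1)) (j : Fin n) (h : j ≠ lo i) (h' : j ≠ hi i) :
      Rel n (xw i * xt j) (xt j * xw i)
  | F_t_F (i : Fin (n - 1)) (m : ℤ) :
      Rel n (xF i * xtPow (lo i) m * xF i) ((MvPolynomial.X m.natAbs : R0a) • xF i)
  | F_w (i : Fin (n - 1)) : Rel n (xF i * xw i) (xF i * xt (lo i))
  | F_t_lo (i : Fin (n - 1)) : Rel n (xF i * xt (lo i)) (xF i * xtInv (hi i))
  | w_F (i : Fin (n - 1)) : Rel n (xw i * xF i) (xtInv (lo i) * xF i)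
  | tInv_F (i : Fin (n - 1)) : Rel n (xtInv (lo i) * xF i) (xt (hi i) * xF i)
  | F_F_far (i j : Fin (n - 1)) (h : Far i j) : Rel n (xF i * xF j) (xF j * xF i)
  | F_w_far (i j : Fin (n - 1)) (h : Far i j) : Rel n (xF i * xw j) (xw j * xF i)
  | F_t (i : Fin (n - 1)) (j : Fin n) (h : j ≠ lo i) (h' : j ≠ hi i) :
      Rel n (xF i * xt j) (xt j * xF i)
  | F_w_F (i j : Fin (n - 1)) (h : Near i j) : Rel n (xF i * xw j * xF i) (xF i)
  | w_w_F (i j : Fin (n - 1)) (h : Near i j) : Rel n (xw i * xw j * xF i) (xF j * xw i * xw j)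

/-- The associative unital algebra over `ℤ[z₀, z₁, …]` defined by the generators and relations. -/
abbrev Presented (n : ℕ) : Type := RingQuot (Rel n)

/-- The class of a generator in the presented algebra. -/
noncomputable def gen {n : ℕ} (g : Gen n) : Presented n :=
  RingQuot.mkAlgHom R0a (Rel n) (FreeAlgebra.ι R0a g)

end ArrowTL

/-! Labels. A pair run through from one of its ends carries a directed label. Concatenating directed
labels is `tw m k`, that is m + (-1)^m k, the multiplication of the infinite dihedral group (even m
are translations, odd m reflections), and reversing the direction is the anti-involution `st`. The
cumulated parities are the bookkeeping of this group: the label of an arc is the product of the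
directed labels along it (`pathSum_eq_prod`). On a closed cycle the product is even; moving the
starting point conjugates it and reversing the cycle applies `st`, so it changes at most by a sign
and ζ is an invariant of the cycle.

Associativity. Three tangles are glued at once. Carrying out only the gluings between two neighbours
replaces the paths by their first returns to the remaining points, and splits the cycles into those
already closed and those still to be closed (`Elimination.prod_eq`). Both bracketings are therefore
read off from the same paths and the same cycles (`comp_assoc`, `loopWeight_mul`).

The homomorphism. The defining relations hold for tangles because the paths concerned can be
followed by hand (`freeHom_rel`); this gives `presentedHom`.

Normal forms. In the presented algebra the t's and w's give a group homomorphism from ℤⁿ ⋊ S_n, by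
the Coxeter presentation (`Coxeter.exists_hom`); its values are the elements `braid e c`. The
conjugate of an F_i by a permutation depends only on the ordered pair of points to which i, i+1 are
moved: the relation w w F = F w w carries every F_i to the last one, and a permutation that fixes
the last two points is a product of w_j that commute with the last F (`intertwines_of_apply`).
Conjugation by torus elements adds an integer parameter, which yields `bridge a b k`, and the
relations between generators spread to all bridges. Two bridges with a common point collapse to a
scalar multiple of a braid times one bridge, so the products of disjoint bridges and a braid, `nf L
e c`, span the algebra (`nfSpan_eq_top`).

Uniqueness. Every tangle is a `diagram L e c`, the image of `nf L e c`, but e and c are not unique: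
they also match caps with cups. Bridges absorb the permutations that flip a cap or exchange two
caps, and the torus elements that slide along a cap. Hence equal diagrams have equal normal forms
(`nf_eq_of_diagram_eq`). So sending a tangle to its normal form extends to a linear right inverse of
`presentedHom` which is surjective, and `presentedHom` is bijective. -/

namespace ArrowTL

/-! ### The monoid of directed labels -/

/-- The sign `(-1)^m`. -/
def sg (m : ℤ) : ℤ := if Even m then 1 else -1

/-- The label of the concatenation of two directed labels. -/
def tw (m k : ℤ) : ℤ := m + sg m * k

/-- The label obtained by reversing the direction. -/
def st (m : ℤ) : ℤ := sg m * m

theorem sg_even {m : ℤ} (h : Even m) : sg m = 1 := if_pos h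

theorem sg_odd {m : ℤ} (h : Odd m) : sg m = -1 := if_neg (Int.not_even_iff_odd.2 h)

theorem sg_cases (m : ℤ) : Even m ∧ sg m = 1 ∨ Odd m ∧ sg m = -1 := by
  rcases Int.even_or_odd m with h | h
  · exact Or.inl ⟨h, sg_even h⟩
  · exact Or.inr ⟨h, sg_odd h⟩

theorem sg_eq_iff {m k : ℤ} : sg m = sg k ↔ (Even m ↔ Even k) := by
  unfold sg
  split_ifs <;> simp [*]

theorem even_sg_mul {m k : ℤ} : Even (sg m * k) ↔ Even k := by
  rcases sg_cases m with ⟨-, h⟩ | ⟨-, h⟩ <;> simp [h]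

theorem sg_tw (m k : ℤ) : sg (tw m k) = sg m * sg k := by
  unfold sg
  simp only [tw, Int.even_add, even_sg_mul]
  split_ifs <;> simp_all

theorem even_tw {m k : ℤ} : Even (tw m k) ↔ (Even m ↔ Even k) := by
  rw [tw, Int.even_add, even_sg_mul]

theorem even_st {m : ℤ} : Even (st m) ↔ Even m := even_sg_mul

theorem sg_mul_self (m : ℤ) : sg m * sg m = 1 := by
  rcases sg_cases m with ⟨-, h⟩ | ⟨-, h⟩ <;> simp [h]

theorem sg_st (m : ℤ) : sg (st m) = sg m := sg_eq_iff.2 even_st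

/-- The sign is multiplicative for `tw`, so `tw` composes the affine maps x ↦ m + (-1)^m x of ℤ. -/
theorem tw_assoc (m k l : ℤ) : tw (tw m k) l = tw m (tw k l) := by
  have := sg_tw m k
  rw [tw, this, tw, tw, tw]
  ring

@[simp] theorem tw_zero (m : ℤ) : tw m 0 = m := by simp [tw]

@[simp] theorem zero_tw (m : ℤ) : tw 0 m = m := by simp [tw, sg]

@[simp] theorem st_st (m : ℤ) : st (st m) = m := by
  rw [st, sg_st, st, ← mul_assoc, sg_mul_self, one_mul]

@[simp] theorem st_zero : st 0 = 0 := by simp [st]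

theorem st_even {m : ℤ} (h : Even m) : st m = m := by simp [st, sg_even h]

theorem st_odd {m : ℤ} (h : Odd m) : st m = -m := by simp [st, sg_odd h]

theorem tw_even {m : ℤ} (h : Even m) (k : ℤ) : tw m k = m + k := by simp [tw, sg_even h]

theorem tw_odd {m : ℤ} (h : Odd m) (k : ℤ) : tw m k = m - k := by
  simp [tw, sg_odd h, sub_eq_add_neg]

/-- A path run backwards meets its pairs in the opposite order. Note that `st` is not the group
inverse: it keeps even labels and negates odd ones. -/
theorem st_tw (m k : ℤ) : st (tw m k) = tw (st k) (st m) := by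
  rw [st, sg_tw, tw, tw, sg_st, st, st]
  linear_combination (sg k * k) * sg_mul_self m

/-! ### Labelled pairings with gluing -/

/-- A set of points paired by `opp`, with directed labels, some of which are glued in pairs
by `glue`. The points that are not glued are the fixed points of `glue`. -/
structure Sys (X : Type*) where
  opp : X → X
  glue : X → X
  lab : X → ℤ
  side : X → Bool
  opp_opp : ∀ x, opp (opp x) = x
  glue_glue : ∀ x, glue (glue x) = x
  lab_opp : ∀ x, lab (opp x) = st (lab x)
  odd_lab : ∀ x, Odd (lab x) ↔ side (opp x) = side x
  side_glue : ∀ x, glue x ≠ x → side (glue x) = !side x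

namespace Sys

variable {X Y : Type*} (S : Sys X)

/-- The entry point of the pair that follows the pair entered at `x`. -/
def next (x : X) : X := S.glue (S.opp x)

/-- The free points. -/
def outer : Set X := {x | S.glue x = x}

/-- The product of the labels of the first `k` pairs of the path from `x`. -/
def prod (x : X) : ℕ → ℤ
  | 0 => 0
  | k + 1 => tw (prod x k) (S.lab (S.next^[k] x))

theorem mem_outer {x : X} : x ∈ S.outer ↔ S.glue x = x := Iff.rfl

theorem glue_mem_outer {x : X} : S.glue x ∈ S.outer ↔ x ∈ S.outer := by
  rw [mem_outer, mem_outer, S.glue_glue]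
  exact eq_comm

theorem next_injective : Function.Injective S.next := by
  intro x y h
  have h1 := congrArg (fun z => S.opp (S.glue z)) h
  simpa only [next, S.glue_glue, S.opp_opp] using h1

/-- `next` is a product of the two involutions `opp` and `glue`, so `glue` conjugates it into its
inverse. All reversal statements below come from this. -/
theorem next_glue_next (x : X) : S.next (S.glue (S.next x)) = S.glue x := by
  simp only [next, S.glue_glue, S.opp_opp]

theorem lab_glue_next (x : X) : S.lab (S.glue (S.next x)) = st (S.lab x) := by
  simp only [next, S.glue_glue, S.lab_opp]

/-- `prod` appends labels at the end of the path, whereas `Hit` peels them off at the beginning;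
associativity of `tw` reconciles the two. -/
theorem prod_succ' (x : X) (k : ℕ) : S.prod x (k + 1) = tw (S.lab x) (S.prod (S.next x) k) := by
  induction k with
  | zero => simp [prod]
  | succ k ih =>
    rw [prod, ih, tw_assoc, prod, Function.iterate_succ_apply]

theorem iterate_glue_iterate (x : X) (k j : ℕ) (hj : j ≤ k) :
    S.next^[j] (S.glue (S.next^[k] x)) = S.glue (S.next^[k - j] x) := by
  induction j with
  | zero => rfl
  | succ j ih =>
    rw [Function.iterate_succ_apply', ih (by omega)]
    obtain ⟨m, hm⟩ : ∃ m, k - j = m + 1 := ⟨k - j - 1, by omega⟩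
    rw [hm, show k - (j + 1) = m by omega, Function.iterate_succ_apply', next_glue_next]

/-- The reversed path runs through the same pairs, each in the other direction, so each induction
step is an instance of `st_tw`. -/
theorem prod_glue_iterate (x : X) (k : ℕ) :
    S.prod (S.glue (S.next^[k] x)) k = st (S.prod x k) := by
  induction k with
  | zero => simp [prod]
  | succ k ih =>
    rw [prod_succ', Function.iterate_succ_apply', next_glue_next, lab_glue_next, ih, prod, st_tw]

/-- The path from `x` meets `B` for the first time at `y`, after at least one step,
and the product of the labels on the way is `d`. -/
inductive Hit (B : Set X) : X → X → ℤ → Prop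
  | one (x : X) (h : S.next x ∈ B) : Hit B x (S.next x) (S.lab x)
  | step (x y : X) (d : ℤ) (h : S.next x ∉ B) (hd : Hit B (S.next x) y d) :
      Hit B x y (tw (S.lab x) d)

variable {S} {B : Set X}

/-- Paths are deterministic. This is what allows a path found by hand, or found in two ways, to
determine partner and label. -/
theorem Hit.unique {x y y' : X} {d d' : ℤ} (h : S.Hit B x y d) (h' : S.Hit B x y' d') :
    y = y' ∧ d = d' := by
  induction h generalizing d' with
  | one x h =>
    cases h' with
    | one _ _ => exact ⟨rfl, rfl⟩
    | step _ _ _ h2 _ => exact absurd h h2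
  | step x y d h hd ih =>
    cases h' with
    | one _ h2 => exact absurd h2 h
    | step _ _ _ _ hd' =>
      obtain ⟨h1, h2⟩ := ih hd'
      exact ⟨h1, by rw [h2]⟩

theorem hit_iff {x y : X} {d : ℤ} : S.Hit B x y d ↔ ∃ k, S.next^[k + 1] x = y ∧ y ∈ B ∧
    (∀ j, 0 < j → j ≤ k → S.next^[j] x ∉ B) ∧ S.prod x (k + 1) = d := by
  constructor
  · intro h
    induction h with
    | one x h => exact ⟨0, rfl, h, fun j h0 h1 => by omega, by simp [prod]⟩
    | step x y d h hd ih =>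
      obtain ⟨k, h1, h2, h3, h4⟩ := ih
      refine ⟨k + 1, h1, h2, ?_, ?_⟩
      · rintro (_ | j) h0 hj
        · omega
        · rcases j with _ | j
          · exact h
          · exact h3 (j + 1) (by omega) (by omega)
      · rw [prod_succ', h4]
  · rintro ⟨k, h1, h2, h3, h4⟩
    induction k generalizing x d with
    | zero =>
      subst h1 h4
      simpa [prod] using Hit.one (S := S) (B := B) x h2
    | succ k ih =>
      subst h4
      rw [prod_succ']
      refine Hit.step _ _ _ (h3 1 (by omega) (by omega)) (ih h1 (fun j h0 hj => ?_) rfl)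
      exact h3 (j + 1) (by omega) (by omega)

/-- The reversal of a path. -/
theorem Hit.reverse {x y : X} {d : ℤ} (h : S.Hit B x y d) (hB : ∀ z, S.glue z ∈ B ↔ z ∈ B)
    (hx : x ∈ B) : S.Hit B (S.glue y) (S.glue x) (st d) := by
  rw [hit_iff] at h ⊢
  obtain ⟨k, h1, h2, h3, h4⟩ := h
  refine ⟨k, ?_, (hB x).2 hx, fun j h0 hj => ?_, ?_⟩
  · rw [← h1, iterate_glue_iterate _ _ _ _ le_rfl, Nat.sub_self]
    rfl
  · rw [← h1, iterate_glue_iterate _ _ _ _ (by omega), hB]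
    exact h3 _ (by omega) (by omega)
  · rw [← h1, prod_glue_iterate, h4]

/-! #### First return -/

/-- Before `y` the path does not meet `B`, hence not the smaller set `C`; as `y` is not in `C`
either, the search for `C` continues from there. -/
theorem Hit.trans_not_mem {B C : Set X} (hBC : C ⊆ B) {x y z : X} {d d' : ℤ} (h : S.Hit B x y d)
    (hy : y ∉ C) (h' : S.Hit C y z d') : S.Hit C x z (tw d d') := by
  induction h with
  | one x h => exact Hit.step _ _ _ hy h'
  | step x y d h hd ih =>
    rw [tw_assoc]
    exact Hit.step _ _ _ (fun hc => h (hBC hc)) (ih hy h')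

theorem Hit.mono {B C : Set X} (hBC : C ⊆ B) {x y : X} {d : ℤ} (h : S.Hit B x y d)
    (hy : y ∈ C) : S.Hit C x y d := by
  induction h with
  | one x h => exact Hit.one _ hy
  | step x y d h hd ih => exact Hit.step _ _ _ (fun hc => h (hBC hc)) (ih hy)

/-- If the paths of `S'` are the first returns of those of `S` to the range of `ι`, they hit the same
subsets of this range. -/
theorem Hit.map {S' : Sys Y} {ι : Y → X} (hι : Function.Injective ι)
    (hret : ∀ y, S.Hit (Set.range ι) (ι y) (ι (S'.next y)) (S'.lab y)) {C : Set Y} {y z : Y} {d : ℤ}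
    (h : S'.Hit C y z d) : S.Hit (ι '' C) (ι y) (ι z) d := by
  have hsub : ι '' C ⊆ Set.range ι := Set.image_subset_range ι C
  induction h with
  | one x h => exact (hret x).mono hsub ⟨_, h, rfl⟩
  | step x y d h hd ih =>
    refine (hret x).trans_not_mem hsub ?_ ih
    rwa [hι.mem_set_image]

/-! #### Closed cycles -/

variable (S)

/-- The path from `x` does not meet `B`. -/
def Avoids (B : Set X) (x : X) : Prop := ∀ k, S.next^[k] x ∉ B

/-- The two points belong to the same arc or cycle. -/
def Conn (x y : X) : Prop := (∃ k, S.next^[k] x = y) ∨ ∃ k, S.next^[k] x = S.glue y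

/-- Half the absolute value of the product of the labels on the cycle through `x`. -/
noncomputable def wt (x : X) : ℕ := (S.prod x (Function.minimalPeriod S.next x)).natAbs / 2

variable {S}

theorem exists_iterate_symm [Finite X] {x y : X} (h : ∃ k, S.next^[k] x = y) :
    ∃ k, S.next^[k] y = x := by
  obtain ⟨k, rfl⟩ := h
  obtain ⟨m, hm, hp⟩ := S.next_injective.mem_periodicPts x
  -- With m a period, m * k is a multiple of it that is at least k, so m * k - k further steps
  -- complete a full number of turns.
  refine ⟨m * k - k, ?_⟩
  rw [← Function.iterate_add_apply, Nat.sub_add_cancel (Nat.le_mul_of_pos_left k hm)]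
  exact hp.mul_const k

theorem Conn.symm [Finite X] {x y : X} (h : S.Conn x y) : S.Conn y x := by
  rcases h with h | ⟨k, h⟩
  · exact Or.inl (exists_iterate_symm h)
  · refine Or.inr ⟨k, ?_⟩
    have := S.iterate_glue_iterate x k k le_rfl
    rwa [h, S.glue_glue, Nat.sub_self] at this

theorem iterate_glue_of_iterate {x y : X} {k : ℕ} (h : S.next^[k] x = y) :
    S.next^[k] (S.glue y) = S.glue x := by
  have := S.iterate_glue_iterate x k k le_rfl
  rwa [h, Nat.sub_self] at this

theorem Conn.trans [Finite X] {x y z : X} (h : S.Conn x y) (h' : S.Conn y z) : S.Conn x z := by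
  rcases h with ⟨k, h⟩ | ⟨k, h⟩ <;> rcases h' with ⟨l, h'⟩ | ⟨l, h'⟩
  · exact Or.inl ⟨l + k, by rw [Function.iterate_add_apply, h, h']⟩
  · exact Or.inr ⟨l + k, by rw [Function.iterate_add_apply, h, h']⟩
  · obtain ⟨m, hm⟩ := exists_iterate_symm ⟨l, iterate_glue_of_iterate h'⟩
    exact Or.inr ⟨m + k, by rw [Function.iterate_add_apply, h, hm]⟩
  · have h2 := iterate_glue_of_iterate h'
    rw [S.glue_glue] at h2
    obtain ⟨m, hm⟩ := exists_iterate_symm ⟨l, h2⟩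
    exact Or.inl ⟨m + k, by rw [Function.iterate_add_apply, h, hm]⟩

theorem Avoids.next {x : X} (h : S.Avoids B x) : S.Avoids B (S.next x) := fun k => h (k + 1)

theorem Avoids.iterate {x : X} (h : S.Avoids B x) (k : ℕ) : S.Avoids B (S.next^[k] x) := fun j => by
  rw [← Function.iterate_add_apply]
  exact h _

theorem Avoids.glue [Finite X] {x : X} (hB : ∀ z, S.glue z ∈ B ↔ z ∈ B)
    (h : S.Avoids B x) : S.Avoids B (S.glue x) := by
  intro k
  obtain ⟨m, hm⟩ := exists_iterate_symm (S := S) (x := x) ⟨k, rfl⟩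
  have h1 := S.iterate_glue_iterate (S.next^[k] x) m
  rw [hm] at h1
  -- Iterating from `glue x` means going backwards from `x`; the period p turns k backward steps
  -- into p * (k + 1) - k forward steps.
  obtain ⟨p, hp0, hp⟩ := S.next_injective.mem_periodicPts x
  have h2 := S.iterate_glue_iterate x (p * (k + 1)) k
    (le_trans (by omega : k ≤ k + 1) (Nat.le_mul_of_pos_left _ hp0))
  rw [show S.next^[p * (k + 1)] x = x from hp.mul_const _] at h2
  rw [h2, hB]
  exact h _

theorem Avoids.conn [Finite X] {x y : X} (hB : ∀ z, S.glue z ∈ B ↔ z ∈ B)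
    (h : S.Avoids B x) (hc : S.Conn x y) : S.Avoids B y := by
  rcases hc with ⟨k, rfl⟩ | ⟨k, hk⟩
  · exact h.iterate k
  · have := (h.iterate k).glue hB
    rwa [hk, S.glue_glue] at this

/-- An odd pair stays on its side and an even one changes it, and the gluing that follows switches
sides once more. So the side of the entry points changes exactly at the odd labels. -/
theorem odd_prod {x : X} (h : S.Avoids S.outer x) (k : ℕ) :
    Odd (S.prod x k) ↔ S.side (S.next^[k] x) ≠ S.side x := by
  induction k with
  | zero => simp [prod]
  | succ k ih =>
    rw [prod, ← Int.not_even_iff_odd, even_tw, ← Int.not_odd_iff_even, ← Int.not_odd_iff_even, ih,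
      S.odd_lab, Function.iterate_succ_apply']
    have h1 := h (k + 1)
    rw [Function.iterate_succ_apply', Sys.next, S.glue_mem_outer] at h1
    have h2 := S.side_glue _ h1
    rw [Sys.next, h2]
    generalize S.side (S.opp (S.next^[k] x)) = a
    generalize S.side (S.next^[k] x) = b
    generalize S.side x = c
    revert a b c
    decide

theorem even_prod_minimalPeriod {x : X} (h : S.Avoids S.outer x) :
    Even (S.prod x (Function.minimalPeriod S.next x)) := by
  rw [← Int.not_odd_iff_even, odd_prod h, Function.iterate_minimalPeriod]
  simp

/-- Let h and h' be the products from `x` and `next x`, and l the first label. Evaluating one step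
more than a full turn in two ways gives h + l = l ± h', since h is even; hence h' = ±h. -/
theorem wt_next [Finite X] {x : X} (h : S.Avoids S.outer x) : S.wt (S.next x) = S.wt x := by
  have hx := S.next_injective.mem_periodicPts x
  have h1 := S.prod_succ' x (Function.minimalPeriod S.next x)
  have he := even_prod_minimalPeriod h
  rw [prod, Function.iterate_minimalPeriod, tw, sg_even he, tw] at h1
  rw [wt, wt, Function.minimalPeriod_apply hx]
  congr 1
  rcases sg_cases (S.lab x) with ⟨-, h2⟩ | ⟨-, h2⟩ <;> rw [h2] at h1 <;> omega

theorem minimalPeriod_glue [Finite X] (x : X) :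
    Function.minimalPeriod S.next (S.glue x) = Function.minimalPeriod S.next x := by
  rw [Function.minimalPeriod_eq_minimalPeriod_iff]
  intro k
  constructor
  · intro h
    have := iterate_glue_of_iterate h
    rwa [S.glue_glue] at this
  · intro h
    exact iterate_glue_of_iterate h

/-- Reversal applies `st`, which fixes the even product of a cycle. -/
theorem wt_glue [Finite X] {x : X} (h : S.Avoids S.outer x) : S.wt (S.glue x) = S.wt x := by
  have h1 := S.prod_glue_iterate x (Function.minimalPeriod S.next x)
  rw [Function.iterate_minimalPeriod, st_even (even_prod_minimalPeriod h)] at h1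
  rw [wt, wt, minimalPeriod_glue, h1]

theorem wt_iterate [Finite X] {x : X} (h : S.Avoids S.outer x) (k : ℕ) :
    S.wt (S.next^[k] x) = S.wt x := by
  induction k with
  | zero => rfl
  | succ k ih => rw [Function.iterate_succ_apply', wt_next (h.iterate k), ih]

theorem wt_conn [Finite X] {x y : X} (h : S.Avoids S.outer x) (hc : S.Conn x y) :
    S.wt y = S.wt x := by
  rcases hc with ⟨k, rfl⟩ | ⟨k, hk⟩
  · exact wt_iterate h k
  · have h1 := wt_glue (h.iterate k)
    rw [hk, S.glue_glue] at h1
    rw [h1, ← hk, wt_iterate h]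

/-- Viewing a cycle as the first return to one of its points makes its product a `Hit`, so that
transport lemmas such as `Hit.map` apply to cycles. -/
theorem hit_singleton [Finite X] (x : X) :
    S.Hit {x} x x (S.prod x (Function.minimalPeriod S.next x)) := by
  rw [hit_iff]
  have hx := Function.minimalPeriod_pos_of_mem_periodicPts (S.next_injective.mem_periodicPts x)
  refine ⟨Function.minimalPeriod S.next x - 1, ?_, rfl, fun j h0 hj => ?_, ?_⟩
  · rw [Nat.sub_add_cancel hx, Function.iterate_minimalPeriod]
  · exact Function.not_isPeriodicPt_of_pos_of_lt_minimalPeriod (by omega) (by omega)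
  · rw [Nat.sub_add_cancel hx]

theorem wt_eq_of_hit [Finite X] {x : X} {d : ℤ} (h : S.Hit {x} x x d) : S.wt x = d.natAbs / 2 := by
  rw [wt, (h.unique (hit_singleton x)).2]

variable (S) in
/-- A set of representatives of the cycles that do not meet `B`. -/
structure IsReps (B : Set X) (R : Finset X) : Prop where
  avoids : ∀ x ∈ R, S.Avoids B x
  eq_of_conn : ∀ x ∈ R, ∀ y ∈ R, S.Conn x y → x = y
  exists_conn : ∀ x, S.Avoids B x → ∃ y ∈ R, S.Conn x y

/-- Sending each representative to the one of its class in the other set is a bijection, and `wt` is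
constant on classes. -/
theorem IsReps.prod_eq [Finite X] {M : Type*} [CommMonoid M] {R R' : Finset X}
    (hR : S.IsReps S.outer R) (hR' : S.IsReps S.outer R') (f : ℕ → M) :
    ∏ x ∈ R, f (S.wt x) = ∏ x ∈ R', f (S.wt x) := by
  classical
  have h1 : ∀ x : X, ∃ y, x ∈ R → y ∈ R' ∧ S.Conn x y := fun x => by
    by_cases hx : x ∈ R
    · obtain ⟨y, hy⟩ := hR'.exists_conn x (hR.avoids x hx)
      exact ⟨y, fun _ => hy⟩
    · exact ⟨x, fun h => absurd h hx⟩
  choose g hg using h1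
  refine Finset.prod_bij (fun x _ => g x) (fun x hx => (hg x hx).1) ?_ ?_ ?_
  · intro x hx y hy hxy
    change g x = g y at hxy
    refine hR.eq_of_conn x hx y hy ((hg x hx).2.trans ?_)
    rw [hxy]
    exact (hg y hy).2.symm
  · intro y hy
    obtain ⟨x, hx, hxy⟩ := hR.exists_conn y (hR'.avoids y hy)
    refine ⟨x, hx, hR'.eq_of_conn _ (hg x hx).1 _ hy ((hg x hx).2.symm.trans hxy.symm)⟩
  · intro x hx
    rw [wt_conn (hR.avoids x hx) (hg x hx).2]

/-! #### Elimination of a part of the gluing -/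

variable (S) in
/-- The system `S'` consists of the points of `S` that remain when the gluings of `S''` have been
carried out. -/
structure Elimination {Z : Type*} (S' : Sys Y) (S'' : Sys Z) (ι : Y → X) (κ : Z → X) : Prop where
  injective : Function.Injective ι
  hit : ∀ y, S.Hit (Set.range ι) (ι y) (ι (S'.next y)) (S'.lab y)
  map_glue : ∀ y, ι (S'.glue y) = S.glue (ι y)
  outer_subset : S.outer ⊆ Set.range ι
  injective' : Function.Injective κ
  mem_range_iff : ∀ z, κ z ∈ Set.range ι ↔ z ∈ S''.outer
  exists_eq : ∀ x, x ∉ Set.range ι → ∃ z, κ z = x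
  next_eq : ∀ z, S''.next z ∉ S''.outer → S.next (κ z) = κ (S''.next z)
  next_mem : ∀ z, S''.next z ∈ S''.outer → S.next (κ z) ∈ Set.range ι
  lab_eq : ∀ z, S.lab (κ z) = S''.lab z
  glue_eq : ∀ z, z ∉ S''.outer → S.glue (κ z) = κ (S''.glue z)

namespace Elimination

variable {Z : Type*} {S' : Sys Y} {S'' : Sys Z} {ι : Y → X} {κ : Z → X}

theorem mem_outer_iff (h : S.Elimination S' S'' ι κ) (y : Y) : ι y ∈ S.outer ↔ y ∈ S'.outer := by
  rw [Sys.mem_outer, Sys.mem_outer, ← h.map_glue, h.injective.eq_iff]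

theorem exists_iterate_map (h : S.Elimination S' S'' ι κ) (y : Y) (k : ℕ) :
    ∃ l, S.next^[l] (ι y) = ι (S'.next^[k] y) := by
  induction k with
  | zero => exact ⟨0, rfl⟩
  | succ k ih =>
    obtain ⟨l, hl⟩ := ih
    obtain ⟨m, hm, -⟩ := hit_iff.1 (h.hit (S'.next^[k] y))
    exact ⟨m + 1 + l, by rw [Function.iterate_add_apply, hl, hm, Function.iterate_succ_apply']⟩

/-- A nonempty path between two remaining points cannot end before the first return of its origin,
so it factors through that return; strong induction handles the shorter rest. -/
theorem exists_iterate_of_map (h : S.Elimination S' S'' ι κ) {y z : Y} {k : ℕ}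
    (hk : S.next^[k] (ι y) = ι z) : ∃ l, S'.next^[l] y = z := by
  induction k using Nat.strong_induction_on generalizing y with
  | _ k ih =>
    rcases Nat.eq_zero_or_pos k with rfl | h0
    · exact ⟨0, h.injective hk⟩
    · obtain ⟨m, hm, -, hm', -⟩ := hit_iff.1 (h.hit y)
      rcases Nat.lt_or_ge m k with h1 | h1
      · obtain ⟨l, hl⟩ := ih (k - (m + 1)) (by omega) (y := S'.next y) (by
          rw [← hm, ← Function.iterate_add_apply, Nat.sub_add_cancel h1, hk])
        exact ⟨l + 1, hl⟩
      · exact absurd ⟨z, hk.symm⟩ (hm' k h0 h1)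

theorem conn_iff (h : S.Elimination S' S'' ι κ) {y z : Y} :
    S.Conn (ι y) (ι z) ↔ S'.Conn y z := by
  unfold Conn
  rw [← h.map_glue]
  constructor
  · rintro (⟨k, hk⟩ | ⟨k, hk⟩)
    · exact Or.inl (h.exists_iterate_of_map hk)
    · exact Or.inr (h.exists_iterate_of_map hk)
  · rintro (⟨k, hk⟩ | ⟨k, hk⟩)
    · obtain ⟨l, hl⟩ := h.exists_iterate_map y k
      exact Or.inl ⟨l, by rw [hl, hk]⟩
    · obtain ⟨l, hl⟩ := h.exists_iterate_map y k
      exact Or.inr ⟨l, by rw [hl, hk]⟩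

theorem avoids_iff (h : S.Elimination S' S'' ι κ) {y : Y} :
    S.Avoids S.outer (ι y) ↔ S'.Avoids S'.outer y := by
  constructor
  · intro hy k hk
    obtain ⟨l, hl⟩ := h.exists_iterate_map y k
    refine hy l ?_
    rwa [hl, h.mem_outer_iff]
  · intro hy k hk
    obtain ⟨z, hz⟩ := h.outer_subset hk
    obtain ⟨l, hl⟩ := h.exists_iterate_of_map hz.symm
    refine hy l ?_
    rwa [hl, ← h.mem_outer_iff, hz]

theorem iterate_eq (h : S.Elimination S' S'' ι κ) {z : Z} (hz : S''.Avoids S''.outer z) (k : ℕ) :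
    S.next^[k] (κ z) = κ (S''.next^[k] z) := by
  induction k with
  | zero => rfl
  | succ k ih =>
    rw [Function.iterate_succ_apply', Function.iterate_succ_apply', ih, h.next_eq]
    have := hz (k + 1)
    rwa [Function.iterate_succ_apply'] at this

theorem avoids_map (h : S.Elimination S' S'' ι κ) {z : Z} (hz : S''.Avoids S''.outer z) :
    S.Avoids S.outer (κ z) := fun k hk => by
  rw [h.iterate_eq hz] at hk
  exact hz k ((h.mem_range_iff _).1 (h.outer_subset hk))

theorem conn_of_conn_map (h : S.Elimination S' S'' ι κ) {z w : Z} (hz : S''.Avoids S''.outer z)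
    (hw : S''.Avoids S''.outer w) (hc : S.Conn (κ z) (κ w)) : S''.Conn z w := by
  unfold Conn at hc
  rw [h.glue_eq w (hw 0)] at hc
  simp only [h.iterate_eq hz, h.injective'.eq_iff] at hc
  exact hc

theorem conn_map (h : S.Elimination S' S'' ι κ) {z w : Z} (hz : S''.Avoids S''.outer z)
    (hw : S''.Avoids S''.outer w) (hc : S''.Conn z w) : S.Conn (κ z) (κ w) := by
  unfold Conn
  rw [h.glue_eq w (hw 0)]
  simp only [h.iterate_eq hz, h.injective'.eq_iff]
  exact hc

/-- A cycle closed by the gluings of `S''` stays in the image of `κ` at points that are not outer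
for `S''`, and those are never remaining points. -/
theorem not_conn (h : S.Elimination S' S'' ι κ) {z : Z} (hz : S''.Avoids S''.outer z) (y : Y) :
    ¬ S.Conn (κ z) (ι y) := by
  unfold Conn
  rw [← h.map_glue]
  simp only [h.iterate_eq hz]
  rintro (⟨k, hk⟩ | ⟨k, hk⟩)
  · exact hz k ((h.mem_range_iff _).1 ⟨_, hk.symm⟩)
  · exact hz k ((h.mem_range_iff _).1 ⟨_, hk.symm⟩)

theorem avoids_of_iterate_not_mem (h : S.Elimination S' S'' ι κ) {z : Z}
    (hz : ∀ k, S.next^[k] (κ z) ∉ Set.range ι) : S''.Avoids S''.outer z := by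
  have key : ∀ k, S.next^[k] (κ z) = κ (S''.next^[k] z) := by
    intro k
    induction k with
    | zero => rfl
    | succ k ih =>
      rw [Function.iterate_succ_apply', Function.iterate_succ_apply', ih, h.next_eq]
      intro hc
      refine hz (k + 1) ?_
      rw [Function.iterate_succ_apply', ih]
      exact h.next_mem _ hc
  intro k hk
  refine hz k ?_
  rw [key, h.mem_range_iff]
  exact hk

/-- The return of `S'` to `y` maps to the return of `S` to `ι y`, with the same product, although it
may take many more steps. -/
theorem wt_map [Finite X] [Finite Y] (h : S.Elimination S' S'' ι κ) (y : Y) :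
    S.wt (ι y) = S'.wt y := by
  have h1 := (hit_singleton (S := S') y).map h.injective h.hit
  rw [Set.image_singleton] at h1
  exact wt_eq_of_hit h1

theorem hit_map (h : S.Elimination S' S'' ι κ) {C : Set Z} {z w : Z} {d : ℤ}
    (hz : S''.Avoids S''.outer z) (hh : S''.Hit C z w d) : S.Hit (κ '' C) (κ z) (κ w) d := by
  induction hh with
  | one x hx =>
    have hn := h.next_eq x (hz 1)
    rw [← h.lab_eq, ← hn]
    refine Hit.one _ ?_
    rw [hn]
    exact ⟨_, hx, rfl⟩
  | step x y d hx hd ih =>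
    have hn := h.next_eq x (hz 1)
    rw [← h.lab_eq]
    refine Hit.step _ _ _ ?_ ?_
    · rwa [hn, h.injective'.mem_set_image]
    · rw [hn]
      exact ih hz.next

theorem wt_map' [Finite X] [Finite Z] (h : S.Elimination S' S'' ι κ) {z : Z}
    (hz : S''.Avoids S''.outer z) : S.wt (κ z) = S''.wt z := by
  have h1 := h.hit_map hz (hit_singleton (S := S'') z)
  rw [Set.image_singleton] at h1
  exact wt_eq_of_hit h1

theorem isReps [Finite X] [Finite Y] [Finite Z] [DecidableEq X]
    (h : S.Elimination S' S'' ι κ) {R' : Finset Y} {R'' : Finset Z} (hR' : S'.IsReps S'.outer R')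
    (hR'' : S''.IsReps S''.outer R'') :
    S.IsReps S.outer (R'.image ι ∪ R''.image κ) where
  avoids x hx := by
    simp only [Finset.mem_union, Finset.mem_image] at hx
    rcases hx with ⟨y, hy, rfl⟩ | ⟨z, hz, rfl⟩
    · exact h.avoids_iff.2 (hR'.avoids y hy)
    · exact h.avoids_map (hR''.avoids z hz)
  eq_of_conn x hx x' hx' hc := by
    simp only [Finset.mem_union, Finset.mem_image] at hx hx'
    rcases hx with ⟨y, hy, rfl⟩ | ⟨z, hz, rfl⟩ <;> rcases hx' with ⟨y', hy', rfl⟩ | ⟨z', hz', rfl⟩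
    · rw [hR'.eq_of_conn y hy y' hy' (h.conn_iff.1 hc)]
    · exact absurd hc.symm (h.not_conn (hR''.avoids z' hz') y)
    · exact absurd hc (h.not_conn (hR''.avoids z hz) y')
    · rw [hR''.eq_of_conn z hz z' hz'
        (h.conn_of_conn_map (hR''.avoids z hz) (hR''.avoids z' hz') hc)]
  exists_conn x hx := by
    -- A cycle either passes through a remaining point, and is then a cycle of `S'`, or it has been
    -- closed entirely by the gluings of `S''`.
    by_cases hc : ∃ k, S.next^[k] x ∈ Set.range ι
    · obtain ⟨k, y, hy⟩ := hc
      have h1 := hx.iterate k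
      rw [← hy, h.avoids_iff] at h1
      obtain ⟨z, hz, hyz⟩ := hR'.exists_conn y h1
      refine ⟨ι z, Finset.mem_union_left _ (Finset.mem_image_of_mem _ hz), ?_⟩
      have h2 : S.Conn x (ι y) := Or.inl ⟨k, hy.symm⟩
      exact h2.trans (h.conn_iff.2 hyz)
    · push Not at hc
      obtain ⟨z, rfl⟩ := h.exists_eq x (hc 0)
      have hz := h.avoids_of_iterate_not_mem hc
      obtain ⟨w, hw, hzw⟩ := hR''.exists_conn z hz
      exact ⟨κ w, Finset.mem_union_right _ (Finset.mem_image_of_mem _ hw),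
        h.conn_map hz (hR''.avoids w hw) hzw⟩

theorem prod_eq [Finite X] [Finite Y] [Finite Z] {M : Type*} [CommMonoid M]
    (h : S.Elimination S' S'' ι κ) {R : Finset X} {R' : Finset Y} {R'' : Finset Z}
    (hR : S.IsReps S.outer R) (hR' : S'.IsReps S'.outer R') (hR'' : S''.IsReps S''.outer R'')
    (f : ℕ → M) :
    ∏ x ∈ R, f (S.wt x) = (∏ y ∈ R', f (S'.wt y)) * ∏ z ∈ R'', f (S''.wt z) := by
  classical
  rw [hR.prod_eq (h.isReps hR' hR'') f, Finset.prod_union]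
  · rw [Finset.prod_image fun _ _ _ _ e => h.injective e,
      Finset.prod_image fun _ _ _ _ e => h.injective' e]
    simp only [h.wt_map]
    congr 1
    exact Finset.prod_congr rfl fun z hz => by rw [h.wt_map' (hR''.avoids z hz)]
  · rw [Finset.disjoint_left]
    intro x hx hx'
    simp only [Finset.mem_image] at hx hx'
    obtain ⟨y, hy, rfl⟩ := hx
    obtain ⟨z, hz, hzy⟩ := hx'
    exact h.not_conn (hR''.avoids z hz) y (Or.inl ⟨0, hzy⟩)

end Elimination

end Sys

end ArrowTL

/-! ### Directed labels, and concatenation in terms of their products. -/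

namespace ArrowTL

open FlatTangle

namespace ArrowTangle

variable {n : ℕ}

/-- The label of the pair that contains `v`, run through starting from `v`. -/
def dir (F : ArrowTangle n) (v : Vertex n) : ℤ :=
  if pos v < pos (F.partner v) then F.label v else st (F.label v)

theorem pos_partner_ne (F : ArrowTangle n) (v : Vertex n) : pos (F.partner v) ≠ pos v :=
  fun h => F.partner_ne v (pos_injective h)

theorem dir_partner (F : ArrowTangle n) (v : Vertex n) : F.dir (F.partner v) = st (F.dir v) := by
  have h := F.pos_partner_ne v
  unfold dir
  rw [F.partner_partner, F.label_partner]
  split_ifs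
  · omega
  · rw [st_st]
  · rfl
  · omega

theorem odd_dir (F : ArrowTangle n) (v : Vertex n) :
    Odd (F.dir v) ↔ (F.partner v).1 = v.1 := by
  rw [← F.odd_label_iff, dir]
  split_ifs
  · rfl
  · rw [← Int.not_even_iff_odd, even_st, Int.not_even_iff_odd]

theorem label_eq (F : ArrowTangle n) (v : Vertex n) :
    F.label v = if pos v < pos (F.partner v) then F.dir v else st (F.dir v) := by
  unfold dir
  split_ifs
  · rfl
  · rw [st_st]

theorem ext_dir {F F' : ArrowTangle n} (h : ∀ v, F.partner v = F'.partner v)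
    (h' : ∀ v, F.dir v = F'.dir v) : F = F' := by
  refine ArrowTangle.ext (funext h) (funext fun v => ?_)
  rw [label_eq, label_eq, h, h']

/-- The arrow tangle with given pairs and given directed labels. -/
def ofDir (E : FlatTangle n) (d : Vertex n → ℤ) (hd : ∀ v, d (E.partner v) = st (d v))
    (ho : ∀ v, Odd (d v) ↔ (E.partner v).1 = v.1) : ArrowTangle n where
  toFlatTangle := E
  label v := if pos v < pos (E.partner v) then d v else st (d v)
  label_partner v := by
    have h : pos (E.partner v) ≠ pos v := fun h => E.partner_ne v (pos_injective h)
    rw [E.partner_partner, hd, st_st]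
    split_ifs <;> first | rfl | omega
  odd_label_iff v := by
    rw [← ho]
    split_ifs
    · rfl
    · rw [← Int.not_even_iff_odd, even_st, Int.not_even_iff_odd]

@[simp] theorem ofDir_dir (E : FlatTangle n) (d : Vertex n → ℤ) (hd) (ho) (v : Vertex n) :
    (ofDir E d hd ho).dir v = d v := by
  unfold dir ofDir
  dsimp only
  split_ifs <;> simp

/-! ### The system of two concatenated tangles -/

/-- The pairs of `F ⊔ F'`, glued. -/
def pairSys (F F' : ArrowTangle n) : Sys (Point n) where
  opp := opposite F.toFlatTangle F'.toFlatTangle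
  glue := glue
  lab p := if p.1 = true then F'.dir p.2 else F.dir p.2
  side p := p.2.1
  opp_opp := opposite_opposite _ _
  glue_glue := glue_glue
  lab_opp := by
    rintro ⟨k, v⟩
    cases k <;> simp [opposite, dir_partner]
  odd_lab := by
    rintro ⟨k, v⟩
    cases k <;> simp [opposite, odd_dir]
  side_glue p h := by
    have h1 : ¬ IsOuter p := fun h' => h (glue_of_isOuter h')
    rw [glue_side]
    rwa [isOuter_glue]

variable (F F' F'' : ArrowTangle n)

theorem pairSys_next_eq :
    (pairSys F F').next = FlatTangle.next F.toFlatTangle F'.toFlatTangle := rfl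

theorem mem_pairSys_outer {p : Point n} : p ∈ (pairSys F F').outer ↔ IsOuter p := by
  constructor
  · intro h
    by_contra hc
    have h' : glue p = p := h
    rw [glue, if_neg hc] at h'
    simpa using congrArg Prod.fst h'
  · exact glue_of_isOuter

theorem parity_eq (p : Point n) :
    parity F.toFlatTangle F'.toFlatTangle p = sg ((pairSys F F').lab p) := by
  have h : Odd ((pairSys F F').lab p) ↔
      (opposite F.toFlatTangle F'.toFlatTangle p).2.1 = p.2.1 := (pairSys F F').odd_lab p
  by_cases h' : Odd ((pairSys F F').lab p)
  · rw [sg_odd h', parity, if_pos (h.1 h')]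
  · rw [sg_even (Int.not_odd_iff_even.1 h'), parity, if_neg (fun hc => h' (h.2 hc))]

/-- The parities of the preceding pairs multiply to the sign of the product so far, and the
additional own parity of a pair run backwards is exactly the effect of `st` on its label. The
statement about signs is carried along because the next summand needs it. -/
theorem pathSum_eq_prod (p : Point n) (l : ℕ) :
    pathSum F F' p l = (pairSys F F').prod p l ∧
      ∏ j ∈ Finset.range l, parity F.toFlatTangle F'.toFlatTangle
        ((FlatTangle.next F.toFlatTangle F'.toFlatTangle)^[j] p) =
        sg ((pairSys F F').prod p l) := by
  induction l with
  | zero => simp [pathSum, Sys.prod, sg]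
  | succ l ih =>
    obtain ⟨h1, h2⟩ := ih
    constructor
    · rw [pathSum, Finset.sum_range_succ, ← pathSum, h1, Sys.prod, tw, ← h2, pairSys_next_eq]
      congr 1
      rw [cumulatedParity]
      generalize hq : (FlatTangle.next F.toFlatTangle F'.toFlatTangle)^[l] p = q
      have h3 : parity F.toFlatTangle F'.toFlatTangle q * labelAt F F' q = st (labelAt F F' q) := by
        have h5 := odd_labelAt_iff F F' q
        by_cases h' : Odd (labelAt F F' q)
        · rw [st_odd h', parity, if_pos (h5.1 h'), neg_one_mul]
        · rw [st_even (Int.not_odd_iff_even.1 h'), parity, if_neg (fun hc => h' (h5.2 hc)), one_mul]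
      have h4 : (pairSys F F').lab q =
          if pos q.2 < pos (opposite F.toFlatTangle F'.toFlatTangle q).2 then labelAt F F' q
          else st (labelAt F F' q) := by
        rcases q with ⟨k, v⟩
        cases k <;> rfl
      rw [h4]
      split_ifs
      · rfl
      · rw [Finset.prod_range_succ, hq, mul_assoc, h3]
    · rw [Finset.prod_range_succ, h2, Sys.prod, sg_tw, pairSys_next_eq, parity_eq]

theorem hit_arc (v : Vertex n) : (pairSys F F').Hit (pairSys F F').outer (outerPoint v)
    (outerPoint (arcEnd F.toFlatTangle F'.toFlatTangle v)) (arcSum F F' v) := by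
  rw [Sys.hit_iff]
  have h0 := arcLength_pos F.toFlatTangle F'.toFlatTangle v
  -- In `hit_iff` the number of steps is `k + 1`.
  refine ⟨arcLength F.toFlatTangle F'.toFlatTangle v - 1, ?_, ?_, fun j hj hj' => ?_, ?_⟩
  · rw [Nat.sub_add_cancel h0, outerPoint_arcEnd]
    rfl
  · rw [mem_pairSys_outer]
    exact isOuter_outerPoint _
  · rw [mem_pairSys_outer]
    exact not_isOuter_of_lt _ _ v hj (by omega)
  · rw [Nat.sub_add_cancel h0, arcSum, (pathSum_eq_prod F F' _ _).1]

theorem arcSum_arcEnd (v : Vertex n) :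
    arcSum F F' (arcEnd F.toFlatTangle F'.toFlatTangle v) = st (arcSum F F' v) := by
  have h := (hit_arc F F' v).reverse (fun z => (pairSys F F').glue_mem_outer)
    ((mem_pairSys_outer F F').2 (isOuter_outerPoint _))
  have h1 : (pairSys F F').glue (outerPoint (arcEnd F.toFlatTangle F'.toFlatTangle v)) =
    outerPoint (arcEnd F.toFlatTangle F'.toFlatTangle v) := glue_of_isOuter (isOuter_outerPoint _)
  rw [h1] at h
  exact ((hit_arc F F' _).unique h).2

/-- `comp` evaluates the arc from its lower end only; seen from the upper end, reversal of the arc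
gives `st` of this sum, in agreement with the definition of `dir`. -/
theorem comp_dir (v : Vertex n) : (F.comp F').dir v = arcSum F F' v := by
  unfold dir
  change (if pos v < pos (arcEnd _ _ v) then arcSum F F' (FlatTangle.lower _ v) else
    st (arcSum F F' (FlatTangle.lower _ v))) = _
  unfold FlatTangle.lower
  change (if pos v < pos (arcEnd _ _ v) then arcSum F F' (if pos v < pos (arcEnd _ _ v) then v else
    (arcEnd _ _ v)) else
    st (arcSum F F' (if pos v < pos (arcEnd _ _ v) then v else (arcEnd _ _ v)))) = _
  split_ifs
  · rfl
  · rw [arcSum_arcEnd, st_st]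

theorem hit_comp (v : Vertex n) : (pairSys F F').Hit (pairSys F F').outer (outerPoint v)
    (outerPoint ((F.comp F').partner v)) ((F.comp F').dir v) := by
  rw [comp_dir]
  exact hit_arc F F' v

/-- The entry points of the representatives of the cycles. -/
noncomputable def cycleReps : Finset (Point n) :=
  (cycles F.toFlatTangle F'.toFlatTangle).map
    ⟨fun b => (false, (true, b)), fun b c h => by simpa using h⟩

theorem mem_cycles {E E' : FlatTangle n} {b : Fin n} : b ∈ cycles E E' ↔ ∀ k : ℕ,
    ¬ IsOuter ((FlatTangle.next E E')^[k] (false, (true, b))) ∧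
      b ≤ ((FlatTangle.next E E')^[k] (false, (true, b))).2.2 := by
  simp [cycles]

theorem glue_snd_snd (p : Point n) : (glue p).2.2 = p.2.2 := by
  unfold glue
  split_ifs <;> rfl

theorem isReps_cycleReps :
    (pairSys F F').IsReps (pairSys F F').outer (cycleReps F F') where
  avoids x hx k := by
    simp only [cycleReps, Finset.mem_map] at hx
    obtain ⟨b, hb, rfl⟩ := hx
    rw [mem_pairSys_outer]
    exact (mem_cycles.1 hb k).1
  eq_of_conn x hx y hy hc := by
    simp only [cycleReps, Finset.mem_map] at hx hy
    obtain ⟨b, hb, rfl⟩ := hx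
    obtain ⟨c, hc', rfl⟩ := hy
    have key : ∀ b c, b ∈ cycles F.toFlatTangle F'.toFlatTangle →
        (pairSys F F').Conn (false, (true, b)) (false, (true, c)) → b ≤ c := by
      rintro b c hb (⟨k, hk⟩ | ⟨k, hk⟩)
      · have := (mem_cycles.1 hb k).2
        rwa [← pairSys_next_eq, hk] at this
      · have := (mem_cycles.1 hb k).2
        rw [← pairSys_next_eq, hk] at this
        exact this.trans_eq (glue_snd_snd _)
    rw [le_antisymm (key b c hb hc) (key c b hc' hc.symm)]
  exists_conn x hx := by
    classical
    obtain ⟨m, hm, hp⟩ := (pairSys F F').next_injective.mem_periodicPts x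
    obtain ⟨k, -, hk⟩ := Finset.exists_min_image (Finset.range m)
      (fun k => ((pairSys F F').next^[k] x).2.2) ⟨0, Finset.mem_range.2 hm⟩
    -- It suffices to minimise the position over one period, and glued points have the same
    -- position, so reversed paths add nothing.
    have hmin : ∀ y, (pairSys F F').Conn x y → ((pairSys F F').next^[k] x).2.2 ≤ y.2.2 := by
      have h1 : ∀ j, ((pairSys F F').next^[k] x).2.2 ≤ ((pairSys F F').next^[j] x).2.2 := by
        intro j
        rw [← hp.iterate_mod_apply j]
        exact hk _ (Finset.mem_range.2 (Nat.mod_lt _ hm))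
      rintro y (⟨j, rfl⟩ | ⟨j, hj⟩)
      · exact h1 j
      · have := h1 j
        rw [hj] at this
        exact this.trans_eq (glue_snd_snd _)
    set q := (pairSys F F').next^[k] x with hq
    have hxq : (pairSys F F').Conn x q := Or.inl ⟨k, rfl⟩
    have hqo : ¬ IsOuter q := by
      rw [← mem_pairSys_outer F F']
      exact hx k
    -- The minimum may be attained at the point (0,b) of the second tangle; it is glued to the point
    -- (1,b) of the first, which lies on the same cycle.
    have hr : (pairSys F F').Conn x (false, (true, q.2.2)) := by
      rcases hq' : q with ⟨s, s', b⟩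
      rw [hq'] at hxq hqo
      cases s <;> cases s'
      · exact absurd rfl hqo
      · exact hxq
      · refine hxq.trans (Or.inr ⟨0, ?_⟩)
        rfl
      · exact absurd rfl hqo
    refine ⟨_, ?_, hr⟩
    simp only [cycleReps, Finset.mem_map]
    refine ⟨q.2.2, mem_cycles.2 fun j => ?_, rfl⟩
    have hc : (pairSys F F').Conn (false, (true, q.2.2))
        ((pairSys F F').next^[j] (false, (true, q.2.2))) := Or.inl ⟨j, rfl⟩
    refine ⟨?_, ?_⟩
    · have := Sys.Avoids.conn (fun z => (pairSys F F').glue_mem_outer) hx (hr.trans hc) 0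
      rwa [mem_pairSys_outer] at this
    · exact hmin _ (hr.trans hc)

theorem loopWeight_eq : F.loopWeight F' =
    ∏ x ∈ cycleReps F F', (MvPolynomial.X ((pairSys F F').wt x) : R0a) := by
  rw [cycleReps, Finset.prod_map, loopWeight]
  refine Finset.prod_congr rfl fun b _ => ?_
  rw [zigzag, (pathSum_eq_prod F F' _ _).1]
  rfl

/-! ### Three concatenated tangles -/

/-- The gluing of the end points of three concatenated tangles. -/
def glueThree : Fin 3 × Vertex n → Fin 3 × Vertex n
  | (0, (true, b)) => (1, (false, b))
  | (1, (false, b)) => (0, (true, b))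
  | (1, (true, b)) => (2, (false, b))
  | (2, (false, b)) => (1, (true, b))
  | (0, (false, b)) => (0, (false, b))
  | (2, (true, b)) => (2, (true, b))

/-- The pairs of three concatenated tangles, glued. -/
def tripleSys (T : Fin 3 → ArrowTangle n) : Sys (Fin 3 × Vertex n) where
  opp p := (p.1, (T p.1).partner p.2)
  glue := glueThree
  lab p := (T p.1).dir p.2
  side p := p.2.1
  opp_opp p := by simp [partner_partner]
  glue_glue := by
    rintro ⟨i, s, b⟩
    fin_cases i <;> cases s <;> rfl
  lab_opp p := dir_partner _ _
  odd_lab p := odd_dir _ _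
  side_glue := by
    rintro ⟨i, s, b⟩
    fin_cases i <;> cases s <;> simp [glueThree]

end ArrowTangle

/-! ### Elimination from maps that respect the pairing. -/

namespace Sys

variable {X Y Z : Type*} {S : Sys X} {S' : Sys Y} {S'' : Sys Z} {ι : Y → X} {κ : Z → X}

/-- The end `w` of an arc of `S''` is free there, but in `S` it may be glued to a point outside. The
path of `S` carries out this last gluing, which explains `S.glue (κ w)`. -/
theorem hit_map_outer (map_glue : ∀ y, ι (S'.glue y) = S.glue (ι y))
    (mem_range_iff : ∀ z, κ z ∈ Set.range ι ↔ z ∈ S''.outer)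
    (opp_eq : ∀ z, S.opp (κ z) = κ (S''.opp z)) (lab_eq : ∀ z, S.lab (κ z) = S''.lab z)
    (glue_eq : ∀ z, z ∉ S''.outer → S.glue (κ z) = κ (S''.glue z))
    {z w : Z} {d : ℤ} (h : S''.Hit S''.outer z w d) :
    S.Hit (Set.range ι) (κ z) (S.glue (κ w)) d := by
  induction h with
  | one x hx =>
    have hx' := hx
    rw [next, S''.glue_mem_outer] at hx'
    obtain ⟨y, hy⟩ := (mem_range_iff _).2 hx'
    have h2 : S''.next x = S''.opp x := hx'
    have h1 : S.next (κ x) = S.glue (κ (S''.next x)) := by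
      rw [next, opp_eq, h2]
    rw [← lab_eq, ← h1]
    refine Hit.one _ ?_
    rw [h1, h2, ← hy, ← map_glue]
    exact ⟨_, rfl⟩
  | step x y d hx hd ih =>
    have hx' := hx
    rw [next, S''.glue_mem_outer] at hx'
    have h1 : S.next (κ x) = κ (S''.next x) := by
      rw [next, opp_eq, glue_eq _ hx', next]
    rw [← lab_eq]
    refine Hit.step _ _ _ ?_ ?_
    · rwa [h1, mem_range_iff]
    · rwa [h1]

theorem Elimination.of_opp (injective : Function.Injective ι)
    (hit : ∀ y, S.Hit (Set.range ι) (ι y) (ι (S'.next y)) (S'.lab y))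
    (map_glue : ∀ y, ι (S'.glue y) = S.glue (ι y))
    (outer_subset : S.outer ⊆ Set.range ι)
    (injective' : Function.Injective κ)
    (mem_range_iff : ∀ z, κ z ∈ Set.range ι ↔ z ∈ S''.outer)
    (exists_eq : ∀ x, x ∉ Set.range ι → ∃ z, κ z = x)
    (opp_eq : ∀ z, S.opp (κ z) = κ (S''.opp z)) (lab_eq : ∀ z, S.lab (κ z) = S''.lab z)
    (glue_eq : ∀ z, z ∉ S''.outer → S.glue (κ z) = κ (S''.glue z)) :
    S.Elimination S' S'' ι κ where
  injective := injective
  hit := hit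
  map_glue := map_glue
  outer_subset := outer_subset
  injective' := injective'
  mem_range_iff := mem_range_iff
  exists_eq := exists_eq
  next_eq z hz := by
    rw [next, S''.glue_mem_outer] at hz
    rw [next, opp_eq, glue_eq _ hz, next]
  next_mem z hz := by
    rw [next, S''.glue_mem_outer] at hz
    obtain ⟨y, hy⟩ := (mem_range_iff _).2 hz
    rw [next, opp_eq, ← hy, ← map_glue]
    exact ⟨_, rfl⟩
  lab_eq := lab_eq
  glue_eq := glue_eq

end Sys

end ArrowTL

/-! ### Associativity of concatenation. -/

namespace ArrowTL

open FlatTangle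

namespace ArrowTangle

variable {n : ℕ} (F F' F'' : ArrowTangle n)

theorem outerPoint_mem (v : Vertex n) : outerPoint v ∈ (pairSys F F').outer :=
  (mem_pairSys_outer F F').2 (isOuter_outerPoint v)

/-- The end points of `F * F'` and `F''` among those of `F`, `F'` and `F''`. -/
def embedLeft : Point n → Fin 3 × Vertex n
  | (false, (false, b)) => (0, (false, b))
  | (false, (true, b)) => (1, (true, b))
  | (true, v) => (2, v)

/-- The end points of `F` and `F' * F''` among those of `F`, `F'` and `F''`. -/
def embedRight : Point n → Fin 3 × Vertex n
  | (false, v) => (0, v)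
  | (true, (false, b)) => (1, (false, b))
  | (true, (true, b)) => (2, (true, b))

theorem mem_tripleSys_outer {T : Fin 3 → ArrowTangle n} {p : Fin 3 × Vertex n} :
    p ∈ (tripleSys T).outer ↔ glueThree p = p := Iff.rfl

/-- A pair of `F * F'` stands for a whole arc of `F ⊔ F'`, which `hit_comp` turns into a first
return in the triple; a pair of `F''` is a single step. -/
theorem elimination_left : (tripleSys ![F, F', F'']).Elimination (pairSys (F.comp F') F'')
    (pairSys F F') embedLeft (fun p => (if p.1 = true then 1 else 0, p.2)) := by
  have hg : ∀ y : Point n, embedLeft ((pairSys (F.comp F') F'').glue y) =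
      (tripleSys ![F, F', F'']).glue (embedLeft y) := by
    rintro ⟨k, s, b⟩
    cases k <;> cases s <;> rfl
  have hm : ∀ z : Point n, ((if z.1 = true then 1 else 0, z.2) : Fin 3 × Vertex n) ∈
      Set.range embedLeft ↔ z ∈ (pairSys F F').outer := by
    intro z
    rw [mem_pairSys_outer, Set.mem_range]
    constructor
    · rintro ⟨⟨k, s, b⟩, h⟩
      rcases z with ⟨l, s', b'⟩
      cases k <;> cases s <;> cases l <;> cases s' <;> simp [embedLeft, IsOuter] at h ⊢
    · intro h
      rcases z with ⟨l, s', b'⟩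
      refine ⟨(false, (s', b')), ?_⟩
      cases l <;> cases s' <;> simp [embedLeft, IsOuter] at h ⊢
  have ho : ∀ z : Point n, (tripleSys ![F, F', F'']).opp (if z.1 = true then 1 else 0, z.2) =
      (if ((pairSys F F').opp z).1 = true then 1 else 0, ((pairSys F F').opp z).2) := by
    rintro ⟨k, v⟩
    cases k <;> rfl
  have hl : ∀ z : Point n, (tripleSys ![F, F', F'']).lab (if z.1 = true then 1 else 0, z.2) =
      (pairSys F F').lab z := by
    rintro ⟨k, v⟩
    cases k <;> rfl
  have hgl : ∀ z : Point n, z ∉ (pairSys F F').outer →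
      (tripleSys ![F, F', F'']).glue (if z.1 = true then 1 else 0, z.2) =
      (if ((pairSys F F').glue z).1 = true then 1 else 0, ((pairSys F F').glue z).2) := by
    rintro ⟨k, s, b⟩ h
    rw [mem_pairSys_outer] at h
    cases k <;> cases s <;> first | rfl | exact absurd rfl h
  refine Sys.Elimination.of_opp ?_ ?_ hg ?_ ?_ hm ?_ ho hl hgl
  · rintro ⟨k, s, b⟩ ⟨l, s', b'⟩ h
    cases k <;> cases s <;> cases l <;> cases s' <;> simp [embedLeft] at h ⊢ <;> exact h
  · rintro ⟨k, v⟩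
    cases k
    · have h := Sys.hit_map_outer (S := tripleSys ![F, F', F'']) (S' := pairSys (F.comp F') F'')
        (S'' := pairSys F F') (ι := embedLeft) (κ := fun p => (if p.1 = true then 1 else 0, p.2))
        hg hm ho hl hgl (hit_comp F F' v)
      have h1 : ∀ u : Vertex n, ((if (outerPoint u).1 = true then 1 else 0, (outerPoint u).2) :
          Fin 3 × Vertex n) = embedLeft (false, u) := by
        rintro ⟨s, b⟩
        cases s <;> rfl
      rw [h1, h1] at h
      rw [Sys.next, hg]
      exact h
    · rw [Sys.next, hg]
      exact Sys.Hit.one (S := tripleSys ![F, F', F'']) (B := Set.range embedLeft) (2, v)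
        (by
          rw [Sys.next]
          change (tripleSys ![F, F', F'']).glue (embedLeft (true, F''.partner v)) ∈ _
          rw [← hg]
          exact ⟨_, rfl⟩)
  · rintro ⟨i, s, b⟩ h
    rw [mem_tripleSys_outer] at h
    fin_cases i <;> cases s <;> simp [glueThree] at h
    · exact ⟨(false, (false, b)), rfl⟩
    · exact ⟨(true, (true, b)), rfl⟩
  · rintro ⟨k, v⟩ ⟨l, v'⟩ h
    cases k <;> cases l <;> simp at h ⊢ <;> exact h
  · rintro ⟨i, s, b⟩ h
    fin_cases i
    · exact ⟨(false, (s, b)), rfl⟩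
    · exact ⟨(true, (s, b)), rfl⟩
    · exact absurd ⟨(true, (s, b)), rfl⟩ h

theorem elimination_right : (tripleSys ![F, F', F'']).Elimination (pairSys F (F'.comp F''))
    (pairSys F' F'') embedRight (fun p => (if p.1 = true then 2 else 1, p.2)) := by
  have hg : ∀ y : Point n, embedRight ((pairSys F (F'.comp F'')).glue y) =
      (tripleSys ![F, F', F'']).glue (embedRight y) := by
    rintro ⟨k, s, b⟩
    cases k <;> cases s <;> rfl
  have hm : ∀ z : Point n, ((if z.1 = true then 2 else 1, z.2) : Fin 3 × Vertex n) ∈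
      Set.range embedRight ↔ z ∈ (pairSys F' F'').outer := by
    intro z
    rw [mem_pairSys_outer, Set.mem_range]
    constructor
    · rintro ⟨⟨k, s, b⟩, h⟩
      rcases z with ⟨l, s', b'⟩
      cases k <;> cases s <;> cases l <;> cases s' <;> simp [embedRight, IsOuter] at h ⊢
    · intro h
      rcases z with ⟨l, s', b'⟩
      refine ⟨(true, (s', b')), ?_⟩
      cases l <;> cases s' <;> simp [embedRight, IsOuter] at h ⊢
  have ho : ∀ z : Point n, (tripleSys ![F, F', F'']).opp (if z.1 = true then 2 else 1, z.2) =
      (if ((pairSys F' F'').opp z).1 = true then 2 else 1, ((pairSys F' F'').opp z).2) := by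
    rintro ⟨k, v⟩
    cases k <;> rfl
  have hl : ∀ z : Point n, (tripleSys ![F, F', F'']).lab (if z.1 = true then 2 else 1, z.2) =
      (pairSys F' F'').lab z := by
    rintro ⟨k, v⟩
    cases k <;> rfl
  have hgl : ∀ z : Point n, z ∉ (pairSys F' F'').outer →
      (tripleSys ![F, F', F'']).glue (if z.1 = true then 2 else 1, z.2) =
      (if ((pairSys F' F'').glue z).1 = true then 2 else 1, ((pairSys F' F'').glue z).2) := by
    rintro ⟨k, s, b⟩ h
    rw [mem_pairSys_outer] at h
    cases k <;> cases s <;> first | rfl | exact absurd rfl h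
  refine Sys.Elimination.of_opp ?_ ?_ hg ?_ ?_ hm ?_ ho hl hgl
  · rintro ⟨k, s, b⟩ ⟨l, s', b'⟩ h
    cases k <;> cases s <;> cases l <;> cases s' <;> simp [embedRight] at h ⊢ <;> exact h
  · rintro ⟨k, v⟩
    cases k
    · rw [Sys.next, hg]
      exact Sys.Hit.one (S := tripleSys ![F, F', F'']) (B := Set.range embedRight) (0, v)
        (by
          rw [Sys.next]
          change (tripleSys ![F, F', F'']).glue (embedRight (false, F.partner v)) ∈ _
          rw [← hg]
          exact ⟨_, rfl⟩)
    · have h := Sys.hit_map_outer (S := tripleSys ![F, F', F'']) (S' := pairSys F (F'.comp F''))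
        (S'' := pairSys F' F'') (ι := embedRight) (κ := fun p => (if p.1 = true then 2 else 1, p.2))
        hg hm ho hl hgl (hit_comp F' F'' v)
      have h1 : ∀ u : Vertex n, ((if (outerPoint u).1 = true then 2 else 1, (outerPoint u).2) :
          Fin 3 × Vertex n) = embedRight (true, u) := by
        rintro ⟨s, b⟩
        cases s <;> rfl
      rw [h1, h1] at h
      rw [Sys.next, hg]
      exact h
  · rintro ⟨i, s, b⟩ h
    rw [mem_tripleSys_outer] at h
    fin_cases i <;> cases s <;> simp [glueThree] at h
    · exact ⟨(false, (false, b)), rfl⟩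
    · exact ⟨(true, (true, b)), rfl⟩
  · rintro ⟨k, v⟩ ⟨l, v'⟩ h
    cases k <;> cases l <;> simp at h ⊢ <;> exact h
  · rintro ⟨i, s, b⟩ h
    fin_cases i
    · exact absurd ⟨(false, (s, b)), rfl⟩ h
    · exact ⟨(false, (s, b)), rfl⟩
    · exact ⟨(true, (s, b)), rfl⟩

/-- Each side is the product over the cycles of the triple, sorted according to whether they close
at the first or only at the second gluing. -/
theorem loopWeight_mul : F.loopWeight F' * (F.comp F').loopWeight F'' =
    F'.loopWeight F'' * F.loopWeight (F'.comp F'') := by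
  classical
  have hl := elimination_left F F' F''
  have hr := elimination_right F F' F''
  -- One set of representatives for the cycles of the triple serves both eliminations.
  have h := hl.isReps (isReps_cycleReps _ _) (isReps_cycleReps _ _)
  have h1 := hl.prod_eq h (isReps_cycleReps _ _) (isReps_cycleReps _ _)
    (fun k => (MvPolynomial.X k : R0a))
  have h2 := hr.prod_eq h (isReps_cycleReps _ _) (isReps_cycleReps _ _)
    (fun k => (MvPolynomial.X k : R0a))
  simp only [← loopWeight_eq] at h1 h2
  rw [mul_comm, ← h1, h2, mul_comm]

theorem hit_triple_left (v : Vertex n) :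
    (tripleSys ![F, F', F'']).Hit (tripleSys ![F, F', F'']).outer (embedLeft (outerPoint v))
      (embedLeft (outerPoint (((F.comp F').comp F'').partner v)))
      (((F.comp F').comp F'').dir v) := by
  have hl := elimination_left F F' F''
  have h := (hit_comp (F.comp F') F'' v).map hl.injective hl.hit
  convert h using 1
  ext x
  constructor
  · intro hx
    obtain ⟨y, rfl⟩ := hl.outer_subset hx
    exact ⟨y, (hl.mem_outer_iff y).1 hx, rfl⟩
  · rintro ⟨y, hy, rfl⟩
    exact (hl.mem_outer_iff y).2 hy

theorem hit_triple_right (v : Vertex n) :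
    (tripleSys ![F, F', F'']).Hit (tripleSys ![F, F', F'']).outer (embedRight (outerPoint v))
      (embedRight (outerPoint ((F.comp (F'.comp F'')).partner v)))
      ((F.comp (F'.comp F'')).dir v) := by
  have hl := elimination_right F F' F''
  have h := (hit_comp F (F'.comp F'') v).map hl.injective hl.hit
  convert h using 1
  ext x
  constructor
  · intro hx
    obtain ⟨y, rfl⟩ := hl.outer_subset hx
    exact ⟨y, (hl.mem_outer_iff y).1 hx, rfl⟩
  · rintro ⟨y, hy, rfl⟩
    exact (hl.mem_outer_iff y).2 hy

/-- For either bracketing, partner and directed label of `v` describe the arc of the triple that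
starts at `v`, and this arc is unique. -/
theorem comp_assoc : (F.comp F').comp F'' = F.comp (F'.comp F'') := by
  have he : ∀ v : Vertex n, embedRight (outerPoint v) = embedLeft (outerPoint v) := by
    rintro ⟨s, b⟩
    cases s <;> rfl
  have h : ∀ v, embedLeft (outerPoint (((F.comp F').comp F'').partner v)) =
      embedLeft (outerPoint ((F.comp (F'.comp F'')).partner v)) ∧
      ((F.comp F').comp F'').dir v = (F.comp (F'.comp F'')).dir v := fun v => by
    have h2 := hit_triple_right F F' F'' v
    rw [he, he] at h2
    exact (hit_triple_left F F' F'' v).unique h2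
  refine ext_dir (fun v => ?_) fun v => (h v).2
  have h1 := (elimination_left F F' F'').injective (h v).1
  simp only [outerPoint, Prod.mk.injEq] at h1
  exact h1.2

end ArrowTangle

end ArrowTL

namespace ArrowTL

open FlatTangle

namespace ArrowTangle

variable {n : ℕ} {F F' : ArrowTangle n}

/-! ### Computation of products -/

variable (F F') in
/-- The path of `F ⊔ F'` from `p` ends at `w`, and the product of its labels is `d`. -/
abbrev Path (p : Point n) (w : Vertex n) (d : ℤ) : Prop :=
  (pairSys F F').Hit (pairSys F F').outer p (outerPoint w) d

theorem pairSys_next_false {v : Vertex n} {s : Bool} {b : Fin n} (h : F.partner v = (s, b)) :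
    (pairSys F F').next (false, v) = glue (false, (s, b)) := by
  rw [← h]
  rfl

theorem pairSys_next_true {v : Vertex n} {s : Bool} {b : Fin n} (h : F'.partner v = (s, b)) :
    (pairSys F F').next (true, v) = glue (true, (s, b)) := by
  rw [← h]
  rfl

theorem Path.left_end {v : Vertex n} {b : Fin n} (h : F.partner v = (false, b)) :
    Path F F' (false, v) (false, b) (F.dir v) := by
  have h1 := pairSys_next_false (F' := F') h
  change _ = outerPoint (false, b) at h1
  have h2 := Sys.Hit.one (S := pairSys F F') (B := (pairSys F F').outer) (false, v)
    (by rw [h1]; exact outerPoint_mem F F' _)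
  rwa [h1] at h2

theorem Path.right_end {v : Vertex n} {b : Fin n} (h : F'.partner v = (true, b)) :
    Path F F' (true, v) (true, b) (F'.dir v) := by
  have h1 := pairSys_next_true (F := F) h
  change _ = outerPoint (true, b) at h1
  have h2 := Sys.Hit.one (S := pairSys F F') (B := (pairSys F F').outer) (true, v)
    (by rw [h1]; exact outerPoint_mem F F' _)
  rwa [h1] at h2

theorem Path.left_step {v w : Vertex n} {b : Fin n} {d : ℤ} (h : F.partner v = (true, b))
    (hd : Path F F' (true, (false, b)) w d) : Path F F' (false, v) w (tw (F.dir v) d) := by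
  have h1 := pairSys_next_false (F' := F') h
  change _ = (true, (false, b)) at h1
  refine Sys.Hit.step (S := pairSys F F') (false, v) _ _ ?_ ?_
  · rw [h1, mem_pairSys_outer]
    exact Bool.noConfusion
  · rwa [h1]

theorem Path.right_step {v w : Vertex n} {b : Fin n} {d : ℤ} (h : F'.partner v = (false, b))
    (hd : Path F F' (false, (true, b)) w d) : Path F F' (true, v) w (tw (F'.dir v) d) := by
  have h1 := pairSys_next_true (F := F) h
  change _ = (false, (true, b)) at h1
  refine Sys.Hit.step (S := pairSys F F') (true, v) _ _ ?_ ?_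
  · rw [h1, mem_pairSys_outer]
    exact Bool.noConfusion
  · rwa [h1]

/-- Every concrete product below is computed by exhibiting a path and applying this. -/
theorem comp_of_path {v w : Vertex n} {d : ℤ} (h : Path F F' (outerPoint v) w d) :
    (F.comp F').partner v = w ∧ (F.comp F').dir v = d := by
  obtain ⟨h1, h2⟩ := (hit_comp F F' v).unique h
  simp only [outerPoint, Prod.mk.injEq] at h1
  exact ⟨h1.2, h2⟩

/-- Each cycle is represented by a point (1,b) of the first tangle, so there are none if the paths
from all these points reach a free point. -/
theorem loopWeight_eq_one (h : ∀ b : Fin n, ∃ w d, Path F F' (false, (true, b)) w d) :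
    F.loopWeight F' = 1 := by
  rw [loopWeight, Finset.prod_eq_one]
  intro b hb
  obtain ⟨w, d, hw⟩ := h b
  obtain ⟨k, hk, -⟩ := Sys.hit_iff.1 hw
  have := (mem_cycles.1 hb (k + 1)).1
  rw [← pairSys_next_eq, hk] at this
  exact absurd (isOuter_outerPoint w) this

/-- The two tangles have the same pair with the same label at `v`. -/
def Agree (F F' : ArrowTangle n) (v : Vertex n) : Prop :=
  F.partner v = F'.partner v ∧ F.dir v = F'.dir v

/-- Agreement propagates along a pair, so one end point of each pair has to be checked. -/
theorem Agree.of_partner {v w : Vertex n} (h : Agree F F' v) (hw : F.partner v = w) :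
    Agree F F' w := by
  obtain ⟨h1, h2⟩ := h
  subst hw
  exact ⟨by rw [F.partner_partner, h1, F'.partner_partner],
    by rw [F.dir_partner, h1, F'.dir_partner, h2]⟩

theorem ext_agree (h : ∀ v, Agree F F' v) : F = F' := ext_dir (fun v => (h v).1) fun v => (h v).2

/-! ### Products with invertible tangles -/

@[simp] theorem strands_partner_false (e : Equiv.Perm (Fin n)) (c : Fin n → ℤ) (b : Fin n) :
    (strands e c).partner (false, b) = (true, e b) := rfl

@[simp] theorem strands_partner_true (e : Equiv.Perm (Fin n)) (c : Fin n → ℤ) (b : Fin n) :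
    (strands e c).partner (true, b) = (false, e.symm b) := rfl

@[simp] theorem strands_dir_false (e : Equiv.Perm (Fin n)) (c : Fin n → ℤ) (b : Fin n) :
    (strands e c).dir (false, b) = 2 * c b := by
  unfold dir
  change (if _ then 2 * c b else st (2 * c b)) = _
  rw [st_even (even_two_mul _), ite_self]

@[simp] theorem strands_dir_true (e : Equiv.Perm (Fin n)) (c : Fin n → ℤ) (b : Fin n) :
    (strands e c).dir (true, b) = 2 * c (e.symm b) := by
  unfold dir
  change (if _ then 2 * c (e.symm b) else st (2 * c (e.symm b))) = _
  rw [st_even (even_two_mul _), ite_self]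

theorem strands_loopWeight (e : Equiv.Perm (Fin n)) (c : Fin n → ℤ) (T : ArrowTangle n) :
    (strands e c).loopWeight T = 1 :=
  loopWeight_eq_one fun b => ⟨_, _, Path.left_end (strands_partner_true e c b)⟩

theorem loopWeight_strands (e : Equiv.Perm (Fin n)) (c : Fin n → ℤ) (T : ArrowTangle n) :
    T.loopWeight (strands e c) = 1 := by
  refine loopWeight_eq_one fun b => ?_
  rcases h : T.partner (true, b) with ⟨_ | _, b'⟩
  · exact ⟨_, _, Path.left_end h⟩
  · exact ⟨_, _, Path.left_step h (Path.right_end (strands_partner_false e c b'))⟩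

/-- The end point of `T` at which the path of `strands e c ⊔ T` that starts at `v` arrives. -/
def moveLeft (e : Equiv.Perm (Fin n)) (v : Vertex n) : Vertex n :=
  if v.1 = true then v else (false, e v.2)

/-- The end point of `T` at which the path of `T ⊔ strands e c` that starts at `v` arrives. -/
def moveRight (e : Equiv.Perm (Fin n)) (v : Vertex n) : Vertex n :=
  if v.1 = true then (true, e v.2) else v

theorem strands_comp (e : Equiv.Perm (Fin n)) (c : Fin n → ℤ) (T : ArrowTangle n)
    {v w : Vertex n} (h : T.partner (moveLeft e v) = w) :
    ((strands e c).comp T).partner v = moveLeft e.symm w ∧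
      ((strands e c).comp T).dir v = (if v.1 = true then 0 else 2 * c v.2) +
        tw (T.dir (moveLeft e v)) (if w.1 = true then 0 else 2 * c (e.symm w.2)) := by
  apply comp_of_path
  have key : Path (strands e c) T (true, moveLeft e v) (moveLeft e.symm w)
      (tw (T.dir (moveLeft e v)) (if w.1 = true then 0 else 2 * c (e.symm w.2))) := by
    rcases w with ⟨_ | _, b⟩
    · refine Path.right_step h ?_
      have := Path.left_end (F' := T) (strands_partner_true e c b)
      simpa [moveLeft] using this
    · have := Path.right_end (F := strands e c) h
      simpa [moveLeft] using this
  rcases v with ⟨_ | _, b⟩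
  · have := Path.left_step (strands_partner_false e c b) key
    rw [strands_dir_false, tw_even (even_two_mul _)] at this
    exact this
  · simpa [moveLeft, outerPoint] using key

theorem comp_strands (e : Equiv.Perm (Fin n)) (c : Fin n → ℤ) (T : ArrowTangle n)
    {v w : Vertex n} (h : T.partner (moveRight e.symm v) = w) :
    (T.comp (strands e c)).partner v = moveRight e w ∧
      (T.comp (strands e c)).dir v = (if v.1 = true then 2 * c (e.symm v.2) else 0) +
        tw (T.dir (moveRight e.symm v)) (if w.1 = true then 2 * c w.2 else 0) := by
  apply comp_of_path
  have key : Path T (strands e c) (false, moveRight e.symm v) (moveRight e w)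
      (tw (T.dir (moveRight e.symm v)) (if w.1 = true then 2 * c w.2 else 0)) := by
    rcases w with ⟨_ | _, b⟩
    · have := Path.left_end (F' := strands e c) h
      simpa [moveRight] using this
    · refine Path.left_step h ?_
      have := Path.right_end (F := T) (strands_partner_false e c b)
      simpa [moveRight] using this
  rcases v with ⟨_ | _, b⟩
  · simpa [moveRight, outerPoint] using key
  · have := Path.right_step (strands_partner_true e c b) key
    rw [strands_dir_true, tw_even (even_two_mul _)] at this
    exact this

/-- This is the group law of ℤⁿ ⋊ S_n, with the permutations in reverse order because tangles are
composed from left to right. -/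
theorem strands_comp_strands (e e' : Equiv.Perm (Fin n)) (c c' : Fin n → ℤ) :
    (strands e c).comp (strands e' c') = strands (e' * e) (c + c' ∘ e) := by
  have key : ∀ b, Agree ((strands e c).comp (strands e' c')) (strands (e' * e) (c + c' ∘ e))
      (false, b) := by
    intro b
    obtain ⟨h1, h2⟩ := strands_comp e c (strands e' c') (v := (false, b)) (w := (true, e' (e b))) rfl
    constructor
    · rw [h1]
      rfl
    · rw [h2]
      simp [moveLeft, mul_add]
  refine ext_agree ?_
  rintro ⟨_ | _, b⟩
  · exact key b
  · refine (key ((e' * e).symm b)).of_partner ?_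
    rw [(key _).1, strands_partner_false, Equiv.apply_symm_apply]

theorem idTangle_comp (T : ArrowTangle n) : (idTangle n).comp T = T := by
  refine ext_agree fun v => ?_
  obtain ⟨h1, h2⟩ := strands_comp 1 0 T (v := v) rfl
  have h3 : ∀ v : Vertex n, moveLeft 1 v = v := by
    rintro ⟨_ | _, b⟩ <;> rfl
  refine ⟨h1.trans ?_, h2.trans ?_⟩
  · exact (h3 _).trans (by rw [h3])
  · simp [h3]

theorem comp_idTangle (T : ArrowTangle n) : T.comp (idTangle n) = T := by
  refine ext_agree fun v => ?_
  obtain ⟨h1, h2⟩ := comp_strands 1 0 T (v := v) rfl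
  have h3 : ∀ v : Vertex n, moveRight 1 v = v := by
    rintro ⟨_ | _, b⟩ <;> rfl
  have h4 : ∀ v : Vertex n, moveRight (Equiv.symm 1) v = v := h3
  refine ⟨h1.trans ?_, h2.trans ?_⟩
  · rw [h3, h4]
  · simp [h4]

end ArrowTangle

/-! ### The algebra structure -/

namespace ATL

variable {n : ℕ}

theorem induction {p : ATL n → Prop} (h0 : p 0) (hadd : ∀ x y, p x → p y → p (x + y))
    (hs : ∀ (r : R0a) (F : ArrowTangle n), p (r • of F)) (x : ATL n) : p x := by
  refine Finsupp.induction_linear (motive := p) x h0 hadd fun F r => ?_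
  have : (Finsupp.single F r : ArrowTangle n →₀ R0a) = r • Finsupp.single F (1 : R0a) := by
    rw [Finsupp.smul_single, smul_eq_mul, mul_one]
  have h2 := hs r F
  unfold of at h2
  exact this ▸ h2

theorem mul_def (x y : ATL n) : x * y = mulHom x y := rfl

theorem smul_mul (r : R0a) (x y : ATL n) : (r • x) * y = r • (x * y) := by
  rw [mul_def, mul_def, map_smul]
  rfl

theorem mul_smul' (r : R0a) (x y : ATL n) : x * (r • y) = r • (x * y) := by
  rw [mul_def, mul_def, map_smul]

theorem add_mul' (x y z : ATL n) : (x + y) * z = x * z + y * z := by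
  rw [mul_def, mul_def, mul_def, map_add]
  rfl

theorem mul_add' (x y z : ATL n) : x * (y + z) = x * y + x * z := by
  rw [mul_def, mul_def, mul_def, map_add]

theorem zero_mul' (x : ATL n) : 0 * x = 0 := by
  rw [mul_def, map_zero]
  rfl

theorem mul_zero' (x : ATL n) : x * 0 = 0 := by
  rw [mul_def, map_zero]

theorem mul_assoc' (x y z : ATL n) : x * y * z = x * (y * z) := by
  induction x using ATL.induction with
  | h0 => simp only [zero_mul']
  | hadd x x' h h' => simp only [add_mul', h, h']
  | hs r F =>
    simp only [smul_mul]
    congr 1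
    induction y using ATL.induction with
    | h0 => simp only [zero_mul', mul_zero']
    | hadd y y' h h' => simp only [add_mul', mul_add', h, h']
    | hs s F' =>
      simp only [smul_mul, mul_smul']
      congr 1
      induction z using ATL.induction with
      | h0 => simp only [mul_zero']
      | hadd z z' h h' => simp only [mul_add', h, h']
      | hs t F'' =>
        simp only [mul_smul']
        congr 1
        rw [of_mul_of, of_mul_of, smul_mul, mul_smul', of_mul_of, of_mul_of, smul_smul, smul_smul,
          ArrowTangle.loopWeight_mul, ArrowTangle.comp_assoc]

theorem one_def : (1 : ATL n) = of (ArrowTangle.idTangle n) := rfl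

theorem one_mul' (x : ATL n) : 1 * x = x := by
  induction x using ATL.induction with
  | h0 => exact mul_zero' _
  | hadd x y h h' => rw [mul_add', h, h']
  | hs r F =>
    rw [mul_smul', one_def, of_mul_of, ArrowTangle.idTangle_comp, ArrowTangle.idTangle,
      ArrowTangle.strands_loopWeight, one_smul]

theorem mul_one' (x : ATL n) : x * 1 = x := by
  induction x using ATL.induction with
  | h0 => exact zero_mul' _
  | hadd x y h h' => rw [add_mul', h, h']
  | hs r F =>
    rw [smul_mul, one_def, of_mul_of, ArrowTangle.comp_idTangle, ArrowTangle.idTangle,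
      ArrowTangle.loopWeight_strands, one_smul]

noncomputable scoped instance : Ring (ATL n) :=
  { (inferInstance : AddCommGroup (ATL n)) with
    mul := (· * ·)
    one := 1
    left_distrib := mul_add'
    right_distrib := add_mul'
    zero_mul := zero_mul'
    mul_zero := mul_zero'
    mul_assoc := mul_assoc'
    one_mul := one_mul'
    mul_one := mul_one' }

noncomputable scoped instance : Algebra R0a (ATL n) := Algebra.ofModule smul_mul fun r x y => mul_smul' r x y

end ATL

end ArrowTL

namespace ArrowTL

open FlatTangle

namespace ArrowTangle

variable {n : ℕ} {T : ArrowTangle n} {a b : Fin n}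

@[simp] theorem symm_one_apply (x : Fin n) : (Equiv.symm (1 : Equiv.Perm (Fin n))) x = x := rfl

/-! ### Caps -/

/-- The tangle with the pairs `{(0,a),(0,b)}` and `{(1,a),(1,b)}`, with label `2 * k + 1` from
`(0,a)` to `(0,b)` and from `(1,b)` to `(1,a)`, and vertical strands with label `0`. -/
def cap (a b : Fin n) (hab : a ≠ b) (k : ℤ) : ArrowTangle n :=
  ofDir
    { partner := fun v => if v.2 = a ∨ v.2 = b then (v.1, Equiv.swap a b v.2) else (!v.1, v.2)
      partner_partner := by
        rintro ⟨s, x⟩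
        by_cases h1 : x = a
        · subst h1; simp
        · by_cases h2 : x = b
          · subst h2; simp
          · simp [h1, h2]
      partner_ne := by
        rintro ⟨s, x⟩
        by_cases h1 : x = a
        · subst h1; simp [hab.symm]
        · by_cases h2 : x = b
          · subst h2; simp [hab]
          · simp [h1, h2] }
    (fun v => if v.2 = a then (if v.1 = true then -(2 * k + 1) else 2 * k + 1) else
      if v.2 = b then (if v.1 = true then 2 * k + 1 else -(2 * k + 1)) else 0)
    (by
      have ho : Odd (2 * k + 1) := odd_two_mul_add_one k
      rintro ⟨s, x⟩
      by_cases h1 : x = a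
      · subst h1
        cases s <;> simp [hab.symm, st_odd ho, st_odd ho.neg, -neg_add_rev]
      · by_cases h2 : x = b
        · subst h2
          cases s <;> simp [hab.symm, st_odd ho, st_odd ho.neg, -neg_add_rev]
        · simp [h1, h2])
    (by
      have ho : Odd (2 * k + 1) := odd_two_mul_add_one k
      rintro ⟨s, x⟩
      by_cases h1 : x = a
      · subst h1
        cases s <;> simp [ho, -neg_add_rev]
      · by_cases h2 : x = b
        · subst h2
          cases s <;> simp [hab.symm, ho, -neg_add_rev]
        · simp [h1, h2])

variable (hab : a ≠ b) (k : ℤ)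

@[simp] theorem cap_partner_left (s : Bool) : (cap a b hab k).partner (s, a) = (s, b) := by
  simp [cap, ofDir]

@[simp] theorem cap_partner_right (s : Bool) : (cap a b hab k).partner (s, b) = (s, a) := by
  simp [cap, ofDir]

theorem cap_partner (s : Bool) {x : Fin n} (ha : x ≠ a) (hb : x ≠ b) :
    (cap a b hab k).partner (s, x) = (!s, x) := by
  simp [cap, ofDir, ha, hb]

@[simp] theorem cap_dir_left_false : (cap a b hab k).dir (false, a) = 2 * k + 1 := by
  simp [cap]

@[simp] theorem cap_dir_left_true : (cap a b hab k).dir (true, a) = -(2 * k + 1) := by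
  simp [cap]

@[simp] theorem cap_dir_right_false : (cap a b hab k).dir (false, b) = -(2 * k + 1) := by
  simp [cap, hab.symm]

@[simp] theorem cap_dir_right_true : (cap a b hab k).dir (true, b) = 2 * k + 1 := by
  simp [cap, hab.symm]

theorem cap_dir (s : Bool) {x : Fin n} (ha : x ≠ a) (hb : x ≠ b) :
    (cap a b hab k).dir (s, x) = 0 := by
  simp [cap, ha, hb]

/-- To compare a tangle with a cap it suffices to consider one end point of each pair. -/
theorem agree_cap (h1 : ∀ s, Agree (cap a b hab k) T (s, a))
    (h2 : ∀ x, x ≠ a → x ≠ b → Agree (cap a b hab k) T (false, x)) : cap a b hab k = T := by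
  refine ext_agree ?_
  rintro ⟨s, x⟩
  by_cases ha : x = a
  · subst ha
    exact h1 s
  · by_cases hb : x = b
    · subst hb
      exact (h1 s).of_partner (cap_partner_left hab k s)
    · cases s
      · exact h2 x ha hb
      · exact (h2 x ha hb).of_partner (cap_partner hab k false ha hb)

/-- Reading the cap from `b` negates its odd label, and -(2k + 1) = 2(-k - 1) + 1. -/
theorem cap_symm : cap a b hab k = cap b a hab.symm (-k - 1) := by
  refine agree_cap hab k (fun s => ⟨?_, ?_⟩) fun x ha hb => ⟨?_, ?_⟩
  · rw [cap_partner_left, cap_partner_right]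
  · cases s
    · rw [cap_dir_left_false, cap_dir_right_false]
      ring
    · rw [cap_dir_left_true, cap_dir_right_true]
      ring
  · rw [cap_partner _ _ _ ha hb, cap_partner _ _ _ hb ha]
  · rw [cap_dir _ _ _ ha hb, cap_dir _ _ _ hb ha]

/-- On the side 1 the order of the points is reversed: label 1 there is read from position i + 1 to
position i, which matches the sign convention of `cap`. -/
theorem FTangle_eq_cap (i : Fin (n - 1)) (h : lo i ≠ hi i) : FTangle i = cap (lo i) (hi i) h 0 := by
  have hlt : (lo i : ℕ) < (hi i : ℕ) := Nat.lt_succ_self _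
  have hlt' := (hi i).isLt
  symm
  refine agree_cap h 0 (fun s => ⟨?_, ?_⟩) fun x ha hb => ⟨?_, ?_⟩
  · rw [cap_partner_left]
    simp [FTangle]
  · have : (FTangle i).partner (s, lo i) = (s, hi i) := by simp [FTangle]
    rw [dir.eq_def (FTangle i), this]
    cases s
    · simp [FTangle, pos, hlt]
    · rw [if_neg]
      · simp [FTangle, st_odd odd_one]
      · simp only [pos, if_true]
        omega
  · rw [cap_partner _ _ _ ha hb]
    simp [FTangle, ha, hb]
  · rw [cap_dir _ _ _ ha hb]
    unfold dir
    simp [FTangle, ha, hb]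

/-- Conjugation of a cap by an invertible tangle. -/
theorem strands_comp_cap (e : Equiv.Perm (Fin n)) (c : Fin n → ℤ) (he : e a ≠ e b) :
    (strands e c).comp (cap (e a) (e b) he k) =
      (cap a b hab (k + c a - c b)).comp (strands e c) := by
  have ho : Odd (2 * k + 1) := odd_two_mul_add_one k
  have ho' : Odd (2 * (k + c a - c b) + 1) := odd_two_mul_add_one _
  have h1 : Agree ((strands e c).comp (cap (e a) (e b) he k))
      ((cap a b hab (k + c a - c b)).comp (strands e c)) (false, a) := by
    obtain ⟨p1, p2⟩ := strands_comp e c (cap (e a) (e b) he k) (v := (false, a))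
      (w := (false, e b)) (cap_partner_left _ _ _)
    obtain ⟨q1, q2⟩ := comp_strands e c (cap a b hab (k + c a - c b)) (v := (false, a))
      (w := (false, b)) (cap_partner_left _ _ _)
    refine ⟨?_, ?_⟩
    · rw [p1, q1]
      simp [moveLeft, moveRight]
    · rw [p2, q2]
      simp [moveLeft, moveRight, tw_odd ho]
      ring
  have h2 : Agree ((strands e c).comp (cap (e a) (e b) he k))
      ((cap a b hab (k + c a - c b)).comp (strands e c)) (true, e a) := by
    obtain ⟨p1, p2⟩ := strands_comp e c (cap (e a) (e b) he k) (v := (true, e a))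
      (w := (true, e b)) (cap_partner_left _ _ _)
    obtain ⟨q1, q2⟩ := comp_strands e c (cap a b hab (k + c a - c b)) (v := (true, e a))
      (w := (true, b)) (by simp [moveRight])
    refine ⟨?_, ?_⟩
    · rw [p1, q1]
      simp [moveLeft, moveRight]
    · rw [p2, q2]
      simp [moveLeft, moveRight, tw_odd ho'.neg, -neg_add_rev]
      ring
  have h3 : ∀ x, x ≠ a → x ≠ b → Agree ((strands e c).comp (cap (e a) (e b) he k))
      ((cap a b hab (k + c a - c b)).comp (strands e c)) (false, x) := by
    intro x ha hb
    have ha' : e x ≠ e a := fun h => ha (e.injective h)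
    have hb' : e x ≠ e b := fun h => hb (e.injective h)
    obtain ⟨p1, p2⟩ := strands_comp e c (cap (e a) (e b) he k) (v := (false, x))
      (w := (true, e x)) (cap_partner _ _ _ ha' hb')
    obtain ⟨q1, q2⟩ := comp_strands e c (cap a b hab (k + c a - c b)) (v := (false, x))
      (w := (true, x)) (cap_partner _ _ _ ha hb)
    refine ⟨?_, ?_⟩
    · rw [p1, q1]
      simp [moveLeft, moveRight]
    · rw [p2, q2]
      simp [moveLeft, moveRight, cap_dir _ _ _ ha hb, cap_dir _ _ _ ha' hb']
  have h4 : ((strands e c).comp (cap (e a) (e b) he k)).partner (false, a) = (false, b) := by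
    rw [(strands_comp e c (cap (e a) (e b) he k) (v := (false, a))
      (w := (false, e b)) (cap_partner_left _ _ _)).1]
    simp [moveLeft]
  have h5 : ((strands e c).comp (cap (e a) (e b) he k)).partner (true, e a) = (true, e b) :=
    (strands_comp e c (cap (e a) (e b) he k) (v := (true, e a))
      (w := (true, e b)) (cap_partner_left _ _ _)).1
  have h6 : ∀ x, x ≠ a → x ≠ b →
      ((strands e c).comp (cap (e a) (e b) he k)).partner (false, x) = (true, e x) := by
    intro x ha hb
    exact (strands_comp e c (cap (e a) (e b) he k) (v := (false, x))
      (w := (true, e x)) (cap_partner _ _ _ (fun h => ha (e.injective h))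
      (fun h => hb (e.injective h)))).1
  refine ext_agree ?_
  rintro ⟨_ | _, x⟩
  · by_cases ha : x = a
    · subst ha; exact h1
    · by_cases hb : x = b
      · subst hb; exact h1.of_partner h4
      · exact h3 x ha hb
  · obtain ⟨y, rfl⟩ := e.surjective x
    by_cases ha : y = a
    · subst ha; exact h2
    · by_cases hb : y = b
      · subst hb; exact h2.of_partner h5
      · exact (h3 y ha hb).of_partner (h6 y ha hb)

/-- A label can be moved along a cap. -/
theorem cap_comp_slide (m : ℤ) :
    (cap a b hab k).comp (strands 1 (Pi.single a m + Pi.single b m)) = cap a b hab k := by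
  symm
  have h1 : ∀ v : Vertex n, moveRight 1 v = v := by
    rintro ⟨_ | _, b⟩ <;> rfl
  have h2 : ∀ v : Vertex n, moveRight (Equiv.symm 1) v = v := h1
  have ho : Odd (2 * k + 1) := odd_two_mul_add_one k
  refine agree_cap hab k (fun s => ?_) fun x ha hb => ?_
  · obtain ⟨p1, p2⟩ := comp_strands 1 (Pi.single a m + Pi.single b m) (cap a b hab k)
      (v := (s, a)) (w := (s, b)) (by rw [h2]; simp)
    refine ⟨?_, ?_⟩
    · rw [p1, h1]
      simp
    · rw [p2, h2]
      cases s
      · simp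
      · simp [hab, hab.symm, tw_odd ho.neg, -neg_add_rev]
  · obtain ⟨p1, p2⟩ := comp_strands 1 (Pi.single a m + Pi.single b m) (cap a b hab k)
      (v := (false, x)) (w := (true, x)) (by rw [h2, cap_partner _ _ _ ha hb]; rfl)
    refine ⟨?_, ?_⟩
    · rw [p1, h1, cap_partner _ _ _ ha hb]
      rfl
    · rw [p2, h2]
      simp [ha, hb, cap_dir _ _ _ ha hb]

/-- A crossing at a cap. -/
theorem cap_comp_swap :
    (cap a b hab 0).comp (strands (Equiv.swap a b) 0) =
      (cap a b hab 0).comp (strands 1 (Pi.single a 1)) := by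
  have h1 : ∀ v : Vertex n, moveRight 1 v = v := by
    rintro ⟨_ | _, b⟩ <;> rfl
  have h2 : ∀ v : Vertex n, moveRight (Equiv.symm 1) v = v := h1
  have o1 : Odd (-1 : ℤ) := by decide
  have hs : ∀ s, ((cap a b hab 0).comp (strands (Equiv.swap a b) 0)).partner (s, a) = (s, b) ∧
      Agree ((cap a b hab 0).comp (strands (Equiv.swap a b) 0))
      ((cap a b hab 0).comp (strands 1 (Pi.single a 1))) (s, a) := by
    intro s
    cases s
    · obtain ⟨p1, p2⟩ := comp_strands (Equiv.swap a b) 0 (cap a b hab 0)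
        (v := (false, a)) (w := (false, b)) (by simp [moveRight])
      obtain ⟨q1, q2⟩ := comp_strands 1 (Pi.single a 1) (cap a b hab 0)
        (v := (false, a)) (w := (false, b)) (by rw [h2]; simp)
      refine ⟨p1, ?_, ?_⟩
      · rw [p1, q1]
        simp [moveRight]
      · rw [p2, q2, h2]
        simp [moveRight]
    · obtain ⟨p1, p2⟩ := comp_strands (Equiv.swap a b) 0 (cap a b hab 0)
        (v := (true, a)) (w := (true, a)) (by simp [moveRight])
      obtain ⟨q1, q2⟩ := comp_strands 1 (Pi.single a 1) (cap a b hab 0)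
        (v := (true, a)) (w := (true, b)) (by rw [h2]; simp)
      refine ⟨?_, ?_, ?_⟩
      · rw [p1]
        simp [moveRight]
      · rw [p1, q1]
        simp [moveRight]
      · rw [p2, q2, h2]
        simp [moveRight, hab.symm]
  have hx : ∀ x, x ≠ a → x ≠ b →
      ((cap a b hab 0).comp (strands (Equiv.swap a b) 0)).partner (false, x) = (true, x) ∧
      Agree ((cap a b hab 0).comp (strands (Equiv.swap a b) 0))
      ((cap a b hab 0).comp (strands 1 (Pi.single a 1))) (false, x) := by
    intro x ha hb
    obtain ⟨p1, p2⟩ := comp_strands (Equiv.swap a b) 0 (cap a b hab 0)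
        (v := (false, x)) (w := (true, x)) (by simp [moveRight, cap_partner _ _ _ ha hb])
    obtain ⟨q1, q2⟩ := comp_strands 1 (Pi.single a 1) (cap a b hab 0)
        (v := (false, x)) (w := (true, x)) (by rw [h2]; simp [cap_partner _ _ _ ha hb])
    have h3 : Equiv.swap a b x = x := Equiv.swap_apply_of_ne_of_ne ha hb
    refine ⟨?_, ?_, ?_⟩
    · rw [p1]
      simp [moveRight, h3]
    · rw [p1, q1]
      simp [moveRight, h3]
    · rw [p2, q2, h2]
      simp [moveRight, ha]
  refine ext_agree ?_
  rintro ⟨s, x⟩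
  by_cases ha : x = a
  · subst ha
    exact (hs s).2
  · by_cases hb : x = b
    · subst hb
      exact (hs s).2.of_partner (hs s).1
    · cases s
      · exact (hx x ha hb).2
      · exact (hx x ha hb).2.of_partner (hx x ha hb).1

/-- A crossing at a cap. -/
theorem swap_comp_cap :
    (strands (Equiv.swap a b) 0).comp (cap a b hab 0) =
      (strands 1 (Pi.single a (-1))).comp (cap a b hab 0) := by
  have h1 : ∀ v : Vertex n, moveLeft 1 v = v := by
    rintro ⟨_ | _, b⟩ <;> rfl
  have h2 : ∀ v : Vertex n, moveLeft (Equiv.symm 1) v = v := h1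
  have hs : ∀ s, ((strands (Equiv.swap a b) 0).comp (cap a b hab 0)).partner (s, a) = (s, b) ∧
      Agree ((strands (Equiv.swap a b) 0).comp (cap a b hab 0))
      ((strands 1 (Pi.single a (-1))).comp (cap a b hab 0)) (s, a) := by
    intro s
    cases s
    · obtain ⟨p1, p2⟩ := strands_comp (Equiv.swap a b) 0 (cap a b hab 0)
        (v := (false, a)) (w := (false, a)) (by simp [moveLeft])
      obtain ⟨q1, q2⟩ := strands_comp 1 (Pi.single a (-1)) (cap a b hab 0)
        (v := (false, a)) (w := (false, b)) (by rw [h1]; simp)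
      refine ⟨?_, ?_, ?_⟩
      · rw [p1]
        simp [moveLeft]
      · rw [p1, q1]
        simp [moveLeft]
      · rw [p2, q2, h1]
        simp [moveLeft, hab.symm, tw_odd odd_one]
    · obtain ⟨p1, p2⟩ := strands_comp (Equiv.swap a b) 0 (cap a b hab 0)
        (v := (true, a)) (w := (true, b)) (by simp [moveLeft])
      obtain ⟨q1, q2⟩ := strands_comp 1 (Pi.single a (-1)) (cap a b hab 0)
        (v := (true, a)) (w := (true, b)) (by rw [h1]; simp)
      refine ⟨p1, ?_, ?_⟩
      · rw [p1, q1]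
        simp [moveLeft]
      · rw [p2, q2, h1]
        simp [moveLeft]
  have hx : ∀ x, x ≠ a → x ≠ b →
      ((strands (Equiv.swap a b) 0).comp (cap a b hab 0)).partner (false, x) = (true, x) ∧
      Agree ((strands (Equiv.swap a b) 0).comp (cap a b hab 0))
      ((strands 1 (Pi.single a (-1))).comp (cap a b hab 0)) (false, x) := by
    intro x ha hb
    have h3 : Equiv.swap a b x = x := Equiv.swap_apply_of_ne_of_ne ha hb
    obtain ⟨p1, p2⟩ := strands_comp (Equiv.swap a b) 0 (cap a b hab 0)
        (v := (false, x)) (w := (true, x)) (by simp [moveLeft, h3, cap_partner _ _ _ ha hb])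
    obtain ⟨q1, q2⟩ := strands_comp 1 (Pi.single a (-1)) (cap a b hab 0)
        (v := (false, x)) (w := (true, x)) (by rw [h1]; simp [cap_partner _ _ _ ha hb])
    refine ⟨p1, ?_, ?_⟩
    · rw [p1, q1]
      simp [moveLeft]
    · rw [p2, q2, h1]
      simp [moveLeft, h3, ha]
  refine ext_agree ?_
  rintro ⟨s, x⟩
  by_cases ha : x = a
  · subst ha
    exact (hs s).2
  · by_cases hb : x = b
    · subst hb
      exact (hs s).2.of_partner (hs s).1
    · cases s
      · exact (hx x ha hb).2
      · exact (hx x ha hb).2.of_partner (hx x ha hb).1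

end ArrowTangle

end ArrowTL

namespace ArrowTL

open FlatTangle

namespace ArrowTangle

variable {n : ℕ} {T : ArrowTangle n} {a b c : Fin n} (hab : a ≠ b) (k : ℤ)

/-! ### Products of a cap and a tangle -/

/-! ### A cap against two through strands. -/

section Through

variable {a' b' : Fin n} (ha : T.partner (false, a) = (true, a'))
  (hb : T.partner (false, b) = (true, b'))

include ha hb

theorem exists_path_cap_of_through (x : Fin n) (hxa : x ≠ a) (hxb : x ≠ b) :
    Path (cap a b hab k) T (true, (false, x)) (T.partner (false, x)) (T.dir (false, x)) := by
  rcases hw : T.partner (false, x) with ⟨_ | _, y⟩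
  · have hy := T.partner_partner (false, x)
    rw [hw] at hy
    have hya : y ≠ a := by
      rintro rfl
      simp [ha] at hy
    have hyb : y ≠ b := by
      rintro rfl
      simp [hb] at hy
    have h1 := Path.left_end (F' := T) (cap_partner hab k true hya hyb)
    rw [cap_dir _ _ _ hya hyb] at h1
    have h2 := Path.right_step hw h1
    rwa [tw_zero] at h2
  · exact Path.right_end hw

theorem cap_loopWeight_of_through : (cap a b hab k).loopWeight T = 1 := by
  refine loopWeight_eq_one fun x => ?_
  by_cases hxa : x = a
  · subst hxa
    exact ⟨_, _, Path.left_step (cap_partner_left hab k true) (Path.right_end hb)⟩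
  · by_cases hxb : x = b
    · subst hxb
      exact ⟨_, _, Path.left_step (cap_partner_right hab k true) (Path.right_end ha)⟩
    · exact ⟨_, _, Path.left_end (cap_partner hab k true hxa hxb)⟩

omit ha hb in
theorem cap_comp_cap_end : ((cap a b hab k).comp T).partner (false, a) = (false, b) ∧
    ((cap a b hab k).comp T).dir (false, a) = 2 * k + 1 := by
  apply comp_of_path
  have := Path.left_end (F' := T) (cap_partner_left hab k false)
  rwa [cap_dir_left_false] at this

/-- The path enters along the strand of `a`, turns at the cup and leaves along the strand of `b`.
The odd label of the cup reverses the sign of the last label only. -/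
theorem cap_comp_cup : ((cap a b hab k).comp T).partner (true, a') = (true, b') ∧
    ((cap a b hab k).comp T).dir (true, a') =
      T.dir (true, a') + -(2 * k + 1) - T.dir (false, b) := by
  apply comp_of_path
  have ha' : T.partner (true, a') = (false, a) := by rw [← ha, T.partner_partner]
  have h0 : Even (T.dir (true, a')) := by
    rw [← Int.not_odd_iff_even, T.odd_dir, ha']
    simp
  have := Path.right_step ha' (Path.left_step (cap_partner_left hab k true) (Path.right_end hb))
  rwa [cap_dir_left_true, tw_odd (odd_two_mul_add_one k).neg, tw_even h0, ← add_sub_assoc] at this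

theorem cap_comp_agree {v : Vertex n} (h1 : v ≠ (false, a)) (h2 : v ≠ (false, b))
    (h3 : v ≠ (true, a')) (h4 : v ≠ (true, b')) : Agree ((cap a b hab k).comp T) T v := by
  apply comp_of_path
  rcases v with ⟨_ | _, x⟩
  · have hxa : x ≠ a := fun h => h1 (by rw [h])
    have hxb : x ≠ b := fun h => h2 (by rw [h])
    have := Path.left_step (cap_partner hab k false hxa hxb)
      (exists_path_cap_of_through hab k ha hb x hxa hxb)
    rwa [cap_dir _ _ _ hxa hxb, zero_tw] at this
  · rcases hw : T.partner (true, x) with ⟨_ | _, y⟩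
    · have hy := T.partner_partner (true, x)
      rw [hw] at hy
      have hya : y ≠ a := by
        rintro rfl
        rw [ha] at hy
        exact h3 hy.symm
      have hyb : y ≠ b := by
        rintro rfl
        rw [hb] at hy
        exact h4 hy.symm
      have h1 := Path.left_end (F' := T) (cap_partner hab k true hya hyb)
      rw [cap_dir _ _ _ hya hyb] at h1
      have h2 := Path.right_step hw h1
      rwa [tw_zero] at h2
    · exact Path.right_end hw

end Through

/-- Two disjoint caps commute. -/
theorem cap_comp_cap_comm {d : Fin n} (hcd : c ≠ d) (l : ℤ) (hac : a ≠ c) (had : a ≠ d)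
    (hbc : b ≠ c) (hbd : b ≠ d) :
    (cap a b hab k).comp (cap c d hcd l) = (cap c d hcd l).comp (cap a b hab k) := by
  have pa := cap_partner hcd l false hac had
  have pb := cap_partner hcd l false hbc hbd
  have pc := cap_partner hab k false hac.symm hbc.symm
  have pd := cap_partner hab k false had.symm hbd.symm
  have h1 : ∀ s, ((cap a b hab k).comp (cap c d hcd l)).partner (s, a) = (s, b) ∧
      Agree ((cap a b hab k).comp (cap c d hcd l)) ((cap c d hcd l).comp (cap a b hab k))
        (s, a) := by
    intro s
    have h3 : Agree ((cap c d hcd l).comp (cap a b hab k)) (cap a b hab k) (s, a) :=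
      cap_comp_agree hcd l pc pd (by simp [hac]) (by simp [had]) (by simp [hac]) (by simp [had])
    cases s
    · have h2 := cap_comp_cap_end hab k (T := cap c d hcd l)
      refine ⟨h2.1, ?_, ?_⟩
      · rw [h2.1, h3.1, cap_partner_left]
      · rw [h2.2, h3.2, cap_dir_left_false]
    · have h2 := cap_comp_cup hab k pa pb
      refine ⟨h2.1, ?_, ?_⟩
      · rw [h2.1, h3.1, cap_partner_left]
      · rw [h2.2, h3.2, cap_dir_left_true, cap_dir _ _ _ hac had, cap_dir _ _ _ hbc hbd]
        ring
  have h2 : ∀ s, ((cap a b hab k).comp (cap c d hcd l)).partner (s, c) = (s, d) ∧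
      Agree ((cap a b hab k).comp (cap c d hcd l)) ((cap c d hcd l).comp (cap a b hab k))
        (s, c) := by
    intro s
    have h3 : Agree ((cap a b hab k).comp (cap c d hcd l)) (cap c d hcd l) (s, c) :=
      cap_comp_agree hab k pa pb (by simp [hac.symm]) (by simp [hbc.symm]) (by simp [hac.symm])
        (by simp [hbc.symm])
    refine ⟨h3.1.trans (cap_partner_left _ _ _), ?_⟩
    cases s
    · have h2 := cap_comp_cap_end hcd l (T := cap a b hab k)
      refine ⟨?_, ?_⟩
      · rw [h2.1, h3.1, cap_partner_left]
      · rw [h2.2, h3.2, cap_dir_left_false]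
    · have h2 := cap_comp_cup hcd l pc pd
      refine ⟨?_, ?_⟩
      · rw [h2.1, h3.1, cap_partner_left]
      · rw [h2.2, h3.2, cap_dir_left_true, cap_dir _ _ _ hac.symm hbc.symm,
          cap_dir _ _ _ had.symm hbd.symm]
        ring
  refine ext_agree ?_
  rintro ⟨s, x⟩
  by_cases ha : x = a
  · subst ha
    exact (h1 s).2
  by_cases hb : x = b
  · subst hb
    exact (h1 s).2.of_partner (h1 s).1
  by_cases hc : x = c
  · subst hc
    exact (h2 s).2
  by_cases hd : x = d
  · subst hd
    exact (h2 s).2.of_partner (h2 s).1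
  have h3 : Agree ((cap a b hab k).comp (cap c d hcd l)) (cap c d hcd l) (s, x) :=
    cap_comp_agree hab k pa pb (by simp [ha]) (by simp [hb]) (by simp [ha]) (by simp [hb])
  have h4 : Agree ((cap c d hcd l).comp (cap a b hab k)) (cap a b hab k) (s, x) :=
    cap_comp_agree hcd l pc pd (by simp [hc]) (by simp [hd]) (by simp [hc]) (by simp [hd])
  refine ⟨?_, ?_⟩
  · rw [h3.1, h4.1, cap_partner _ _ _ ha hb, cap_partner _ _ _ hc hd]
  · rw [h3.2, h4.2, cap_dir _ _ _ ha hb, cap_dir _ _ _ hc hd]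

/-! ### A cap against a cap on the same points: a closed cycle. -/

section Loop

variable (ha : T.partner (false, a) = (false, b))

include ha

/-- A cap multiplied by a tangle with the same pair. -/
theorem cap_comp_of_cap (hT : ∀ v : Vertex n, v ≠ (false, a) → v ≠ (false, b) →
    Agree T (cap a b hab k) v) : (cap a b hab k).comp T = cap a b hab k := by
  have hb : T.partner (false, b) = (false, a) := by rw [← ha, T.partner_partner]
  symm
  refine agree_cap hab k (fun s => ?_) fun x hxa hxb => ?_
  · cases s
    · have h := cap_comp_cap_end hab k (T := T)
      exact ⟨by rw [h.1, cap_partner_left], by rw [h.2, cap_dir_left_false]⟩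
    · obtain ⟨h1, h2⟩ := hT (true, a) (by simp) (by simp)
      rw [cap_partner_left] at h1
      rw [cap_dir_left_true] at h2
      have h := comp_of_path (v := (true, a)) (Path.right_end (F := cap a b hab k) h1)
      exact ⟨by rw [h.1, cap_partner_left], by rw [h.2, h2, cap_dir_left_true]⟩
  · obtain ⟨h1, h2⟩ := hT (false, x) (by simp [hxa]) (by simp [hxb])
    rw [cap_partner _ _ _ hxa hxb] at h1
    rw [cap_dir _ _ _ hxa hxb] at h2
    have h := comp_of_path (v := (false, x)) (Path.left_step
      (cap_partner hab k false hxa hxb) (Path.right_end h1))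
    rw [cap_dir _ _ _ hxa hxb, h2, tw_zero] at h
    exact ⟨by rw [h.1, cap_partner _ _ _ hxa hxb]; rfl, by rw [h.2, cap_dir _ _ _ hxa hxb]⟩

/-- The cup {(1,a),(1,b)} and the cap of `T` form the only cycle, of two pairs, with `a` as its
smallest position. All other points (1,x) of the first tangle leave immediately through a vertical
strand. -/
theorem cap_loopWeight_of_cap (hlt : a < b) :
    (cap a b hab k).loopWeight T =
      MvPolynomial.X ((T.dir (false, a) - (2 * k + 1)).natAbs / 2) := by
  have hb : T.partner (false, b) = (false, a) := by rw [← ha, T.partner_partner]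
  have e1 : FlatTangle.next (cap a b hab k).toFlatTangle T.toFlatTangle (false, (true, a)) =
      (true, (false, b)) := pairSys_next_false (cap_partner_left hab k true)
  have e2 : FlatTangle.next (cap a b hab k).toFlatTangle T.toFlatTangle (true, (false, b)) =
      (false, (true, a)) := pairSys_next_true hb
  have e3 : FlatTangle.next (cap a b hab k).toFlatTangle T.toFlatTangle (false, (true, b)) =
      (true, (false, a)) := pairSys_next_false (cap_partner_right hab k true)
  have hp : Function.IsPeriodicPt
      (FlatTangle.next (cap a b hab k).toFlatTangle T.toFlatTangle) 2 (false, (true, a)) := by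
    change FlatTangle.next _ _ (FlatTangle.next _ _ _) = _
    rw [e1, e2]
  have hc : cycles (cap a b hab k).toFlatTangle T.toFlatTangle = {a} := by
    ext x
    rw [Finset.mem_singleton, mem_cycles]
    constructor
    · intro h
      by_contra hxa
      by_cases hxb : x = b
      · subst hxb
        have := (h 1).2
        rw [Function.iterate_one, e3] at this
        exact absurd hlt (not_lt.2 this)
      · have := (h 1).1
        rw [Function.iterate_one] at this
        have h2 : FlatTangle.next (cap a b hab k).toFlatTangle T.toFlatTangle (false, (true, x)) =
          (false, (false, x)) := pairSys_next_false (cap_partner hab k true hxa hxb)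
        rw [h2] at this
        exact this rfl
    · rintro rfl j
      rw [← hp.iterate_mod_apply]
      have hj : j % 2 < 2 := Nat.mod_lt _ (by norm_num)
      interval_cases j % 2
      · exact ⟨by simp [IsOuter], le_rfl⟩
      · rw [Function.iterate_one, e1]
        exact ⟨by simp [IsOuter], hlt.le⟩
  have hm : Function.minimalPeriod
      (FlatTangle.next (cap a b hab k).toFlatTangle T.toFlatTangle) (false, (true, a)) = 2 := by
    refine Function.minimalPeriod_eq_prime hp ?_
    rw [Function.IsFixedPt, e1]
    simp
  rw [loopWeight, hc, Finset.prod_singleton, zigzag, cycleLength, hm, (pathSum_eq_prod _ _ _ _).1]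
  congr 2
  have hd : T.dir (false, b) = - T.dir (false, a) := by
    rw [← ha, dir_partner, st_odd]
    rw [odd_dir, ha]
  have : (pairSys (cap a b hab k) T).prod (false, (true, a)) 2 =
      T.dir (false, a) - (2 * k + 1) := by
    change tw (tw 0 ((cap a b hab k).dir (true, a))) ((pairSys (cap a b hab k) T).lab
      (FlatTangle.next (cap a b hab k).toFlatTangle T.toFlatTangle (false, (true, a)))) = _
    rw [e1, zero_tw, cap_dir_left_true, tw_odd (odd_two_mul_add_one k).neg]
    change -(2 * k + 1) - T.dir (false, b) = _
    rw [hd]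
    ring
  rw [this]

end Loop

/-! ### A cap against a cap with one common point: a straightened zigzag. -/

section Slide

variable {x : Fin n} (hac : a ≠ c) (hb : T.partner (false, b) = (false, c))
  (ha : T.partner (false, a) = (true, x))

include hac hb ha

theorem cap_loopWeight_of_adjacent : (cap a b hab k).loopWeight T = 1 := by
  have hc : T.partner (false, c) = (false, b) := by rw [← hb, T.partner_partner]
  have hcb : c ≠ b := by
    rintro rfl
    exact T.partner_ne _ hb
  refine loopWeight_eq_one fun y => ?_
  by_cases hya : y = a
  · subst hya
    exact ⟨_, _, Path.left_step (cap_partner_left hab k true) (Path.right_step hb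
      (Path.left_end (cap_partner hab k true hac.symm hcb)))⟩
  by_cases hyb : y = b
  · subst hyb
    exact ⟨_, _, Path.left_step (cap_partner_right hab k true) (Path.right_end ha)⟩
  exact ⟨_, _, Path.left_end (cap_partner hab k true hya hyb)⟩

/-- From `c` the path follows the cap of `T` to `b`, the cup to `a`, and then the strand of `a`. Two
odd labels in succession restore the sign of the last one. -/
theorem cap_comp_adjacent : ((cap a b hab k).comp T).partner (false, c) = (true, x) ∧
    ((cap a b hab k).comp T).dir (false, c) =
      T.dir (false, c) - (2 * k + 1) + T.dir (false, a) := by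
  have hc : T.partner (false, c) = (false, b) := by rw [← hb, T.partner_partner]
  have hcb : c ≠ b := by
    rintro rfl
    exact T.partner_ne _ hb
  apply comp_of_path
  have h := Path.left_step (cap_partner hab k false hac.symm hcb)
    (Path.right_step hc (Path.left_step (cap_partner_right hab k true) (Path.right_end ha)))
  have ho : Odd (T.dir (false, c)) := by
    rw [odd_dir, hc]
  rw [cap_dir _ _ _ hac.symm hcb, zero_tw, cap_dir_right_true, tw_odd (odd_two_mul_add_one k),
    tw_odd ho] at h
  rw [sub_add]
  exact h

theorem cap_comp_agree_of_adjacent {v : Vertex n} (h1 : v ≠ (false, a)) (h2 : v ≠ (false, b))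
    (h3 : v ≠ (false, c)) (h4 : v ≠ (true, x)) : Agree ((cap a b hab k).comp T) T v := by
  have hc : T.partner (false, c) = (false, b) := by rw [← hb, T.partner_partner]
  have key : ∀ y, T.partner v = (false, y) → y ≠ a ∧ y ≠ b := by
    intro y hw
    have hy := T.partner_partner v
    rw [hw] at hy
    refine ⟨?_, ?_⟩
    · rintro rfl
      rw [ha] at hy
      exact h4 hy.symm
    · rintro rfl
      rw [hb] at hy
      exact h3 hy.symm
  apply comp_of_path
  have hv : Path (cap a b hab k) T (true, v) (T.partner v) (T.dir v) := by
    rcases hw : T.partner v with ⟨_ | _, y⟩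
    · obtain ⟨hya, hyb⟩ := key y hw
      have h1 := Path.left_end (F' := T) (cap_partner hab k true hya hyb)
      rw [cap_dir _ _ _ hya hyb] at h1
      have h2 := Path.right_step hw h1
      rwa [tw_zero] at h2
    · exact Path.right_end hw
  rcases v with ⟨_ | _, y⟩
  · have hya : y ≠ a := fun h => h1 (by rw [h])
    have hyb : y ≠ b := fun h => h2 (by rw [h])
    have := Path.left_step (cap_partner hab k false hya hyb) hv
    rwa [cap_dir _ _ _ hya hyb, zero_tw] at this
  · exact hv

end Slide

/-- The relation `F w F = F`. -/
theorem cap_comp_swap_comp_cap (hac : a ≠ c) (hbc : b ≠ c) :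
    (cap a b hab k).loopWeight ((strands (Equiv.swap a c) 0).comp (cap a b hab k)) = 1 ∧
    (cap a b hab k).comp ((strands (Equiv.swap a c) 0).comp (cap a b hab k)) = cap a b hab k := by
  have hsb : Equiv.swap a c b = b := Equiv.swap_apply_of_ne_of_ne hab.symm hbc
  -- After the crossing, the second factor joins `b` to `c` on the side 0 and lets `a` pass to
  -- (1,c), so the cap on `a`, `b` meets it in the zigzag configuration.
  have hTb := strands_comp (Equiv.swap a c) 0 (cap a b hab k) (v := (false, b)) (w := (false, a))
    (by simp [moveLeft, hsb])
  have hTc := strands_comp (Equiv.swap a c) 0 (cap a b hab k) (v := (false, c)) (w := (false, b))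
    (by simp [moveLeft])
  have hTa := strands_comp (Equiv.swap a c) 0 (cap a b hab k) (v := (false, a)) (w := (true, c))
    (by simp [moveLeft, cap_partner _ _ _ hac.symm hbc.symm])
  have hTt := strands_comp (Equiv.swap a c) 0 (cap a b hab k) (v := (true, a)) (w := (true, b))
    (by simp [moveLeft])
  have hTx : ∀ x, x ≠ a → x ≠ b → x ≠ c → _ := fun x hxa hxb hxc =>
    strands_comp (Equiv.swap a c) 0 (cap a b hab k) (v := (false, x)) (w := (true, x))
    (by simp [moveLeft, Equiv.swap_apply_of_ne_of_ne hxa hxc, cap_partner _ _ _ hxa hxb])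
  simp [moveLeft, hsb] at hTb
  simp [moveLeft] at hTc
  simp [moveLeft, cap_dir _ _ _ hac.symm hbc.symm] at hTa
  simp [moveLeft, -neg_add_rev] at hTt
  refine ⟨cap_loopWeight_of_adjacent hab k hac hTb.1 hTa.1, ?_⟩
  symm
  refine agree_cap hab k (fun s => ?_) fun x hxa hxb => ?_
  · cases s
    · have h := cap_comp_cap_end hab k (T := (strands (Equiv.swap a c) 0).comp (cap a b hab k))
      exact ⟨by rw [h.1, cap_partner_left], by rw [h.2, cap_dir_left_false]⟩
    · have h := cap_comp_agree_of_adjacent hab k hac hTb.1 hTa.1 (v := (true, a)) (by simp)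
        (by simp) (by simp) (by simp [hac])
      exact ⟨by rw [h.1, hTt.1, cap_partner_left], by rw [h.2, hTt.2, cap_dir_left_true]⟩
  · by_cases hxc : x = c
    · subst hxc
      have h := cap_comp_adjacent hab k hac hTb.1 hTa.1
      refine ⟨by rw [h.1, cap_partner _ _ _ hxa hxb]; rfl, ?_⟩
      rw [h.2, hTc.2, hTa.2, cap_dir _ _ _ hxa hxb]
      ring
    · have h := cap_comp_agree_of_adjacent hab k hac hTb.1 hTa.1 (v := (false, x)) (by simp [hxa])
        (by simp [hxb]) (by simp [hxc]) (by simp)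
      have h' := hTx x hxa hxb hxc
      simp [moveLeft, Equiv.swap_apply_of_ne_of_ne hxa hxc, cap_dir _ _ _ hxa hxb] at h'
      exact ⟨by rw [h.1, h'.1, cap_partner _ _ _ hxa hxb]; rfl,
        by rw [h.2, h'.2, cap_dir _ _ _ hxa hxb]⟩

end ArrowTangle

end ArrowTL

namespace ArrowTL

open FlatTangle ArrowTangle

variable {n : ℕ}

theorem lo_ne_hi (i : Fin (n - 1)) : lo i ≠ hi i := by simp [lo, hi, Fin.ext_iff]

namespace ATL

/-! ### The defining relations hold for tangles -/

/-- The basis element of an invertible tangle. -/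
noncomputable def str (e : Equiv.Perm (Fin n)) (c : Fin n → ℤ) : ATL n := of (strands e c)

/-- The basis element of a cap. -/
noncomputable def capElt (a b : Fin n) (h : a ≠ b) (k : ℤ) : ATL n := of (cap a b h k)

theorem of_mul_of_of_loopWeight {F F' : ArrowTangle n} (h : F.loopWeight F' = 1) :
    of F * of F' = of (F.comp F') := by
  rw [of_mul_of, h, one_smul]

theorem str_mul_of (e : Equiv.Perm (Fin n)) (c : Fin n → ℤ) (T : ArrowTangle n) :
    str e c * of T = of ((strands e c).comp T) :=
  of_mul_of_of_loopWeight (strands_loopWeight e c T)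

theorem of_mul_str (e : Equiv.Perm (Fin n)) (c : Fin n → ℤ) (T : ArrowTangle n) :
    of T * str e c = of (T.comp (strands e c)) :=
  of_mul_of_of_loopWeight (loopWeight_strands e c T)

theorem str_mul_str (e e' : Equiv.Perm (Fin n)) (c c' : Fin n → ℤ) :
    str e c * str e' c' = str (e' * e) (c + c' ∘ e) := by
  rw [str, str, ← str, str_mul_of, strands_comp_strands, str]

theorem str_one : (str 1 0 : ATL n) = 1 := rfl

theorem str_mul_capElt {a b : Fin n} (hab : a ≠ b) (e : Equiv.Perm (Fin n)) (c : Fin n → ℤ)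
    (he : e a ≠ e b) (k : ℤ) :
    str e c * capElt (e a) (e b) he k = capElt a b hab (k + c a - c b) * str e c := by
  rw [capElt, capElt, str_mul_of, of_mul_str, strands_comp_cap hab]

theorem capElt_mul_str_single {a b : Fin n} (hab : a ≠ b) (k m : ℤ) :
    capElt a b hab k * str 1 (Pi.single a m + Pi.single b m) = capElt a b hab k := by
  rw [capElt, of_mul_str, cap_comp_slide]

theorem capElt_mul_str_swap {a b : Fin n} (hab : a ≠ b) :
    capElt a b hab 0 * str (Equiv.swap a b) 0 = capElt a b hab 0 * str 1 (Pi.single a 1) := by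
  rw [capElt, of_mul_str, of_mul_str, cap_comp_swap]

theorem str_swap_mul_capElt {a b : Fin n} (hab : a ≠ b) :
    str (Equiv.swap a b) 0 * capElt a b hab 0 = str 1 (Pi.single a (-1)) * capElt a b hab 0 := by
  rw [capElt, str_mul_of, str_mul_of, swap_comp_cap]

theorem capElt_comm {a b c d : Fin n} (hab : a ≠ b) (hcd : c ≠ d) (k l : ℤ) (hac : a ≠ c)
    (had : a ≠ d) (hbc : b ≠ c) (hbd : b ≠ d) :
    capElt a b hab k * capElt c d hcd l = capElt c d hcd l * capElt a b hab k := by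
  rw [capElt, capElt, of_mul_of_of_loopWeight, of_mul_of_of_loopWeight, cap_comp_cap_comm hab k hcd l hac had hbc hbd]
  · exact cap_loopWeight_of_through hcd l (cap_partner hab k false hac.symm hbc.symm)
      (cap_partner hab k false had.symm hbd.symm)
  · exact cap_loopWeight_of_through hab k (cap_partner hcd l false hac had)
      (cap_partner hcd l false hbc hbd)

theorem capElt_symm {a b : Fin n} (hab : a ≠ b) (k : ℤ) :
    capElt a b hab k = capElt b a hab.symm (-k - 1) := by
  rw [capElt, cap_symm, capElt]

theorem capElt_mul_swap_mul_capElt {a b c : Fin n} (hab : a ≠ b) (k : ℤ) (hac : a ≠ c)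
    (hbc : b ≠ c) : capElt a b hab k * str (Equiv.swap a c) 0 * capElt a b hab k =
      capElt a b hab k := by
  have h := cap_comp_swap_comp_cap hab k hac hbc
  rw [mul_assoc, capElt, str_mul_of, of_mul_of_of_loopWeight h.1, h.2]

/-- The torus element raises the label of the second cap to 2m + 1. Closed by the cup with label 1,
it gives a cycle of sum 2m. -/
theorem capElt_mul_str_mul_capElt {a b : Fin n} (hab : a < b) (m : ℤ) :
    capElt a b hab.ne 0 * str 1 (Pi.single a m) * capElt a b hab.ne 0 =
      (MvPolynomial.X m.natAbs : R0a) • capElt a b hab.ne 0 := by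
  have h1 : ∀ v : Vertex n, moveLeft 1 v = v := by
    rintro ⟨_ | _, b⟩ <;> rfl
  have h2 : ∀ v : Vertex n, moveLeft (Equiv.symm 1) v = v := h1
  have h3 : ∀ v, ((strands 1 (Pi.single a m)).comp (cap a b hab.ne 0)).partner v =
      (cap a b hab.ne 0).partner v := by
    intro v
    rw [(strands_comp 1 (Pi.single a m) (cap a b hab.ne 0) (v := v) rfl).1, h1, h2]
  have h4 := fun v => (strands_comp 1 (Pi.single a m) (cap a b hab.ne 0) (v := v) rfl).2
  have h5 : ((strands 1 (Pi.single a m)).comp (cap a b hab.ne 0)).partner (false, a) =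
      (false, b) := by rw [h3, cap_partner_left]
  have h6 := h4 (false, a)
  simp [h1, hab.ne'] at h6
  rw [mul_assoc, capElt, str_mul_of, of_mul_of, cap_loopWeight_of_cap hab.ne 0 h5 hab, h6,
    cap_comp_of_cap hab.ne 0 h5]
  · congr 2
    omega
  · rintro ⟨s, x⟩ hva hvb
    refine ⟨h3 _, ?_⟩
    rw [h4, h1]
    by_cases hxa : x = a
    · subst hxa
      cases s
      · exact absurd rfl hva
      · simp
    · by_cases hxb : x = b
      · subst hxb
        cases s
        · exact absurd rfl hvb
        · simp
      · cases s <;> simp [cap_partner _ _ _ hxa hxb, cap_dir _ _ _ hxa hxb, hxa]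

/-- The tangle of a generator. -/
def genTangle : Gen n → ArrowTangle n
  | .F i => FTangle i
  | .w i => wTangle i
  | .t j => tTangle j
  | .tInv j => tInvTangle j

variable (n) in
/-- The homomorphism from the free algebra that sends each generator to its tangle. -/
noncomputable def freeHom : FreeAlgebra R0a (Gen n) →ₐ[R0a] ATL n :=
  FreeAlgebra.lift R0a fun g => of (genTangle g)

theorem freeHom_F (i : Fin (n - 1)) :
    freeHom n (Gen.xF i) = capElt (lo i) (hi i) (lo_ne_hi i) 0 := by
  rw [Gen.xF, freeHom, FreeAlgebra.lift_ι_apply, genTangle, FTangle_eq_cap i (lo_ne_hi i), capElt]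

theorem freeHom_w (i : Fin (n - 1)) :
    freeHom n (Gen.xw i) = str (Equiv.swap (lo i) (hi i)) 0 := by
  rw [Gen.xw, freeHom, FreeAlgebra.lift_ι_apply, genTangle, wTangle, str]

theorem freeHom_t (j : Fin n) : freeHom n (Gen.xt j) = str 1 (Pi.single j 1) := by
  rw [Gen.xt, freeHom, FreeAlgebra.lift_ι_apply, genTangle, tTangle, str]

theorem freeHom_tInv (j : Fin n) : freeHom n (Gen.xtInv j) = str 1 (Pi.single j (-1)) := by
  rw [Gen.xtInv, freeHom, FreeAlgebra.lift_ι_apply, genTangle, tInvTangle, str]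

theorem str_one_mul_str_one (c c' : Fin n → ℤ) : str 1 c * str 1 c' = str 1 (c + c') :=
  str_mul_str 1 1 c c'

theorem str_single_pow (j : Fin n) (m : ℤ) (k : ℕ) :
    str 1 (Pi.single j m) ^ k = str 1 (Pi.single j (k * m)) := by
  induction k with
  | zero => simp [str_one]
  | succ k ih =>
    rw [pow_succ, ih, str_one_mul_str_one, ← Pi.single_add]
    congr 2
    push_cast
    ring

theorem freeHom_tPow (j : Fin n) (m : ℤ) :
    freeHom n (Gen.xtPow j m) = str 1 (Pi.single j m) := by
  cases m with
  | ofNat k =>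
    rw [Gen.xtPow, map_pow, freeHom_t, str_single_pow, mul_one]
    rfl
  | negSucc k =>
    rw [Gen.xtPow, map_pow, freeHom_tInv, str_single_pow, Int.negSucc_eq]
    congr 2
    push_cast
    ring

theorem single_comp_perm (e : Equiv.Perm (Fin n)) (j : Fin n) (m : ℤ) :
    (Pi.single (e j) m : Fin n → ℤ) ∘ e = Pi.single j m := by
  ext x
  simp [Pi.single_apply]

theorem str_mul_str_single (e : Equiv.Perm (Fin n)) (j : Fin n) (m : ℤ) :
    str e 0 * str 1 (Pi.single (e j) m) = str 1 (Pi.single j m) * str e 0 := by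
  rw [str_mul_str, str_mul_str, single_comp_perm]
  simp

theorem swap_comm_of_disjoint {a b c d : Fin n} (hac : a ≠ c) (had : a ≠ d) (hbc : b ≠ c)
    (hbd : b ≠ d) : Equiv.swap a b * Equiv.swap c d = Equiv.swap c d * Equiv.swap a b := by
  have := Equiv.swap_mul_eq_mul_swap (Equiv.swap c d) a b
  rw [this, Equiv.swap_inv, Equiv.swap_apply_of_ne_of_ne hac had,
    Equiv.swap_apply_of_ne_of_ne hbc hbd]

theorem far_ne {i j : Fin (n - 1)} (h : Far i j) :
    lo i ≠ lo j ∧ lo i ≠ hi j ∧ hi i ≠ lo j ∧ hi i ≠ hi j := by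
  simp only [lo, hi, ne_eq, Fin.mk.injEq]
  unfold Far at h
  omega

theorem str_mul_capElt_of_apply_eq {a b c d : Fin n} (hab : a ≠ b) (hcd : c ≠ d)
    (e : Equiv.Perm (Fin n)) (x : Fin n → ℤ) (k : ℤ) (hc : e a = c) (hd : e b = d) :
    str e x * capElt c d hcd k = capElt a b hab (k + x a - x b) * str e x := by
  subst hc hd
  exact str_mul_capElt hab e x hcd k

theorem braid_swap {a b c : Fin n} (hab : a ≠ b) (hbc : b ≠ c) (hac : a ≠ c) :
    Equiv.swap a b * Equiv.swap b c * Equiv.swap a b =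
      Equiv.swap b c * Equiv.swap a b * Equiv.swap b c := by
  rw [Equiv.swap_mul_swap_mul_swap hab hac, Equiv.swap_comm a b, Equiv.swap_comm b c,
    Equiv.swap_mul_swap_mul_swap hbc.symm hac.symm, Equiv.swap_comm]

theorem near_apply {i j : Fin (n - 1)} (h : Near i j) :
    (Equiv.swap (lo j) (hi j) * Equiv.swap (lo i) (hi i)) (lo j) = lo i ∧
    (Equiv.swap (lo j) (hi j) * Equiv.swap (lo i) (hi i)) (hi j) = hi i := by
  rw [Equiv.Perm.mul_apply, Equiv.Perm.mul_apply]
  rcases h with h | h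
  · have e1 : lo j = hi i := Fin.ext h.symm
    have h1 : lo i ≠ hi j := by
      simp only [lo, hi, ne_eq, Fin.mk.injEq]
      omega
    have h2 : hi i ≠ hi j := e1 ▸ lo_ne_hi j
    rw [e1, Equiv.swap_apply_right, Equiv.swap_apply_of_ne_of_ne (lo_ne_hi i) h1,
      Equiv.swap_apply_of_ne_of_ne h1.symm h2.symm, Equiv.swap_apply_right]
    exact ⟨rfl, rfl⟩
  · have e1 : lo i = hi j := Fin.ext h.symm
    have h1 : hi i ≠ lo j := by
      simp only [lo, hi, ne_eq, Fin.mk.injEq]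
      omega
    have h2 : hi i ≠ hi j := e1 ▸ (lo_ne_hi i).symm
    rw [e1, Equiv.swap_apply_left, Equiv.swap_apply_of_ne_of_ne (lo_ne_hi j) h1.symm,
      Equiv.swap_apply_of_ne_of_ne h1 h2, Equiv.swap_apply_left]
    exact ⟨rfl, rfl⟩

theorem freeHom_rel {x y : FreeAlgebra R0a (Gen n)} (h : Rel n x y) :
    freeHom n x = freeHom n y := by
  cases h with
  | t_tInv i =>
    rw [map_mul, freeHom_t, freeHom_tInv, str_one_mul_str_one, ← Pi.single_add, map_one]
    simp [str_one]
  | tInv_t i =>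
    rw [map_mul, freeHom_t, freeHom_tInv, str_one_mul_str_one, ← Pi.single_add, map_one]
    simp [str_one]
  | t_t i j h =>
    rw [map_mul, map_mul, freeHom_t, freeHom_t, str_one_mul_str_one, str_one_mul_str_one, add_comm]
  | w_w i =>
    rw [map_mul, freeHom_w, str_mul_str, map_one, Equiv.swap_mul_self]
    simp [str_one]
  | w_w_far i j h =>
    obtain ⟨h1, h2, h3, h4⟩ := far_ne h
    rw [map_mul, map_mul, freeHom_w, freeHom_w, str_mul_str, str_mul_str,
      swap_comm_of_disjoint h1 h2 h3 h4]
    rfl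
  | w_w_w i j h =>
    simp only [map_mul, freeHom_w, str_mul_str, ← mul_assoc]
    have key : Equiv.swap (lo i) (hi i) * Equiv.swap (lo j) (hi j) * Equiv.swap (lo i) (hi i) =
        Equiv.swap (lo j) (hi j) * Equiv.swap (lo i) (hi i) * Equiv.swap (lo j) (hi j) := by
      rcases h with h | h
      · have e1 : lo j = hi i := Fin.ext h.symm
        rw [e1]
        refine braid_swap (lo_ne_hi i) (e1 ▸ lo_ne_hi j) ?_
        simp only [lo, hi, ne_eq, Fin.mk.injEq]
        omega
      · have e1 : lo i = hi j := Fin.ext h.symm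
        rw [e1]
        refine (braid_swap (lo_ne_hi j) (e1 ▸ lo_ne_hi i) ?_).symm
        simp only [lo, hi, ne_eq, Fin.mk.injEq]
        omega
    rw [key]
    rfl
  | w_t_lo i =>
    rw [map_mul, map_mul, freeHom_t, freeHom_t, freeHom_w]
    have := str_mul_str_single (Equiv.swap (lo i) (hi i)) (hi i) 1
    rwa [Equiv.swap_apply_right] at this
  | w_t_hi i =>
    rw [map_mul, map_mul, freeHom_t, freeHom_t, freeHom_w]
    have := str_mul_str_single (Equiv.swap (lo i) (hi i)) (lo i) 1
    rwa [Equiv.swap_apply_left] at this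
  | w_t i j h h' =>
    rw [map_mul, map_mul, freeHom_t, freeHom_w]
    have := str_mul_str_single (Equiv.swap (lo i) (hi i)) j 1
    rwa [Equiv.swap_apply_of_ne_of_ne h h'] at this
  | F_t_F i m =>
    rw [map_mul, map_mul, map_smul, freeHom_F, freeHom_tPow]
    exact capElt_mul_str_mul_capElt (a := lo i) (b := hi i) (Nat.lt_succ_self _) m
  | F_w i =>
    rw [map_mul, map_mul, freeHom_F, freeHom_w, freeHom_t, capElt_mul_str_swap]
  -- The cap on the left first absorbs the slide by -1; this cancels the t at the lower point and
  -- leaves the inverse at the upper one.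
  | F_t_lo i =>
    rw [map_mul, map_mul, freeHom_F, freeHom_tInv, freeHom_t,
      ← capElt_mul_str_single (lo_ne_hi i) 0 (-1), mul_assoc, str_one_mul_str_one,
      add_right_comm, ← Pi.single_add, capElt_mul_str_single]
    simp
  | w_F i =>
    rw [map_mul, map_mul, freeHom_F, freeHom_tInv, freeHom_w, str_swap_mul_capElt]
  | tInv_F i =>
    rw [map_mul, map_mul, freeHom_F, freeHom_tInv, freeHom_t]
    -- Pushed through the cap, both torus elements turn its parameter into -1; the factors that
    -- remain on the right differ by a slide.
    have h1 := str_mul_capElt (lo_ne_hi i) 1 (Pi.single (lo i) (-1)) (lo_ne_hi i) 0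
    have h2 := str_mul_capElt (lo_ne_hi i) 1 (Pi.single (hi i) 1) (lo_ne_hi i) 0
    simp [lo_ne_hi i, (lo_ne_hi i).symm] at h1 h2
    rw [h1, h2]
    conv_lhs =>
      rw [← capElt_mul_str_single (lo_ne_hi i) (-1) 1, mul_assoc, str_one_mul_str_one,
        add_right_comm, ← Pi.single_add]
    simp
  | F_F_far i j h =>
    obtain ⟨h1, h2, h3, h4⟩ := far_ne h
    rw [map_mul, map_mul, freeHom_F, freeHom_F, capElt_comm _ _ _ _ h1 h2 h3 h4]
  | F_w_far i j h =>
    obtain ⟨h1, h2, h3, h4⟩ := far_ne h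
    rw [map_mul, map_mul, freeHom_F, freeHom_w]
    have := str_mul_capElt_of_apply_eq (lo_ne_hi i) (lo_ne_hi i) (Equiv.swap (lo j) (hi j)) 0 0
      (Equiv.swap_apply_of_ne_of_ne h1 h2) (Equiv.swap_apply_of_ne_of_ne h3 h4)
    simpa using this.symm
  | F_t i j h h' =>
    rw [map_mul, map_mul, freeHom_F, freeHom_t]
    have := str_mul_capElt (lo_ne_hi i) 1 (Pi.single j 1) (lo_ne_hi i) 0
    simp [h.symm, h'.symm] at this
    exact this.symm
  | F_w_F i j h =>
    rw [map_mul, map_mul, freeHom_F, freeHom_w]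
    rcases h with h | h
    · have e1 : lo j = hi i := Fin.ext h.symm
      have h1 : lo i ≠ hi j := by
        simp only [lo, hi, ne_eq, Fin.mk.injEq]
        omega
      -- The lemma on F w F wants the point shared with the crossing as the first point of the cap,
      -- hence the change of orientation.
      rw [e1, capElt_symm, capElt_mul_swap_mul_capElt _ _ (e1 ▸ lo_ne_hi j) h1]
    · have e1 : lo i = hi j := Fin.ext h.symm
      have h1 : hi i ≠ lo j := by
        simp only [lo, hi, ne_eq, Fin.mk.injEq]
        omega
      rw [← e1, Equiv.swap_comm, capElt_mul_swap_mul_capElt _ _ (e1 ▸ (lo_ne_hi j).symm) h1]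
  | w_w_F i j h =>
    rw [map_mul, map_mul, map_mul, map_mul, freeHom_F, freeHom_F, freeHom_w, freeHom_w,
      mul_assoc (capElt _ _ _ _), str_mul_str]
    have h3 : (0 + (0 : Fin n → ℤ) ∘ (Equiv.swap (lo i) (hi i))) = 0 := rfl
    rw [h3]
    have key := near_apply h
    have := str_mul_capElt_of_apply_eq (lo_ne_hi j) (lo_ne_hi i) _ 0 0 key.1 key.2
    simpa using this

variable (n) in
/-- The homomorphism from the presented algebra that sends each generator to its tangle. -/
noncomputable def presentedHom : Presented n →ₐ[R0a] ATL n :=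
  RingQuot.liftAlgHom R0a ⟨freeHom n, fun _ _ h => freeHom_rel h⟩

theorem presentedHom_mk (x : FreeAlgebra R0a (Gen n)) :
    presentedHom n (RingQuot.mkAlgHom R0a (Rel n) x) = freeHom n x := by
  rw [presentedHom, RingQuot.liftAlgHom_mkAlgHom_apply]

end ATL

end ArrowTL

namespace ArrowTL

/-! ### The Coxeter presentation of the symmetric group -/

namespace Coxeter

/-! ### Coset representatives in a group with braid relations. -/

section Words

variable {H : Type*} [Group H] (x : ℕ → H)

/-- The product `x j * x (j + 1) * ⋯ * x (j + m - 1)`. -/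
def run (j : ℕ) : ℕ → H
  | 0 => 1
  | m + 1 => x j * run (j + 1) m

/-- The subgroup generated by `x i` for `i < k`. -/
def initial (k : ℕ) : Subgroup H := Subgroup.closure (x '' {i | i < k})

variable {x} {N : ℕ}

theorem mem_initial {i k : ℕ} (h : i < k) : x i ∈ initial x k :=
  Subgroup.subset_closure ⟨i, h, rfl⟩

variable (far : ∀ i j, i + 2 ≤ j → x i * x j = x j * x i)

include far in
theorem mul_run_of_lt (i j m : ℕ) (h : i + 2 ≤ j) : x i * run x j m = run x j m * x i := by
  induction m generalizing j with
  | zero => simp [run]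
  | succ m ih => rw [run, ← mul_assoc, far i j h, mul_assoc, ih (j + 1) (by omega), mul_assoc]

variable (braid : ∀ i, i + 1 < N → x i * x (i + 1) * x i = x (i + 1) * x i * x (i + 1))

-- The letter commutes with the run up to two adjacent places where the braid relation applies; it
-- comes out with its index lowered by one.
include far braid in
theorem mul_run_of_gt (d j m : ℕ) (h : d + 2 ≤ m) (hN : j + d + 1 < N) :
    x (j + d + 1) * run x j m = run x j m * x (j + d) := by
  induction d generalizing j m with
  | zero =>
    obtain ⟨m, rfl⟩ : ∃ m', m = m' + 2 := ⟨m - 2, by omega⟩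
    rw [run, run, add_zero, ← mul_assoc, ← mul_assoc, ← braid j hN, mul_assoc _ (x j),
      mul_run_of_lt far j (j + 1 + 1) m (by omega)]
    simp only [mul_assoc]
  | succ d ih =>
    obtain ⟨m, rfl⟩ : ∃ m', m = m' + 1 := ⟨m - 1, by omega⟩
    rw [run, ← mul_assoc, ← far j (j + (d + 1) + 1) (by omega), mul_assoc,
      show j + (d + 1) + 1 = j + 1 + d + 1 by omega, ih (j + 1) m (by omega) (by omega), mul_assoc,
      show j + (d + 1) = j + 1 + d by omega]

variable (sq : ∀ i, x i * x i = 1)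

-- The runs x_j ⋯ x_k are coset representatives of `initial x k` in `initial x (k + 1)`: left
-- multiplication by a generator lengthens the run, shortens it, or moves through it into the
-- smaller subgroup.
include far braid sq in
theorem exists_run (k : ℕ) (hk : k < N) {y : H} (hy : y ∈ initial x (k + 1)) :
    ∃ j m g, j + m = k + 1 ∧ g ∈ initial x k ∧ y = run x j m * g := by
  have step : ∀ i < k + 1, ∀ y : H, (∃ j m g, j + m = k + 1 ∧ g ∈ initial x k ∧ y = run x j m * g) →
      ∃ j m g, j + m = k + 1 ∧ g ∈ initial x k ∧ x i * y = run x j m * g := by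
    rintro i hi y ⟨j, m, g, hjm, hg, rfl⟩
    rcases lt_trichotomy i j with h | h | h
    · rcases Nat.lt_or_ge (i + 1) j with h1 | h1
      · refine ⟨j, m, x i * g, hjm, mul_mem (mem_initial (by omega)) hg, ?_⟩
        rw [← mul_assoc, mul_run_of_lt far i j m h1, mul_assoc]
      · obtain rfl : j = i + 1 := by omega
        exact ⟨i, m + 1, g, by omega, hg, by rw [run, mul_assoc]⟩
    · subst h
      obtain ⟨m, rfl⟩ : ∃ m', m = m' + 1 := ⟨m - 1, by omega⟩
      exact ⟨i + 1, m, g, by omega, hg, by rw [run, ← mul_assoc, ← mul_assoc, sq, one_mul]⟩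
    · obtain ⟨d, rfl⟩ : ∃ d, i = j + d + 1 := ⟨i - j - 1, by omega⟩
      refine ⟨j, m, x (j + d) * g, hjm, mul_mem (mem_initial (by omega)) hg, ?_⟩
      rw [← mul_assoc, mul_run_of_gt far braid d j m (by omega) (by omega), mul_assoc]
  unfold initial at hy
  induction hy using Subgroup.closure_induction_left with
  | one => exact ⟨k + 1, 0, 1, rfl, one_mem _, by simp [run]⟩
  | mul_left y hy z hz ih =>
    obtain ⟨i, hi, rfl⟩ := hy
    exact step i hi _ ih
  | inv_mul_cancel y hy z hz ih =>
    obtain ⟨i, hi, rfl⟩ := hy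
    rw [inv_eq_of_mul_eq_one_left (sq i)]
    exact step i hi _ ih

end Words

/-! ### Lifting the braid relations to the symmetric group. -/

open ArrowTangle

variable {n : ℕ} {G : Type*} [Group G] (s : Fin (n - 1) → G)

/-- The transposition of `i` and `i + 1`, together with the `i`-th element of `G`. -/
def simple (i : ℕ) : Equiv.Perm (Fin n) × G :=
  if h : i < n - 1 then (Equiv.swap (lo ⟨i, h⟩) (hi ⟨i, h⟩), s ⟨i, h⟩) else 1

variable {s} in
theorem simple_apply_of_ne (i : ℕ) (v : Fin n) (h : (v : ℕ) ≠ i) (h' : (v : ℕ) ≠ i + 1) :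
    (simple s i).1 v = v := by
  unfold simple
  split_ifs with hi
  · exact Equiv.swap_apply_of_ne_of_ne (fun e => h (congrArg Fin.val e))
      (fun e => h' (congrArg Fin.val e))
  · rfl

theorem initial_apply (k : ℕ) {y : Equiv.Perm (Fin n) × G} (hy : y ∈ initial (simple s) k)
    (v : Fin n) (hv : k < v) : y.1 v = v := by
  unfold initial at hy
  induction hy using Subgroup.closure_induction with
  | mem y hy =>
    obtain ⟨i, hi, rfl⟩ := hy
    have hi' : i < k := hi
    exact simple_apply_of_ne i v (by omega) (by omega)
  | one => rfl
  | mul y z hy hz ih ih' => rw [Prod.fst_mul, Equiv.Perm.mul_apply, ih', ih]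
  | inv y hy ih =>
    rw [Prod.fst_inv, Equiv.Perm.inv_eq_iff_eq, ih]

theorem run_apply (j m : ℕ) (v w : Fin n) (hv : (v : ℕ) = j + m) (hw : (w : ℕ) = j) :
    (run (simple s) j m).1 v = w := by
  induction m generalizing j w with
  | zero => exact Fin.ext (by rw [hw]; exact hv)
  | succ m ih =>
    have hlt : j < n - 1 := by omega
    rw [run, Prod.fst_mul, Equiv.Perm.mul_apply, ih (j + 1) ⟨j + 1, by omega⟩ (by omega) rfl,
      simple, dif_pos hlt]
    have : (⟨j + 1, by omega⟩ : Fin n) = hi ⟨j, hlt⟩ := rfl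
    dsimp only
    rw [this, Equiv.swap_apply_right]
    exact Fin.ext hw.symm

variable {s} (sq : ∀ i, s i * s i = 1) (far : ∀ i j, Far i j → s i * s j = s j * s i)
  (braid : ∀ i j, Near i j → s i * s j * s i = s j * s i * s j)

include sq in
theorem simple_sq (i : ℕ) : simple s i * simple s i = 1 := by
  unfold simple
  split_ifs with h
  · rw [Prod.mk_mul_mk, Equiv.swap_mul_self, sq]
    rfl
  · exact one_mul 1

-- Beyond the range of indices `simple` is 1, so this relation holds for all natural indices. The
-- braid relation would fail at the boundary and keeps a bound.
include far in
theorem simple_far (i j : ℕ) (h : i + 2 ≤ j) :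
    simple s i * simple s j = simple s j * simple s i := by
  unfold simple
  split_ifs with h1 h2
  · have hf : Far (⟨i, h1⟩ : Fin (n - 1)) ⟨j, h2⟩ := Or.inl h
    obtain ⟨e1, e2, e3, e4⟩ := ATL.far_ne hf
    rw [Prod.mk_mul_mk, Prod.mk_mul_mk, far _ _ hf, ATL.swap_comm_of_disjoint e1 e2 e3 e4]
  · simp
  · simp
  · simp

include braid in
theorem simple_braid (i : ℕ) (h : i + 1 < n - 1) :
    simple s i * simple s (i + 1) * simple s i =
      simple s (i + 1) * simple s i * simple s (i + 1) := by
  unfold simple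
  have h0 : i < n - 1 := by omega
  rw [dif_pos h, dif_pos h0]
  simp only [Prod.mk_mul_mk]
  have hf : Near (⟨i, h0⟩ : Fin (n - 1)) ⟨i + 1, h⟩ := Or.inl rfl
  rw [braid _ _ hf]
  congr 1
  refine ATL.braid_swap (lo_ne_hi _) (lo_ne_hi (⟨i + 1, h⟩ : Fin (n - 1))) ?_
  simp only [lo, hi, ne_eq, Fin.mk.injEq]
  omega

-- An element of `initial (m + k + 1)` is a run times an element that fixes the point m + k + 1, and
-- the run carries this point to the start j of the run. If the point is fixed, the run is empty and
-- the element lies one level lower.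
include sq far braid in
theorem mem_initial_of_apply (k : ℕ) (y : Equiv.Perm (Fin n) × G)
    (hy : y ∈ initial (simple s) (n - 1)) (h : ∀ v : Fin n, k < v → y.1 v = v) :
    y ∈ initial (simple s) k := by
  have key : ∀ m, m + k ≤ n - 1 → y ∈ initial (simple s) (m + k) → y ∈ initial (simple s) k := by
    intro m
    induction m with
    | zero =>
      intro _ hm
      rwa [Nat.zero_add] at hm
    | succ m ih =>
      intro hm1 hm
      refine ih (by omega) ?_
      rw [show m + 1 + k = m + k + 1 by omega] at hm
      obtain ⟨j, l, g, hjl, hg, rfl⟩ := exists_run (N := n - 1) (simple_far far)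
        (simple_braid braid) (simple_sq sq) (m + k) (by omega) hm
      have hv := h ⟨m + k + 1, by omega⟩ (by simp only; omega)
      rw [Prod.fst_mul, Equiv.Perm.mul_apply, initial_apply s (m + k) hg _ (by simp),
        run_apply s j l _ ⟨j, by omega⟩ hjl.symm rfl, Fin.mk.injEq] at hv
      obtain rfl : l = 0 := by omega
      rwa [run, one_mul]
  rcases Nat.le_total k (n - 1) with hk | hk
  · exact key (n - 1 - k) (by omega) (by rwa [Nat.sub_add_cancel hk])
  · exact Subgroup.closure_mono (Set.image_mono fun i (hi : i < n - 1) => lt_of_lt_of_le hi hk) hy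

theorem closure_swap (n : ℕ) :
    Subgroup.closure (Set.range fun i : Fin (n - 1) => Equiv.swap (lo i) (hi i)) =
      (⊤ : Subgroup (Equiv.Perm (Fin n))) := by
  rcases n with _ | m
  · exact Subsingleton.elim _ _
  · have h := Equiv.Perm.mclosure_swap_castSucc_succ m
    rw [← top_le_iff]
    intro e _
    have he : e ∈ Submonoid.closure (Set.range fun i : Fin m ↦ Equiv.swap i.castSucc i.succ) := by
      rw [h]
      trivial
    have hs : Submonoid.closure (Set.range fun i : Fin m ↦ Equiv.swap i.castSucc i.succ) ≤
        (Subgroup.closure (Set.range fun i : Fin (m + 1 - 1) =>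
          Equiv.swap (lo i) (hi i))).toSubmonoid :=
      Submonoid.closure_le.2 Subgroup.subset_closure
    exact hs he

theorem exists_mem_initial (e : Equiv.Perm (Fin n)) :
    ∃ y ∈ initial (simple s) (n - 1), y.1 = e := by
  have he : e ∈ Subgroup.closure (Set.range fun i : Fin (n - 1) => Equiv.swap (lo i) (hi i)) := by
    rw [closure_swap]
    trivial
  have hs : Subgroup.closure (Set.range fun i : Fin (n - 1) => Equiv.swap (lo i) (hi i)) ≤
      (initial (simple s) (n - 1)).map (MonoidHom.fst _ _) := by
    rw [Subgroup.closure_le]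
    rintro _ ⟨i, rfl⟩
    refine ⟨simple s i, mem_initial i.isLt, ?_⟩
    simp [simple, i.isLt]
  obtain ⟨y, hy, rfl⟩ := hs he
  exact ⟨y, hy, rfl⟩

-- The subgroup generated by the pairs (transposition, `s i`) has trivial intersection with the
-- kernel of the first projection. It is thus the graph of a homomorphism on the permutations, which
-- `exists_hom` reads off.
include sq far braid in
theorem eq_of_mem_initial {y z : Equiv.Perm (Fin n) × G} (hy : y ∈ initial (simple s) (n - 1))
    (hz : z ∈ initial (simple s) (n - 1)) (h : y.1 = z.1) : y = z := by
  have h1 := mem_initial_of_apply sq far braid 0 (y * z⁻¹) (mul_mem hy (inv_mem hz)) (fun v _ => by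
    rw [Prod.fst_mul, Prod.fst_inv, h, mul_inv_cancel]
    rfl)
  have h2 : initial (simple s) 0 = ⊥ := by simp [initial]
  rw [h2, Subgroup.mem_bot] at h1
  exact mul_inv_eq_one.1 h1

include sq far braid in
/-- Elements of a group that satisfy the braid relations define a homomorphism from the symmetric
group. -/
theorem exists_hom : ∃ W : Equiv.Perm (Fin n) →* G, ∀ i, W (Equiv.swap (lo i) (hi i)) = s i := by
  choose f hf hf' using exists_mem_initial (s := s)
  refine ⟨⟨⟨fun e => (f e).2, ?_⟩, ?_⟩, fun i => ?_⟩
  · have := eq_of_mem_initial sq far braid (hf 1) (one_mem _) (hf' 1)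
    rw [this]
    rfl
  · intro e e'
    have := eq_of_mem_initial sq far braid (hf (e * e')) (mul_mem (hf e) (hf e'))
      (by rw [hf', Prod.fst_mul, hf', hf'])
    dsimp only
    rw [this]
    rfl
  · have := eq_of_mem_initial sq far braid (hf (Equiv.swap (lo i) (hi i)))
      (mem_initial (x := simple s) i.isLt) (by rw [hf']; simp [simple, i.isLt])
    change (f _).2 = _
    rw [this]
    simp [simple, i.isLt]

/-- A permutation that fixes the points after `k` is a product of the first adjacent
transpositions. -/
theorem mem_closure_swap (k : ℕ) (e : Equiv.Perm (Fin n)) (h : ∀ v : Fin n, k < v → e v = v) :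
    e ∈ Subgroup.closure {g | ∃ i : Fin (n - 1), (i : ℕ) < k ∧ g = Equiv.swap (lo i) (hi i)} := by
  -- With trivial second components the relations hold automatically, and the descent becomes a
  -- statement on permutations alone.
  obtain ⟨y, hy, rfl⟩ := exists_mem_initial (s := fun _ : Fin (n - 1) => (1 : Equiv.Perm (Fin n))) e
  have h1 := mem_initial_of_apply (s := fun _ : Fin (n - 1) => (1 : Equiv.Perm (Fin n)))
    (fun _ => one_mul (1 : Equiv.Perm (Fin n))) (fun _ _ _ => rfl) (fun _ _ _ => rfl) k y hy h
  have h2 : initial (simple fun _ : Fin (n - 1) => (1 : Equiv.Perm (Fin n))) k ≤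
      (Subgroup.closure {g | ∃ i : Fin (n - 1), (i : ℕ) < k ∧
        g = Equiv.swap (lo i) (hi i)}).comap (MonoidHom.fst _ _) := by
    rw [initial, Subgroup.closure_le]
    rintro _ ⟨i, hi, rfl⟩
    rw [SetLike.mem_coe, Subgroup.mem_comap, MonoidHom.coe_fst, simple]
    split_ifs with h3
    · exact Subgroup.subset_closure ⟨⟨i, h3⟩, hi, rfl⟩
    · exact one_mem _
  exact h2 h1

end Coxeter

end ArrowTL

namespace ArrowTL

open ArrowTangle

namespace Presented

open scoped ATL

variable {n : ℕ}

/-! ### The invertible elements of the presented algebra -/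

theorem mk_rel {x y : FreeAlgebra R0a (Gen n)} (h : Rel n x y) :
    RingQuot.mkAlgHom R0a (Rel n) x = RingQuot.mkAlgHom R0a (Rel n) y :=
  RingQuot.mkAlgHom_rel R0a h

/-- The unit `t_j`. -/
noncomputable def tUnit (j : Fin n) : (Presented n)ˣ where
  val := gen (.t j)
  inv := gen (.tInv j)
  val_inv := by
    have := mk_rel (Rel.t_tInv j)
    rwa [map_mul, map_one] at this
  inv_val := by
    have := mk_rel (Rel.tInv_t j)
    rwa [map_mul, map_one] at this

/-- The unit `w_i`. -/
noncomputable def wUnit (i : Fin (n - 1)) : (Presented n)ˣ where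
  val := gen (.w i)
  inv := gen (.w i)
  val_inv := by
    have := mk_rel (Rel.w_w i)
    rwa [map_mul, map_one] at this
  inv_val := by
    have := mk_rel (Rel.w_w i)
    rwa [map_mul, map_one] at this

theorem tUnit_comm (i j : Fin n) : Commute (tUnit i) (tUnit j) := by
  have key : ∀ i j : Fin n, i < j → Commute (tUnit i) (tUnit j) := by
    intro i j h
    have := mk_rel (Rel.t_t i j h)
    rw [map_mul, map_mul] at this
    exact Units.ext this
  rcases lt_trichotomy i j with h | rfl | h
  · exact key i j h
  · exact Commute.refl _
  · exact (key j i h).symm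

theorem exists_permHom : ∃ W : Equiv.Perm (Fin n) →* (Presented n)ˣ,
    ∀ i, W (Equiv.swap (lo i) (hi i)) = wUnit i := by
  refine Coxeter.exists_hom (fun i => ?_) (fun i j h => ?_) fun i j h => ?_
  · have := mk_rel (Rel.w_w i)
    rw [map_mul, map_one] at this
    exact Units.ext this
  · have := mk_rel (Rel.w_w_far i j h)
    rw [map_mul, map_mul] at this
    exact Units.ext this
  · have := mk_rel (Rel.w_w_w i j h)
    rw [map_mul, map_mul, map_mul, map_mul] at this
    exact Units.ext this

/-- The homomorphism from the symmetric group that sends the adjacent transpositions to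
the `w_i`. -/
noncomputable def permHom : Equiv.Perm (Fin n) →* (Presented n)ˣ := Classical.choose exists_permHom

theorem permHom_swap (i : Fin (n - 1)) : permHom (Equiv.swap (lo i) (hi i)) = wUnit i :=
  Classical.choose_spec exists_permHom i

theorem perm_induction {p : Equiv.Perm (Fin n) → Prop} (h1 : p 1)
    (hs : ∀ i, p (Equiv.swap (lo i) (hi i))) (hm : ∀ e e', p e → p e' → p (e * e'))
    (e : Equiv.Perm (Fin n)) : p e := by
  have he : e ∈ Subgroup.closure (Set.range fun i : Fin (n - 1) => Equiv.swap (lo i) (hi i)) := by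
    rw [Coxeter.closure_swap]
    trivial
  induction he using Subgroup.closure_induction_left with
  | one => exact h1
  | mul_left x hx y hy ih =>
    obtain ⟨i, rfl⟩ := hx
    exact hm _ _ (hs i) ih
  | inv_mul_cancel x hx y hy ih =>
    obtain ⟨i, rfl⟩ := hx
    rw [Equiv.swap_inv]
    exact hm _ _ (hs i) ih

theorem permHom_mul_tUnit (e : Equiv.Perm (Fin n)) :
    ∀ j, permHom e * tUnit j = tUnit (e j) * permHom e := by
  induction e using perm_induction with
  | h1 => simp
  | hs i =>
    intro j
    rw [permHom_swap]
    by_cases h1 : j = lo i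
    · subst h1
      have := mk_rel (Rel.w_t_lo i)
      rw [map_mul, map_mul] at this
      rw [Equiv.swap_apply_left]
      exact Units.ext this
    by_cases h2 : j = hi i
    · subst h2
      have := mk_rel (Rel.w_t_hi i)
      rw [map_mul, map_mul] at this
      rw [Equiv.swap_apply_right]
      exact Units.ext this
    have := mk_rel (Rel.w_t i j h1 h2)
    rw [map_mul, map_mul] at this
    rw [Equiv.swap_apply_of_ne_of_ne h1 h2]
    exact Units.ext this
  | hm e e' h h' =>
    intro j
    rw [map_mul, mul_assoc, h', ← mul_assoc, h, mul_assoc, Equiv.Perm.mul_apply]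

theorem pairwise_commute_zpowersHom : Pairwise fun i j : Fin n => ∀ a b : Multiplicative ℤ,
    Commute (zpowersHom (Presented n)ˣ (tUnit i) a) (zpowersHom (Presented n)ˣ (tUnit j) b) := by
  intro i j _ a b
  simp only [zpowersHom_apply]
  exact (tUnit_comm i j).zpow_zpow _ _

/-- The homomorphism that sends `c` to the product of the `t_j ^ c_j`. -/
noncomputable def torusHom : (Fin n → Multiplicative ℤ) →* (Presented n)ˣ :=
  MonoidHom.noncommPiCoprod (fun j => zpowersHom _ (tUnit j)) pairwise_commute_zpowersHom

/-- The product of the `t_j ^ c_j`. -/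
noncomputable def torus (c : Fin n → ℤ) : (Presented n)ˣ :=
  torusHom fun j => Multiplicative.ofAdd (c j)

theorem torus_add (c c' : Fin n → ℤ) : torus (c + c') = torus c * torus c' := by
  rw [torus, torus, torus, ← map_mul]
  rfl

theorem torus_zero : torus (0 : Fin n → ℤ) = 1 := map_one torusHom

theorem torus_single (j : Fin n) (m : ℤ) : torus (Pi.single j m) = tUnit j ^ m := by
  rw [torus]
  have : (fun i => Multiplicative.ofAdd ((Pi.single j m : Fin n → ℤ) i)) =
      Pi.mulSingle j (Multiplicative.ofAdd m) := by
    ext i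
    by_cases h : i = j
    · subst h; simp
    · simp [h]
  rw [this, torusHom, MonoidHom.noncommPiCoprod_mulSingle, zpowersHom_apply, toAdd_ofAdd]

theorem torus_induction {p : (Fin n → ℤ) → Prop} (c : Fin n → ℤ) (h0 : p 0)
    (hs : ∀ j, p (Pi.single j (c j))) (ha : ∀ c c', p c → p c' → p (c + c')) : p c := by
  rw [← Finset.univ_sum_single c]
  exact Finset.sum_induction _ p ha h0 fun j _ => hs j

theorem permHom_mul_torus (e : Equiv.Perm (Fin n)) (c : Fin n → ℤ) :
    permHom e⁻¹ * torus c = torus (c ∘ e) * permHom e⁻¹ := by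
  refine torus_induction (p := fun c => permHom e⁻¹ * torus c = torus (c ∘ e) * permHom e⁻¹) c
    ?_ (fun j => ?_) fun c c' h h' => ?_
  · rw [torus_zero, mul_one, Pi.zero_comp, torus_zero, one_mul]
  · have h1 : (Pi.single j (c j) : Fin n → ℤ) ∘ e = Pi.single (e⁻¹ j) (c j) := by
      have := ATL.single_comp_perm e (e⁻¹ j) (c j)
      rwa [show e (e⁻¹ j) = j from e.apply_symm_apply j] at this
    rw [h1, torus_single, torus_single]
    have h2 : SemiconjBy (permHom e⁻¹) (tUnit j) (tUnit (e⁻¹ j)) := permHom_mul_tUnit e⁻¹ j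
    exact (h2.zpow_right (c j)).eq
  · have h1 : (c + c') ∘ e = c ∘ e + c' ∘ e := rfl
    rw [h1, torus_add, torus_add, ← mul_assoc, h, mul_assoc, h', mul_assoc]

/-- The element of the presented algebra that corresponds to the tangle `strands e c`. -/
noncomputable def braid (e : Equiv.Perm (Fin n)) (c : Fin n → ℤ) : Presented n :=
  ((torus c * permHom e⁻¹ : (Presented n)ˣ) : Presented n)

/-- The inverse in the definition of `braid` makes this the same law as `strands_comp_strands`. -/
theorem braid_mul (e e' : Equiv.Perm (Fin n)) (c c' : Fin n → ℤ) :
    braid e c * braid e' c' = braid (e' * e) (c + c' ∘ e) := by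
  rw [braid, braid, braid, ← Units.val_mul, mul_assoc, ← mul_assoc (permHom _), permHom_mul_torus,
    torus_add, mul_inv_rev, map_mul]
  simp only [mul_assoc]

theorem braid_one : braid 1 (0 : Fin n → ℤ) = 1 := by
  simp [braid, torus_zero]

theorem braid_mul_inv (e : Equiv.Perm (Fin n)) (c : Fin n → ℤ) :
    braid e c * braid e⁻¹ (-(c ∘ ⇑(e⁻¹))) = 1 := by
  rw [braid_mul, inv_mul_cancel, ← braid_one]
  congr 1
  ext j
  simp

theorem braid_inv_mul (e : Equiv.Perm (Fin n)) (c : Fin n → ℤ) :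
    braid e⁻¹ (-(c ∘ ⇑(e⁻¹))) * braid e c = 1 := by
  rw [braid_mul, mul_inv_cancel, ← braid_one]
  congr 1
  ext j
  simp

theorem isUnit_braid (e : Equiv.Perm (Fin n)) (c : Fin n → ℤ) : IsUnit (braid e c) := Units.isUnit _

theorem braid_torus_mul (c c' : Fin n → ℤ) : braid 1 c * braid 1 c' = braid 1 (c + c') :=
  braid_mul 1 1 c c'

theorem braid_eq (e : Equiv.Perm (Fin n)) (c : Fin n → ℤ) :
    braid e c = braid 1 c * braid e 0 := by
  rw [braid_mul, mul_one]
  congr 1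
  ext
  simp

theorem braid_torus_single (j : Fin n) : braid 1 (Pi.single j 1) = gen (.t j) := by
  simp only [braid, torus_single, inv_one, map_one, mul_one, zpow_one]
  rfl

theorem braid_torus_single_neg (j : Fin n) : braid 1 (Pi.single j (-1)) = gen (.tInv j) := by
  simp only [braid, torus_single, inv_one, map_one, mul_one, zpow_neg_one]
  rfl

theorem braid_swap (i : Fin (n - 1)) : braid (Equiv.swap (lo i) (hi i)) 0 = gen (.w i) := by
  simp only [braid, torus_zero, one_mul, Equiv.swap_inv, permHom_swap]
  rfl

theorem mk_tPow (j : Fin n) (m : ℤ) :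
    RingQuot.mkAlgHom R0a (Rel n) (Gen.xtPow j m) = braid 1 (Pi.single j m) := by
  have h : braid 1 (Pi.single j m) = ((tUnit j ^ m : (Presented n)ˣ) : Presented n) := by
    simp only [braid, torus_single, inv_one, map_one, mul_one]
  rw [h]
  cases m with
  | ofNat k =>
    rw [Gen.xtPow, map_pow, Int.ofNat_eq_natCast, zpow_natCast, Units.val_pow_eq_pow_val]
    rfl
  | negSucc k =>
    rw [Gen.xtPow, map_pow, zpow_negSucc, ← inv_pow, Units.val_pow_eq_pow_val]
    rfl

theorem presentedHom_gen (g : Gen n) : ATL.presentedHom n (gen g) = ATL.of (ATL.genTangle g) := by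
  rw [gen, ATL.presentedHom_mk, ATL.freeHom, FreeAlgebra.lift_ι_apply]

theorem presentedHom_braid (e : Equiv.Perm (Fin n)) (c : Fin n → ℤ) :
    ATL.presentedHom n (braid e c) = ATL.str e c := by
  have h1 : ∀ c : Fin n → ℤ, ATL.presentedHom n (braid 1 c) = ATL.str 1 c := by
    intro c
    refine torus_induction (p := fun c => ATL.presentedHom n (braid 1 c) = ATL.str 1 c) c ?_
      (fun j => ?_) fun c c' h h' => ?_
    · rw [braid_one, map_one, ATL.str_one]
    · rw [← mk_tPow, ATL.presentedHom_mk, ATL.freeHom_tPow]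
    · rw [← braid_torus_mul, map_mul, h, h', ATL.str_one_mul_str_one]
  have h2 : ATL.presentedHom n (braid e 0) = ATL.str e 0 := by
    induction e using perm_induction with
    | h1 => exact h1 0
    | hs i =>
      rw [braid_swap, presentedHom_gen, ATL.genTangle, wTangle, ATL.str]
    | hm e e' h h' =>
      have h3 : ∀ e : Equiv.Perm (Fin n), (0 : Fin n → ℤ) + (0 : Fin n → ℤ) ∘ e = 0 := fun e => by ext; simp
      have h4 := braid_mul e' e 0 0
      have h5 := ATL.str_mul_str e' e 0 0
      rw [h3] at h4 h5
      rw [← h4, map_mul, h, h', h5]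
  rw [braid_eq, map_mul, h1, h2, ATL.str_mul_str, mul_one]
  congr 1
  ext
  simp

end Presented

end ArrowTL

namespace ArrowTL

open ArrowTangle

namespace Presented

open scoped ATL

variable {n : ℕ}

theorem exists_perm {m : ℕ} {f g : Fin m → Fin n} (hf : Function.Injective f)
    (hg : Function.Injective g) : ∃ e : Equiv.Perm (Fin n), ∀ i, e (f i) = g i := by
  obtain ⟨e, he⟩ := (Equiv.Perm.isMultiplyPretransitive (Fin n) m).exists_smul_eq
    (⟨f, hf⟩ : Fin m ↪ Fin n) ⟨g, hg⟩
  exact ⟨e, fun i => congrArg (fun h : Fin m ↪ Fin n => h i) he⟩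

theorem exists_perm_pair {a b c d : Fin n} (hab : a ≠ b) (hcd : c ≠ d) :
    ∃ e : Equiv.Perm (Fin n), e a = c ∧ e b = d := by
  obtain ⟨e, he⟩ := exists_perm (f := ![a, b]) (g := ![c, d])
    (by rw [Function.Injective]; simp [Fin.forall_fin_two, hab, hab.symm])
    (by rw [Function.Injective]; simp [Fin.forall_fin_two, hcd, hcd.symm])
  exact ⟨e, he 0, he 1⟩

/-! ### Caps in the presented algebra -/

theorem braid_perm_mul (e e' : Equiv.Perm (Fin n)) : braid e 0 * braid e' 0 = braid (e' * e) 0 := by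
  rw [braid_mul]
  congr 1

theorem braid_perm_mul_inv (e : Equiv.Perm (Fin n)) : braid e 0 * braid e⁻¹ 0 = 1 := by
  rw [braid_perm_mul, inv_mul_cancel, braid_one]

theorem braid_perm_inv_mul (e : Equiv.Perm (Fin n)) : braid e⁻¹ 0 * braid e 0 = 1 := by
  rw [braid_perm_mul, mul_inv_cancel, braid_one]

theorem gen_F_mul_braid_swap (i j : Fin (n - 1)) (h : Far i j) :
    gen (.F i) * braid (Equiv.swap (lo j) (hi j)) 0 =
      braid (Equiv.swap (lo j) (hi j)) 0 * gen (.F i) := by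
  have := mk_rel (Rel.F_w_far i j h)
  rw [map_mul, map_mul] at this
  rw [braid_swap]
  exact this

/-- A permutation that fixes the last two points commutes with the last `F_i`. -/
theorem gen_F_comm_of_fix (i : Fin (n - 1)) (hi' : (i : ℕ) + 2 = n) (e : Equiv.Perm (Fin n))
    (h1 : e (lo i) = lo i) (h2 : e (hi i) = hi i) :
    braid e 0 * gen (.F i) = gen (.F i) * braid e 0 := by
  -- The last two positions are i and i + 1, so all points beyond i - 1 are fixed, and the
  -- transpositions below i - 1 are far from i. For i = 0 the subtraction truncates to 0, and the
  -- only point beyond it is again fixed.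
  have he := Coxeter.mem_closure_swap (i - 1) e (fun v hv => by
    by_cases h3 : (v : ℕ) = i
    · have : v = lo i := Fin.ext h3
      rw [this, h1]
    · have : v = hi i := Fin.ext (by simp only [hi]; omega)
      rw [this, h2])
  clear h1 h2
  have key : ∀ j : Fin (n - 1), (j : ℕ) < i - 1 → ∀ y, braid y 0 * gen (.F i) =
      gen (.F i) * braid y 0 → braid (Equiv.swap (lo j) (hi j) * y) 0 * gen (.F i) =
        gen (.F i) * braid (Equiv.swap (lo j) (hi j) * y) 0 := by
    intro j hj y hy
    rw [← braid_perm_mul, mul_assoc, ← gen_F_mul_braid_swap i j (Or.inr (by omega)), ← mul_assoc,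
      hy, mul_assoc]
  induction he using Subgroup.closure_induction_left with
  | one => rw [braid_one, mul_one, one_mul]
  | mul_left x hx y hy ih =>
    obtain ⟨j, hj, rfl⟩ := hx
    exact key j hj y ih
  | inv_mul_cancel x hx y hy ih =>
    obtain ⟨j, hj, rfl⟩ := hx
    rw [Equiv.swap_inv]
    exact key j hj y ih

/-- A permutation that maps the points of `F_j` to those of `F_i` and conjugates one into the
other. -/
structure Intertwines (e : Equiv.Perm (Fin n)) (i j : Fin (n - 1)) : Prop where
  apply_lo : e (lo j) = lo i
  apply_hi : e (hi j) = hi i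
  braid_mul : braid e 0 * gen (.F i) = gen (.F j) * braid e 0

theorem Intertwines.mul {e e' : Equiv.Perm (Fin n)} {i j k : Fin (n - 1)} (h : Intertwines e i j)
    (h' : Intertwines e' j k) : Intertwines (e * e') i k where
  apply_lo := by rw [Equiv.Perm.mul_apply, h'.apply_lo, h.apply_lo]
  apply_hi := by rw [Equiv.Perm.mul_apply, h'.apply_hi, h.apply_hi]
  braid_mul := by
    rw [← braid_perm_mul, mul_assoc, h.braid_mul, ← mul_assoc, h'.braid_mul, mul_assoc]

theorem Intertwines.inv {e : Equiv.Perm (Fin n)} {i j : Fin (n - 1)} (h : Intertwines e i j) :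
    Intertwines e⁻¹ j i where
  apply_lo := by rw [Equiv.Perm.inv_eq_iff_eq, h.apply_lo]
  apply_hi := by rw [Equiv.Perm.inv_eq_iff_eq, h.apply_hi]
  braid_mul := by
    have h1 := congrArg (fun x => braid e⁻¹ 0 * x * braid e⁻¹ 0) h.braid_mul
    simp only [← mul_assoc, braid_perm_inv_mul, one_mul] at h1
    rw [mul_assoc _ (braid e 0), braid_perm_mul_inv, mul_one] at h1
    exact h1.symm

theorem intertwines_near (i j : Fin (n - 1)) (h : Near i j) :
    Intertwines (Equiv.swap (lo j) (hi j) * Equiv.swap (lo i) (hi i)) i j := by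
  have key := ATL.near_apply h
  refine ⟨key.1, key.2, ?_⟩
  have := mk_rel (Rel.w_w_F i j h)
  simp only [map_mul] at this
  rw [← braid_perm_mul, braid_swap, braid_swap, ← mul_assoc]
  exact this

/-- The relation w w F = F w w moves an F to its neighbour; a chain of such moves reaches the last
position. -/
theorem exists_intertwines_last (l : Fin (n - 1)) (hl : (l : ℕ) + 2 = n) (j : Fin (n - 1)) :
    ∃ e, Intertwines e l j := by
  obtain ⟨m, hm⟩ : ∃ m, (j : ℕ) + m = l := ⟨l - j, by omega⟩
  induction m generalizing j with
  | zero =>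
    obtain rfl : j = l := Fin.ext hm
    exact ⟨1, rfl, rfl, by rw [braid_one, one_mul, mul_one]⟩
  | succ m ih =>
    obtain ⟨e, he⟩ := ih ⟨j + 1, by omega⟩ (by simp only; omega)
    exact ⟨_, he.mul (intertwines_near ⟨j + 1, by omega⟩ j (Or.inr rfl))⟩

/-- Conjugating both ends to the last position leaves a permutation that fixes the last two points,
and for these the commutation is known. -/
theorem intertwines_of_apply (e : Equiv.Perm (Fin n)) (i j : Fin (n - 1)) (h1 : e (lo j) = lo i)
    (h2 : e (hi j) = hi i) : Intertwines e i j := by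
  have hlt := i.isLt
  obtain ⟨l, hl⟩ : ∃ l : Fin (n - 1), (l : ℕ) + 2 = n := ⟨⟨n - 2, by omega⟩, by simp only; omega⟩
  obtain ⟨f, hf⟩ := exists_intertwines_last l hl i
  obtain ⟨g, hg⟩ := exists_intertwines_last l hl j
  have h3 : (f * e * g⁻¹) (lo l) = lo l := by
    rw [Equiv.Perm.mul_apply, hg.inv.apply_lo, Equiv.Perm.mul_apply, h1, hf.apply_lo]
  have h4 : (f * e * g⁻¹) (hi l) = hi l := by
    rw [Equiv.Perm.mul_apply, hg.inv.apply_hi, Equiv.Perm.mul_apply, h2, hf.apply_hi]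
  have h5 : Intertwines (f * e * g⁻¹) l l := ⟨h3, h4, gen_F_comm_of_fix l hl _ h3 h4⟩
  have h6 := (hf.inv.mul h5).mul hg
  simpa [mul_assoc] using h6

/-- Two choices of `i` and `e` differ by a permutation that maps the one pair of neighbours to the
other, and such a permutation intertwines the two F's. -/
theorem exists_bridge (a b : Fin n) : ∃ x : Presented n, ∀ (i : Fin (n - 1))
    (e : Equiv.Perm (Fin n)), e a = lo i → e b = hi i →
      braid e 0 * gen (.F i) = x * braid e 0 := by
  by_cases h : ∃ (i : Fin (n - 1)) (e : Equiv.Perm (Fin n)), e a = lo i ∧ e b = hi i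
  · obtain ⟨i, e, ha, hb⟩ := h
    refine ⟨braid e 0 * gen (.F i) * braid e⁻¹ 0, fun j f ha' hb' => ?_⟩
    have h1 := intertwines_of_apply (f * e⁻¹) j i (by
      rw [← ha, Equiv.Perm.mul_apply, ← ha']
      exact congrArg f (e.symm_apply_apply a)) (by
      rw [← hb, Equiv.Perm.mul_apply, ← hb']
      exact congrArg f (e.symm_apply_apply b))
    have h2 := h1.braid_mul
    rw [← braid_perm_mul] at h2
    rw [mul_assoc, mul_assoc, ← h2, ← mul_assoc, ← mul_assoc, braid_perm_mul_inv, one_mul]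
  · push Not at h
    exact ⟨0, fun i e ha hb => absurd hb (h i e ha)⟩

/-- The conjugate of the `F_i` at the points `a` and `b`. -/
noncomputable def bridgeZero (a b : Fin n) : Presented n := Classical.choose (exists_bridge a b)

theorem braid_mul_gen_F {a b : Fin n} {i : Fin (n - 1)} {e : Equiv.Perm (Fin n)} (ha : e a = lo i)
    (hb : e b = hi i) : braid e 0 * gen (.F i) = bridgeZero a b * braid e 0 :=
  Classical.choose_spec (exists_bridge a b) i e ha hb

theorem gen_F_eq (i : Fin (n - 1)) : gen (.F i) = bridgeZero (lo i) (hi i) := by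
  have := braid_mul_gen_F (a := lo i) (b := hi i) (i := i) (e := 1) rfl rfl
  rwa [braid_one, one_mul, mul_one] at this

theorem exists_index {a b : Fin n} (hab : a ≠ b) :
    ∃ (i : Fin (n - 1)) (e : Equiv.Perm (Fin n)), e a = lo i ∧ e b = hi i := by
  have h : (a : ℕ) ≠ b := fun h => hab (Fin.ext h)
  have h1 := a.isLt
  have h2 := b.isLt
  obtain ⟨e, he⟩ := exists_perm_pair hab (lo_ne_hi (⟨0, by omega⟩ : Fin (n - 1)))
  exact ⟨_, e, he⟩

theorem braid_mul_bridgeZero {a b : Fin n} (hab : a ≠ b) (e : Equiv.Perm (Fin n)) :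
    braid e 0 * bridgeZero (e a) (e b) = bridgeZero a b * braid e 0 := by
  obtain ⟨i, f, hfa, hfb⟩ := exists_index (e.injective.ne hab)
  have h1 := braid_mul_gen_F hfa hfb
  have h2 := braid_mul_gen_F (a := a) (b := b) (e := f * e) hfa hfb
  rw [← braid_perm_mul, mul_assoc, h1, ← mul_assoc, ← mul_assoc] at h2
  have h3 := congrArg (fun x => x * braid f⁻¹ 0) h2
  simp only [mul_assoc, braid_perm_mul_inv, mul_one] at h3
  exact h3

/-- Statements about pairs of distinct points that are invariant under permutations hold if they
hold for neighbours. -/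
theorem bridgeZero_induction {p : Fin n → Fin n → Prop} (h : ∀ i : Fin (n - 1), p (lo i) (hi i))
    (hp : ∀ a b (e : Equiv.Perm (Fin n)), a ≠ b → p (e a) (e b) → p a b) {a b : Fin n}
    (hab : a ≠ b) : p a b := by
  obtain ⟨i, e, ha, hb⟩ := exists_index hab
  refine hp a b e hab ?_
  rw [ha, hb]
  exact h i

/-- The vectors whose torus elements fix `x` by right multiplication. -/
noncomputable def rightStab (x : Presented n) : AddSubgroup (Fin n → ℤ) where
  carrier := {c | x * braid 1 c = x}
  zero_mem' := by simp [braid_one]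
  add_mem' {c c'} h h' := by
    change x * braid 1 (c + c') = x
    rw [← braid_torus_mul, ← mul_assoc, h, h']
  neg_mem' {c} h := by
    change x * braid 1 (-c) = x
    conv_lhs => rw [← show x * braid 1 c = x from h, mul_assoc, braid_torus_mul, add_neg_cancel,
      braid_one, mul_one]

/-- The vectors whose torus elements fix `x` by left multiplication. -/
noncomputable def leftStab (x : Presented n) : AddSubgroup (Fin n → ℤ) where
  carrier := {c | braid 1 c * x = x}
  zero_mem' := by simp [braid_one]
  add_mem' {c c'} h h' := by
    change braid 1 (c + c') * x = x
    rw [← braid_torus_mul, mul_assoc, h', h]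
  neg_mem' {c} h := by
    change braid 1 (-c) * x = x
    conv_lhs => rw [← show braid 1 c * x = x from h, ← mul_assoc, braid_torus_mul, neg_add_cancel,
      braid_one, one_mul]

/-- The vectors whose torus elements commute with `x`. -/
noncomputable def commStab (x : Presented n) : AddSubgroup (Fin n → ℤ) where
  carrier := {c | Commute (braid 1 c) x}
  zero_mem' := by simp [braid_one]
  add_mem' {c c'} h h' := by
    change Commute (braid 1 (c + c')) x
    rw [← braid_torus_mul]
    exact Commute.mul_left h h'
  neg_mem' {c} h := by
    change Commute (braid 1 (-c)) x
    have h1 : Commute (braid 1 c) x := h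
    have h2 : braid 1 (-c) * braid 1 c = 1 := by
      rw [braid_torus_mul, neg_add_cancel, braid_one]
    have h3 : braid 1 c * braid 1 (-c) = 1 := by
      rw [braid_torus_mul, add_neg_cancel, braid_one]
    have h4 := congrArg (fun y => braid 1 (-c) * y * braid 1 (-c)) h1.eq
    simp only [← mul_assoc, h2, one_mul] at h4
    rw [mul_assoc _ (braid 1 c), h3, mul_one] at h4
    exact h4.symm

theorem single_add_single_eq_smul (a b : Fin n) (m : ℤ) :
    (Pi.single a m + Pi.single b m : Fin n → ℤ) = m • (Pi.single a 1 + Pi.single b 1) := by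
  rw [smul_add, ← Pi.single_smul, ← Pi.single_smul, smul_eq_mul, mul_one]

/-- The vectors absorbed on the right form a subgroup, so the case m = 1, which is the relation F
t_i = F t_{i+1}⁻¹, suffices. -/
theorem gen_F_mul_slide (i : Fin (n - 1)) (m : ℤ) :
    gen (.F i) * braid 1 (Pi.single (lo i) m + Pi.single (hi i) m) = gen (.F i) := by
  have h : (Pi.single (lo i) 1 + Pi.single (hi i) 1 : Fin n → ℤ) ∈ rightStab (gen (.F i)) := by
    change gen (.F i) * braid 1 _ = _
    have h1 := mk_rel (Rel.F_t_lo i)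
    rw [map_mul, map_mul] at h1
    change gen (.F i) * gen (.t (lo i)) = gen (.F i) * gen (.tInv (hi i)) at h1
    rw [← braid_torus_mul, ← mul_assoc, braid_torus_single, h1, ← braid_torus_single_neg, mul_assoc,
      braid_torus_mul, ← Pi.single_add, neg_add_cancel, Pi.single_zero, braid_one, mul_one]
  rw [single_add_single_eq_smul]
  exact (rightStab (gen (.F i))).zsmul_mem h m

theorem slide_mul_gen_F (i : Fin (n - 1)) (m : ℤ) :
    braid 1 (Pi.single (lo i) m + Pi.single (hi i) m) * gen (.F i) = gen (.F i) := by
  have h : (Pi.single (lo i) 1 + Pi.single (hi i) 1 : Fin n → ℤ) ∈ leftStab (gen (.F i)) := by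
    change braid 1 _ * gen (.F i) = _
    have h1 := mk_rel (Rel.tInv_F i)
    rw [map_mul, map_mul] at h1
    change gen (.tInv (lo i)) * gen (.F i) = gen (.t (hi i)) * gen (.F i) at h1
    rw [← braid_torus_mul, mul_assoc, braid_torus_single (hi i), ← h1, ← braid_torus_single_neg,
      ← mul_assoc, braid_torus_mul, ← Pi.single_add, add_neg_cancel, Pi.single_zero, braid_one,
      one_mul]
  rw [single_add_single_eq_smul]
  exact (leftStab (gen (.F i))).zsmul_mem h m

/-- Such a vector is a slide, which F absorbs on both sides, plus a vector vanishing at both points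
of F, whose t's commute with F. -/
theorem gen_F_comm_torus (i : Fin (n - 1)) (c : Fin n → ℤ) (h : c (lo i) = c (hi i)) :
    Commute (braid 1 c) (gen (.F i)) := by
  have h1 : (Pi.single (lo i) (c (lo i)) + Pi.single (hi i) (c (lo i)) : Fin n → ℤ) ∈
      commStab (gen (.F i)) := by
    change Commute _ _
    rw [Commute, SemiconjBy, slide_mul_gen_F, gen_F_mul_slide]
  obtain ⟨d, hd⟩ : ∃ d : Fin n → ℤ,
      d + (Pi.single (lo i) (c (lo i)) + Pi.single (hi i) (c (lo i))) = c :=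
    ⟨_, sub_add_cancel _ _⟩
  have hlo : d (lo i) = 0 := by
    have := congrFun hd (lo i)
    simpa [lo_ne_hi i] using this
  have hhi : d (hi i) = 0 := by
    have := congrFun hd (hi i)
    simpa [(lo_ne_hi i).symm, ← h] using this
  have h2 : d ∈ commStab (gen (.F i)) := by
    rw [← Finset.univ_sum_single d]
    refine sum_mem fun j _ => ?_
    by_cases ha : j = lo i
    · rw [ha, hlo, Pi.single_zero]
      exact zero_mem _
    by_cases hb : j = hi i
    · rw [hb, hhi, Pi.single_zero]
      exact zero_mem _
    · have h3 : (Pi.single j 1 : Fin n → ℤ) ∈ commStab (gen (.F i)) := by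
        change Commute _ _
        have h4 := mk_rel (Rel.F_t i j ha hb)
        rw [map_mul, map_mul] at h4
        rw [braid_torus_single]
        exact h4.symm
      have h5 := (commStab (gen (.F i))).zsmul_mem h3 (d j)
      rwa [← Pi.single_smul, smul_eq_mul, mul_one] at h5
  rw [← hd]
  exact add_mem h2 h1

end Presented

end ArrowTL

namespace ArrowTL

open ArrowTangle

namespace Presented

open scoped ATL

variable {n : ℕ}

/-! ### Conjugation by invertible elements -/

/-- Conjugation by `braid e c`. -/
noncomputable def conj (e : Equiv.Perm (Fin n)) (c : Fin n → ℤ) : Presented n →ₐ[R0a] Presented n where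
  toFun x := braid e c * x * braid e⁻¹ (-(c ∘ ⇑(e⁻¹)))
  map_one' := by rw [mul_one, braid_mul_inv]
  map_mul' x y := by
    have h := braid_inv_mul e c
    calc braid e c * (x * y) * braid e⁻¹ (-(c ∘ ⇑(e⁻¹)))
        = braid e c * x * 1 * y * braid e⁻¹ (-(c ∘ ⇑(e⁻¹))) := by simp only [mul_assoc, one_mul]
      _ = _ := by rw [← h]; simp only [mul_assoc]
  map_zero' := by rw [mul_zero, zero_mul]
  map_add' x y := by rw [mul_add, add_mul]
  commutes' r := by
    rw [← Algebra.commutes, mul_assoc, braid_mul_inv, mul_one]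

theorem conj_apply (e : Equiv.Perm (Fin n)) (c : Fin n → ℤ) (x : Presented n) :
    conj e c x = braid e c * x * braid e⁻¹ (-(c ∘ ⇑(e⁻¹))) := rfl

theorem conj_eq_of_mul_eq {e : Equiv.Perm (Fin n)} {c : Fin n → ℤ} {x y : Presented n}
    (h : braid e c * x = y * braid e c) : conj e c x = y := by
  rw [conj_apply, h, mul_assoc, braid_mul_inv, mul_one]

theorem conj_mul_braid (e : Equiv.Perm (Fin n)) (c : Fin n → ℤ) (x : Presented n) :
    braid e c * x = conj e c x * braid e c := by
  rw [conj_apply, mul_assoc, braid_inv_mul, mul_one]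

theorem conj_torus (e : Equiv.Perm (Fin n)) (c d : Fin n → ℤ) :
    conj e c (braid 1 d) = braid 1 (d ∘ e) := by
  apply conj_eq_of_mul_eq
  rw [braid_mul, braid_mul, one_mul, mul_one]
  congr 1
  ext j
  simp [add_comm]

theorem conj_swap (e : Equiv.Perm (Fin n)) (a b : Fin n) :
    conj e 0 (braid (Equiv.swap (e a) (e b)) 0) = braid (Equiv.swap a b) 0 := by
  apply conj_eq_of_mul_eq
  rw [braid_perm_mul, braid_perm_mul, Equiv.mul_swap_eq_swap_mul]

theorem conj_bridgeZero {a b : Fin n} (hab : a ≠ b) (e : Equiv.Perm (Fin n)) :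
    conj e 0 (bridgeZero (e a) (e b)) = bridgeZero a b :=
  conj_eq_of_mul_eq (braid_mul_bridgeZero hab e)

theorem conj_one_braid (u d : Fin n → ℤ) (e : Equiv.Perm (Fin n)) :
    conj 1 u (braid e d) = braid e (u + d - u ∘ e) := by
  rw [conj_apply, braid_mul, braid_mul, inv_one, mul_one, one_mul]
  congr 1

/-! ### Relations between caps -/

theorem single_comp (e : Equiv.Perm (Fin n)) (a : Fin n) (m : ℤ) :
    (Pi.single (e a) m : Fin n → ℤ) ∘ e = Pi.single a m := ATL.single_comp_perm e a m

theorem bridgeZero_comm_torus {a b : Fin n} (hab : a ≠ b) :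
    ∀ c : Fin n → ℤ, c a = c b → Commute (braid 1 c) (bridgeZero a b) := by
  refine bridgeZero_induction (p := fun a b => ∀ c : Fin n → ℤ, c a = c b →
    Commute (braid 1 c) (bridgeZero a b)) (fun i c h => ?_) (fun a b e hab h c hc => ?_) hab
  · rw [← gen_F_eq]
    exact gen_F_comm_torus i c h
  · have h1 := (h (c ∘ e.symm) (by simpa using hc)).map (conj e 0)
    rw [conj_bridgeZero hab, conj_torus] at h1
    have h2 : (c ∘ e.symm) ∘ e = c := by
      ext
      simp
    rwa [h2] at h1

theorem bridgeZero_mul_slide {a b : Fin n} (hab : a ≠ b) (m : ℤ) :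
    bridgeZero a b * braid 1 (Pi.single a m + Pi.single b m : Fin n → ℤ) = bridgeZero a b := by
  obtain ⟨i, e, ha, hb⟩ := exists_index hab
  have h := gen_F_mul_slide i m
  rw [gen_F_eq, ← ha, ← hb] at h
  have h1 := congrArg (conj e 0) h
  rw [map_mul, conj_bridgeZero hab, conj_torus] at h1
  have h2 : (Pi.single (e a) m + Pi.single (e b) m : Fin n → ℤ) ∘ e =
      Pi.single a m + Pi.single b m := by
    rw [Pi.add_comp, single_comp, single_comp]
  rwa [h2] at h1

theorem bridgeZero_mul_swap {a b : Fin n} (hab : a ≠ b) :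
    bridgeZero a b * braid (Equiv.swap a b) 0 = bridgeZero a b * braid 1 (Pi.single a 1) := by
  refine bridgeZero_induction (p := fun a b => bridgeZero a b * braid (Equiv.swap a b) 0 =
    bridgeZero a b * braid 1 (Pi.single a 1)) (fun i => ?_) (fun a b e hab h => ?_) hab
  · rw [← gen_F_eq, braid_swap, braid_torus_single]
    have := mk_rel (Rel.F_w i)
    rwa [map_mul, map_mul] at this
  · have h1 := congrArg (conj e 0) h
    rwa [map_mul, map_mul, conj_bridgeZero hab, conj_torus, conj_swap, single_comp] at h1

theorem swap_mul_bridgeZero {a b : Fin n} (hab : a ≠ b) :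
    braid (Equiv.swap a b) 0 * bridgeZero a b = braid 1 (Pi.single a (-1)) * bridgeZero a b := by
  refine bridgeZero_induction (p := fun a b => braid (Equiv.swap a b) 0 * bridgeZero a b =
    braid 1 (Pi.single a (-1)) * bridgeZero a b) (fun i => ?_) (fun a b e hab h => ?_) hab
  · rw [← gen_F_eq, braid_swap, braid_torus_single_neg]
    have := mk_rel (Rel.w_F i)
    rwa [map_mul, map_mul] at this
  · have h1 := congrArg (conj e 0) h
    rwa [map_mul, map_mul, conj_bridgeZero hab, conj_torus, conj_swap, single_comp] at h1

theorem bridgeZero_mul_torus_mul {a b : Fin n} (hab : a ≠ b) :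
    ∀ m : ℤ, bridgeZero a b * braid 1 (Pi.single a m) * bridgeZero a b =
      (MvPolynomial.X m.natAbs : R0a) • bridgeZero a b := by
  refine bridgeZero_induction (p := fun a b => ∀ m : ℤ, bridgeZero a b * braid 1 (Pi.single a m) *
    bridgeZero a b = (MvPolynomial.X m.natAbs : R0a) • bridgeZero a b) (fun i m => ?_)
    (fun a b e hab h m => ?_) hab
  · rw [← gen_F_eq, ← mk_tPow]
    have := mk_rel (Rel.F_t_F i m)
    rwa [map_mul, map_mul, map_smul] at this
  · have h1 := congrArg (conj e 0) (h m)
    rwa [map_mul, map_mul, map_smul, conj_bridgeZero hab, conj_torus, single_comp] at h1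

/-- Four distinct points can be moved to the first four positions, where the relation for distant
F's applies. -/
theorem bridgeZero_comm {a b c d : Fin n} (hab : a ≠ b) (hcd : c ≠ d) (hac : a ≠ c)
    (had : a ≠ d) (hbc : b ≠ c) (hbd : b ≠ d) : Commute (bridgeZero a b) (bridgeZero c d) := by
  have hinj : Function.Injective ![a, b, c, d] := by
    intro x y h
    fin_cases x <;> fin_cases y <;> simp at h <;> first | rfl | (exfalso; tauto)
  have hn : 4 ≤ n := by
    have := Fintype.card_le_of_injective _ hinj
    simpa using this
  obtain ⟨e, he⟩ := exists_perm (g := ![lo (⟨0, by omega⟩ : Fin (n - 1)),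
    hi (⟨0, by omega⟩ : Fin (n - 1)), lo (⟨2, by omega⟩ : Fin (n - 1)),
    hi (⟨2, by omega⟩ : Fin (n - 1))]) hinj (by
      intro x y h
      fin_cases x <;> fin_cases y <;> simp [lo, hi] at h <;> rfl)
  have h0 : e a = _ := he 0
  have h1 : e b = _ := he 1
  have h2 : e c = _ := he 2
  have h3 : e d = _ := he 3
  have hr := mk_rel (Rel.F_F_far (⟨0, by omega⟩ : Fin (n - 1)) ⟨2, by omega⟩ (Or.inl le_rfl))
  rw [map_mul, map_mul] at hr
  have hr' : Commute (gen (.F (⟨0, by omega⟩ : Fin (n - 1)))) (gen (.F ⟨2, by omega⟩)) := hr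
  rw [gen_F_eq, gen_F_eq] at hr'
  have hr2 : Commute (bridgeZero (e a) (e b)) (bridgeZero (e c) (e d)) := by
    rw [h0, h1, h2, h3]
    exact hr'
  have h4 := hr2.map (conj e 0)
  rwa [conj_bridgeZero hab, conj_bridgeZero hcd] at h4

theorem bridgeZero_mul_swap_mul {a b c : Fin n} (hab : a ≠ b) (hac : a ≠ c) (hbc : b ≠ c) :
    bridgeZero a b * braid (Equiv.swap a c) 0 * bridgeZero a b = bridgeZero a b := by
  have hinj : Function.Injective ![a, b, c] := by
    intro x y h
    fin_cases x <;> fin_cases y <;> simp at h <;> first | rfl | (exfalso; tauto)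
  have hn : 3 ≤ n := by
    have := Fintype.card_le_of_injective _ hinj
    simpa using this
  obtain ⟨e, he⟩ := exists_perm (g := ![lo (⟨1, by omega⟩ : Fin (n - 1)),
    hi (⟨1, by omega⟩ : Fin (n - 1)), lo (⟨0, by omega⟩ : Fin (n - 1))]) hinj (by
      intro x y h
      fin_cases x <;> fin_cases y <;> simp [lo, hi] at h <;> rfl)
  have h0 : e a = lo (⟨1, by omega⟩ : Fin (n - 1)) := he 0
  have h1 : e b = hi (⟨1, by omega⟩ : Fin (n - 1)) := he 1
  have h2 : e c = lo (⟨0, by omega⟩ : Fin (n - 1)) := he 2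
  -- The middle of the three positions belongs both to the F and to the crossing.
  have h0' : e a = hi (⟨0, by omega⟩ : Fin (n - 1)) := h0
  have hr := mk_rel (Rel.F_w_F (⟨1, by omega⟩ : Fin (n - 1)) ⟨0, by omega⟩ (Or.inr rfl))
  rw [map_mul, map_mul] at hr
  have hr' : gen (.F (⟨1, by omega⟩ : Fin (n - 1))) * gen (.w ⟨0, by omega⟩) *
    gen (.F (⟨1, by omega⟩ : Fin (n - 1))) = gen (.F (⟨1, by omega⟩ : Fin (n - 1))) := hr
  rw [gen_F_eq, ← braid_swap, ← h0, ← h1, ← h0', ← h2, Equiv.swap_comm] at hr'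
  have h4 := congrArg (conj e 0) hr'
  rwa [map_mul, map_mul, conj_bridgeZero hab, conj_swap] at h4

/-- The crossing of `a` and `c` conjugates one cap into the other, which turns F w F = F into a
formula for the product of the two caps. -/
theorem bridgeZero_mul_bridgeZero {a b c : Fin n} (hab : a ≠ b) (hac : a ≠ c) (hbc : b ≠ c) :
    bridgeZero a b * bridgeZero c b = bridgeZero a b * braid (Equiv.swap a c) 0 ∧
      bridgeZero a b * bridgeZero c b = braid (Equiv.swap a c) 0 * bridgeZero c b := by
  have hb : Equiv.swap a c b = b := Equiv.swap_apply_of_ne_of_ne hab.symm hbc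
  have h1 := braid_mul_bridgeZero hbc.symm (Equiv.swap a c)
  rw [hb, Equiv.swap_apply_right] at h1
  have h2 := braid_mul_bridgeZero hab (Equiv.swap a c)
  rw [hb, Equiv.swap_apply_left] at h2
  have h3 := bridgeZero_mul_swap_mul hab hac hbc
  have h4 : bridgeZero a b * bridgeZero c b = bridgeZero a b * braid (Equiv.swap a c) 0 := by
    conv_rhs => rw [← h3]
    rw [mul_assoc (bridgeZero a b), h1, mul_assoc, mul_assoc, braid_perm_mul, Equiv.swap_mul_self,
      braid_one, mul_one]
  exact ⟨h4, h4.trans h2.symm⟩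

/-- The element of the presented algebra that corresponds to the tangle `cap a b _ k`. -/
noncomputable def bridge (a b : Fin n) (k : ℤ) : Presented n :=
  braid 1 (Pi.single a k) * bridgeZero a b * braid 1 (Pi.single a (-k))

theorem bridge_zero (a b : Fin n) : bridge a b 0 = bridgeZero a b := by
  rw [bridge, neg_zero, Pi.single_zero, braid_one, one_mul, mul_one]

/-- Only the difference of `c` at the two points matters: the rest of `c` takes equal values there
and commutes with the cap. -/
theorem conj_one_bridgeZero {a b : Fin n} (hab : a ≠ b) (c : Fin n → ℤ) :
    conj 1 c (bridgeZero a b) = bridge a b (c a - c b) := by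
  apply conj_eq_of_mul_eq
  obtain ⟨d, hd⟩ : ∃ d : Fin n → ℤ, Pi.single a (c a - c b) + d = c := ⟨_, add_sub_cancel _ _⟩
  have h1 : d a = d b := by
    have ha := congrFun hd a
    have hb := congrFun hd b
    simp [hab.symm] at ha hb
    omega
  have h2 := (bridgeZero_comm_torus hab d h1).eq
  obtain ⟨m, hm⟩ : ∃ m, m = c a - c b := ⟨_, rfl⟩
  rw [← hm] at hd ⊢
  have h3 : braid 1 (Pi.single a (-m)) * braid 1 (Pi.single a m + d) = braid 1 d := by
    rw [braid_torus_mul, ← add_assoc, ← Pi.single_add, neg_add_cancel, Pi.single_zero, zero_add]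
  rw [← hd, bridge, mul_assoc _ (braid 1 (Pi.single a (-m))), h3, ← braid_torus_mul, mul_assoc, h2,
    mul_assoc]

theorem braid_mul_bridge {a b : Fin n} (hab : a ≠ b) (e : Equiv.Perm (Fin n)) (c : Fin n → ℤ)
    (k : ℤ) : braid e c * bridge (e a) (e b) k = bridge a b (k + c a - c b) * braid e c := by
  have h1 := conj_one_bridgeZero hab (c + Pi.single a k)
  have h2 := conj_mul_braid 1 (c + Pi.single a k) (bridgeZero a b)
  rw [h1] at h2
  have h3 : (c + Pi.single a k : Fin n → ℤ) a - (c + Pi.single a k : Fin n → ℤ) b =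
      k + c a - c b := by
    simp [hab.symm]
    ring
  rw [h3] at h2
  have h4 : braid e c * braid 1 (Pi.single (e a) k) = braid 1 (c + Pi.single a k) * braid e 0 := by
    rw [braid_mul, braid_mul, single_comp, one_mul, mul_one]
    congr 1
    ext
    simp
  have h5 : braid 1 (c + Pi.single a k) * braid e 0 * braid 1 (Pi.single (e a) (-k)) =
      braid e c := by
    rw [braid_mul, braid_mul, one_mul, mul_one, single_comp, Pi.single_neg]
    congr 1
    ext
    simp
  rw [bridge, ← mul_assoc, ← mul_assoc, h4, mul_assoc _ (braid e 0), braid_mul_bridgeZero hab,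
    ← mul_assoc, h2, mul_assoc, mul_assoc, ← mul_assoc (braid 1 _), h5]

theorem conj_bridge {a b : Fin n} (hab : a ≠ b) (e : Equiv.Perm (Fin n)) (c : Fin n → ℤ) (k : ℤ) :
    conj e c (bridge (e a) (e b) k) = bridge a b (k + c a - c b) :=
  conj_eq_of_mul_eq (braid_mul_bridge hab e c k)

theorem conj_single_bridgeZero {a b : Fin n} (hab : a ≠ b) (k : ℤ) :
    conj 1 (Pi.single a k) (bridgeZero a b) = bridge a b k := by
  rw [conj_one_bridgeZero hab]
  simp [hab.symm]

/-- Conjugating by the crossing of `a` and `b` exchanges the points. By w F = t⁻¹ F and F w = F t it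
is also conjugation by the inverse of t at `a`, which shifts the parameter by -1. -/
theorem bridge_symm {a b : Fin n} (hab : a ≠ b) (k : ℤ) : bridge a b k = bridge b a (-k - 1) := by
  have h1 : bridgeZero b a = bridge a b (-1) := by
    have h := braid_mul_bridgeZero hab.symm (Equiv.swap a b)
    rw [Equiv.swap_apply_left, Equiv.swap_apply_right, swap_mul_bridgeZero hab] at h
    have h2 := congrArg (fun x => x * braid (Equiv.swap a b) 0) h
    simp only [mul_assoc, braid_perm_mul, Equiv.swap_mul_self, braid_one, mul_one] at h2
    rw [← h2, bridgeZero_mul_swap hab, bridge, neg_neg, mul_assoc]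
  have h2 := conj_one_bridgeZero hab.symm (Pi.single b (-k - 1))
  simp [hab] at h2
  have h3 := conj_bridge hab 1 (Pi.single b (-k - 1)) (-1)
  simp [hab] at h3
  rw [← h2, h1, h3]
  congr 1
  ring

theorem bridge_comm {a b c d : Fin n} (hab : a ≠ b) (hcd : c ≠ d) (hac : a ≠ c)
    (had : a ≠ d) (hbc : b ≠ c) (hbd : b ≠ d) (k l : ℤ) :
    Commute (bridge a b k) (bridge c d l) := by
  have h := (bridgeZero_comm hab hcd hac had hbc hbd).map
    (conj 1 (Pi.single a k + Pi.single c l))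
  rw [conj_one_bridgeZero hab, conj_one_bridgeZero hcd] at h
  simpa [hab.symm, hac, had, hac.symm, hbc, hcd.symm, had.symm] using h

theorem bridge_mul_slide {a b : Fin n} (hab : a ≠ b) (k m : ℤ) :
    bridge a b k * braid 1 (Pi.single a m + Pi.single b m : Fin n → ℤ) = bridge a b k := by
  have h := congrArg (conj 1 (Pi.single a k)) (bridgeZero_mul_slide hab m)
  rw [map_mul, conj_torus, conj_single_bridgeZero hab] at h
  exact h

/-- A cap absorbs a flip. -/
theorem exists_bridge_mul_flip {a b : Fin n} (hab : a ≠ b) (k : ℤ) :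
    ∃ d : Fin n → ℤ, (∀ x, x ≠ a → x ≠ b → d x = 0) ∧
      bridge a b k * braid (Equiv.swap a b) d = bridge a b k := by
  have h1 := congrArg (fun x => x * braid 1 (Pi.single a (-1))) (bridgeZero_mul_swap hab)
  simp only [mul_assoc] at h1
  rw [braid_torus_mul, ← Pi.single_add, add_neg_cancel, Pi.single_zero, braid_one, mul_one,
    braid_mul, one_mul] at h1
  have h := congrArg (conj 1 (Pi.single a k)) h1
  rw [map_mul, conj_one_braid, conj_single_bridgeZero hab] at h
  refine ⟨_, fun x ha hb => ?_, h⟩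
  have hx : Equiv.swap a b x = x := Equiv.swap_apply_of_ne_of_ne ha hb
  simp [ha, hx]

/-- The product of two caps with one common point. -/
theorem exists_bridge_mul_bridge {a b c : Fin n} (hab : a ≠ b) (hac : a ≠ c) (hbc : b ≠ c)
    (k l : ℤ) : ∃ d : Fin n → ℤ, (∀ x, x ≠ a → x ≠ c → d x = 0) ∧
      bridge a b k * bridge c b l = bridge a b k * braid (Equiv.swap a c) d ∧
      bridge a b k * bridge c b l = braid (Equiv.swap a c) d * bridge c b l := by
  obtain ⟨h1, h2⟩ := bridgeZero_mul_bridgeZero hab hac hbc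
  have h3 := congrArg (conj 1 (Pi.single a k + Pi.single c l)) h1
  have h4 := congrArg (conj 1 (Pi.single a k + Pi.single c l)) h2
  have h5 : conj 1 (Pi.single a k + Pi.single c l) (bridgeZero a b) = bridge a b k := by
    rw [conj_one_bridgeZero hab]
    simp [hab.symm, hac, hbc]
  have h6 : conj 1 (Pi.single a k + Pi.single c l) (bridgeZero c b) = bridge c b l := by
    rw [conj_one_bridgeZero hbc.symm]
    simp [hab.symm, hac.symm, hbc]
  rw [map_mul, map_mul, conj_one_braid, h5, h6] at h3 h4
  refine ⟨_, fun x ha hc => ?_, h3, h4⟩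
  have hx : Equiv.swap a c x = x := Equiv.swap_apply_of_ne_of_ne ha hc
  simp [ha, hc, hx]

/-- Between the two caps the torus factors combine to the power l - k of t at `a`, and the relation
F t^m F applies. -/
theorem bridge_mul_self {a b : Fin n} (hab : a ≠ b) (k l : ℤ) :
    bridge a b k * bridge a b l =
      (MvPolynomial.X (l - k).natAbs : R0a) • (braid 1 (Pi.single a (k - l)) * bridge a b l) := by
  have h := bridgeZero_mul_torus_mul hab (l - k)
  have h1 : bridge a b k * bridge a b l = braid 1 (Pi.single a k) *
      (bridgeZero a b * braid 1 (Pi.single a (l - k)) * bridgeZero a b) *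
        braid 1 (Pi.single a (-l)) := by
    have : braid 1 (Pi.single a (l - k)) =
        braid 1 (Pi.single a (-k)) * braid 1 (Pi.single a l) := by
      rw [braid_torus_mul, ← Pi.single_add]
      congr 2
      ring
    rw [this, bridge, bridge]
    simp only [mul_assoc]
  rw [h1, h, bridge, ← mul_assoc, ← mul_assoc, braid_torus_mul, ← Pi.single_add, sub_add_cancel,
    mul_smul_comm, smul_mul_assoc]

theorem presentedHom_bridge {a b : Fin n} (hab : a ≠ b) (k : ℤ) :
    ATL.presentedHom n (bridge a b k) = ATL.capElt a b hab k := by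
  have h1 : ATL.presentedHom n (bridgeZero a b) = ATL.capElt a b hab 0 := by
    obtain ⟨i, e, ha, hb⟩ := exists_index hab
    have h := congrArg (ATL.presentedHom n) (braid_mul_gen_F ha hb)
    have h2 := ATL.str_mul_capElt_of_apply_eq hab (lo_ne_hi i) e 0 0 ha hb
    rw [map_mul, map_mul, presentedHom_braid, presentedHom_gen, ATL.genTangle,
      FTangle_eq_cap i (lo_ne_hi i), ← ATL.capElt, h2] at h
    have hu : IsUnit (ATL.str e 0) := by
      rw [← presentedHom_braid]
      exact (isUnit_braid e 0).map (ATL.presentedHom n)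
    rw [hu.mul_left_inj] at h
    simpa using h.symm
  rw [bridge, map_mul, map_mul, presentedHom_braid, presentedHom_braid, h1]
  have h2 := ATL.str_mul_capElt hab 1 (Pi.single a k) hab 0
  simp only [Equiv.Perm.one_apply] at h2
  rw [h2, mul_assoc, ATL.str_one_mul_str_one, ← Pi.single_add, add_neg_cancel, Pi.single_zero,
    ATL.str_one, mul_one]
  simp [hab.symm]

end Presented

end ArrowTL

namespace ArrowTL

open ArrowTangle

namespace ArrowTangle

variable {n : ℕ}

/-! ### Opening a cap -/

/-- A cap and a cup are replaced by two strands. -/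
theorem exists_open (T : ArrowTangle n) {a b a' b' : Fin n}
    (h : T.partner (false, a) = (false, b)) (h' : T.partner (true, a') = (true, b')) {m : ℤ}
    (hm : Even m) : ∃ S : ArrowTangle n, S.partner (false, a) = (true, a') ∧
      S.partner (false, b) = (true, b') ∧ S.dir (true, a') = m ∧ S.dir (false, b) = 0 ∧
      ∀ v, v ≠ (false, a) → v ≠ (false, b) → v ≠ (true, a') → v ≠ (true, b') → Agree S T v := by
  have hb : T.partner (false, b) = (false, a) := by rw [← h, T.partner_partner]
  have hb' : T.partner (true, b') = (true, a') := by rw [← h', T.partner_partner]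
  have hab : a ≠ b := by
    rintro rfl
    exact T.partner_ne _ h
  have hab' : a' ≠ b' := by
    rintro rfl
    exact T.partner_ne _ h'
  obtain ⟨E, e1, e2, e3⟩ : ∃ E : FlatTangle n, E.partner (false, a) = (true, a') ∧
      E.partner (false, b) = (true, b') ∧
      ∀ v, v ≠ (false, a) → v ≠ (false, b) → v ≠ (true, a') → v ≠ (true, b') →
        E.partner v = T.partner v ∧ E.partner v ≠ (false, a) ∧ E.partner v ≠ (false, b) ∧
          E.partner v ≠ (true, a') ∧ E.partner v ≠ (true, b') := by
    have hs : ∀ v, Equiv.swap (false, b) (true, a') (Equiv.swap (false, b) (true, a') v) = v :=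
      fun v => by rw [← Equiv.Perm.mul_apply, Equiv.swap_mul_self, Equiv.Perm.one_apply]
    have ha0 : Equiv.swap ((false, b) : Vertex n) (true, a') (false, a) = (false, a) :=
      Equiv.swap_apply_of_ne_of_ne (by simpa using hab) (by simp)
    have hb0 : Equiv.swap ((false, b) : Vertex n) (true, a') (true, b') = (true, b') :=
      Equiv.swap_apply_of_ne_of_ne (by simp) (by simpa using hab'.symm)
    -- Conjugating the pairing by the transposition of (0,b) and (1,a') turns the cap and the cup
    -- into the strands from a to a' and from b to b', and leaves all other pairs alone.
    refine ⟨{ partner := fun v => Equiv.swap (false, b) (true, a') (T.partner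
                (Equiv.swap (false, b) (true, a') v))
              partner_partner := fun v => by rw [hs, T.partner_partner, hs]
              partner_ne := fun v hv => ?_ }, ?_, ?_, fun v h1 h2 h3 h4 => ?_⟩
    · rw [Equiv.swap_apply_eq_iff] at hv
      exact T.partner_ne _ hv
    · dsimp only
      rw [ha0, h, Equiv.swap_apply_left]
    · dsimp only
      rw [Equiv.swap_apply_left, h', hb0]
    · have key : ∀ u w, T.partner u = w → v ≠ w → T.partner v ≠ u := by
        rintro u w huw hvw rfl
        exact hvw (by rw [← huw, T.partner_partner])
      have k1 := key _ _ h h2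
      have k2 := key _ _ hb h1
      have k3 := key _ _ h' h4
      have k4 := key _ _ hb' h3
      have : Equiv.swap (false, b) (true, a') (T.partner (Equiv.swap (false, b) (true, a') v)) =
          T.partner v := by
        rw [Equiv.swap_apply_of_ne_of_ne h2 h3, Equiv.swap_apply_of_ne_of_ne k2 k3]
      dsimp only
      rw [this]
      exact ⟨rfl, k1, k2, k3, k4⟩
  have e1' : E.partner (true, a') = (false, a) := by rw [← e1, E.partner_partner]
  have e2' : E.partner (true, b') = (false, b) := by rw [← e2, E.partner_partner]
  obtain ⟨d, d1, d2, d3, d4, d5⟩ : ∃ d : Vertex n → ℤ, d (false, a) = m ∧ d (true, a') = m ∧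
      d (false, b) = 0 ∧ d (true, b') = 0 ∧
      ∀ v, v ≠ (false, a) → v ≠ (false, b) → v ≠ (true, a') → v ≠ (true, b') → d v = T.dir v := by
    refine ⟨fun v => if v = (false, a) ∨ v = (true, a') then m else
      if v = (false, b) ∨ v = (true, b') then 0 else T.dir v, ?_, ?_, ?_, ?_,
      fun v h1 h2 h3 h4 => ?_⟩
    · simp
    · simp
    · simp [hab.symm]
    · simp [hab'.symm]
    · simp [h1, h2, h3, h4]
  have cases4 : ∀ p : Vertex n → Prop, p (false, a) → p (false, b) → p (true, a') → p (true, b') →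
      (∀ v, v ≠ (false, a) → v ≠ (false, b) → v ≠ (true, a') → v ≠ (true, b') → p v) →
      ∀ v, p v := by
    intro p q1 q2 q3 q4 q5 v
    by_cases h1 : v = (false, a)
    · rwa [h1]
    by_cases h2 : v = (false, b)
    · rwa [h2]
    by_cases h3 : v = (true, a')
    · rwa [h3]
    by_cases h4 : v = (true, b')
    · rwa [h4]
    exact q5 v h1 h2 h3 h4
  have hm' : ¬ Odd m := Int.not_odd_iff_even.2 hm
  refine ⟨ofDir E d (cases4 _ ?_ ?_ ?_ ?_ fun v h1 h2 h3 h4 => ?_)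
    (cases4 _ ?_ ?_ ?_ ?_ fun v h1 h2 h3 h4 => ?_), e1, e2, by rw [ofDir_dir, d2],
    by rw [ofDir_dir, d3], fun v h1 h2 h3 h4 => ⟨(e3 v h1 h2 h3 h4).1, ?_⟩⟩
  · rw [e1, d1, d2, st_even hm]
  · rw [e2, d3, d4, st_even Even.zero]
  · rw [e1', d1, d2, st_even hm]
  · rw [e2', d3, d4, st_even Even.zero]
  · obtain ⟨k0, k1, k2, k3, k4⟩ := e3 v h1 h2 h3 h4
    rw [d5 _ k1 k2 k3 k4, d5 v h1 h2 h3 h4, k0, T.dir_partner]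
  · rw [e1, d1]
    simpa using hm'
  · rw [e2, d3]
    simp
  · rw [e1', d2]
    simpa using hm'
  · rw [e2', d4]
    simp
  · obtain ⟨k0, k1, k2, k3, k4⟩ := e3 v h1 h2 h3 h4
    rw [d5 v h1 h2 h3 h4, k0, T.odd_dir]
  · rw [ofDir_dir, d5 v h1 h2 h3 h4]

/-- A tangle with a cap on the side `0` has a cup on the side `1`. -/
theorem exists_cup (T : ArrowTangle n) {a b : Fin n} (h : T.partner (false, a) = (false, b)) :
    ∃ a' b', T.partner (true, a') = (true, b') := by
  by_contra! hc
  have h1 : ∀ y, T.partner (true, y) = (false, (T.partner (true, y)).2) := by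
    intro y
    rcases hy : T.partner (true, y) with ⟨_ | _, z⟩
    · rfl
    · exact absurd hy (hc y z)
  -- Without a cup, the n points of the side 1 are joined injectively to points of the side 0 and so
  -- exhaust them, leaving none for the cap.
  have hinj : Function.Injective fun y => (T.partner (true, y)).2 := by
    intro y z hyz
    have h2 : T.partner (true, y) = T.partner (true, z) := by
      rw [h1 y, h1 z]
      exact congrArg (Prod.mk false) hyz
    have h3 := congrArg T.partner h2
    rw [T.partner_partner, T.partner_partner] at h3
    exact congrArg Prod.snd h3
  obtain ⟨y, hy⟩ := Finite.surjective_of_injective hinj a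
  have h2 := h1 y
  dsimp only at hy
  rw [hy] at h2
  have h3 := congrArg T.partner h2
  rw [T.partner_partner, h] at h3
  simp at h3

/-- A tangle without caps on the side `0` is invertible. -/
theorem exists_eq_strands (T : ArrowTangle n)
    (h : ∀ a b, T.partner (false, a) ≠ (false, b)) : ∃ e c, T = strands e c := by
  have h1 : ∀ y, T.partner (false, y) = (true, (T.partner (false, y)).2) := by
    intro y
    rcases hy : T.partner (false, y) with ⟨_ | _, z⟩
    · exact absurd hy (h y z)
    · rfl
  have hinj : Function.Injective fun y => (T.partner (false, y)).2 := by
    intro y z hyz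
    have h2 : T.partner (false, y) = T.partner (false, z) := by
      rw [h1 y, h1 z]
      exact congrArg (Prod.mk true) hyz
    have h3 := congrArg T.partner h2
    rw [T.partner_partner, T.partner_partner] at h3
    exact congrArg Prod.snd h3
  have h2 : ∀ y, Even (T.dir (false, y)) := by
    intro y
    rw [← Int.not_odd_iff_even, T.odd_dir, h1 y]
    simp
  refine ⟨Equiv.ofBijective _ (Finite.injective_iff_bijective.1 hinj),
    fun y => T.dir (false, y) / 2, ?_⟩
  have key : ∀ y, Agree T (strands (Equiv.ofBijective _ (Finite.injective_iff_bijective.1 hinj))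
      fun y => T.dir (false, y) / 2) (false, y) := by
    intro y
    refine ⟨h1 y, ?_⟩
    rw [strands_dir_false, Int.mul_ediv_cancel' (h2 y).two_dvd]
  refine ext_agree ?_
  rintro ⟨_ | _, y⟩
  · exact key y
  · obtain ⟨z, rfl⟩ := Finite.surjective_of_injective hinj y
    exact (key z).of_partner (h1 z)

end ArrowTangle

end ArrowTL

/-! ### Tangles as disjoint caps followed by an invertible tangle. -/

namespace ArrowTL

open ArrowTangle

/-- A cap that joins two points of the side `0`, with the half of its label. -/
structure Arc (n : ℕ) where
  /-- The first point. -/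
  src : Fin n
  /-- The second point. -/
  tgt : Fin n
  /-- The label of the cap is `2 * lab + 1`. -/
  lab : ℤ

variable {n : ℕ}

/-- Two arcs have no point in common. -/
def Arc.Apart (s t : Arc n) : Prop :=
  s.src ≠ t.src ∧ s.src ≠ t.tgt ∧ s.tgt ≠ t.src ∧ s.tgt ≠ t.tgt

theorem Arc.Apart.symm {s t : Arc n} (h : s.Apart t) : t.Apart s :=
  ⟨h.1.symm, h.2.2.1.symm, h.2.1.symm, h.2.2.2.symm⟩

/-- The arcs of the list join distinct points and are disjoint. -/
def IsDiagram (L : List (Arc n)) : Prop := L.Pairwise Arc.Apart ∧ ∀ t ∈ L, t.src ≠ t.tgt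

theorem isDiagram_nil : IsDiagram ([] : List (Arc n)) := ⟨List.Pairwise.nil, by simp⟩

theorem isDiagram_cons {α : Arc n} {L : List (Arc n)} :
    IsDiagram (α :: L) ↔ α.src ≠ α.tgt ∧ (∀ t ∈ L, α.Apart t) ∧ IsDiagram L := by
  rw [IsDiagram, IsDiagram, List.pairwise_cons, List.forall_mem_cons]
  tauto

theorem IsDiagram.perm {L L' : List (Arc n)} (h : IsDiagram L) (hp : L.Perm L') : IsDiagram L' :=
  ⟨(hp.pairwise_iff fun h => h.symm).1 h.1, fun t ht => h.2 t (hp.mem_iff.2 ht)⟩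

namespace ArrowTangle

/-- The tangle with the caps `L` on the side `0`, the images of these caps under `e` on the
side `1`, and the other strands given by `e`. -/
noncomputable def diagram (L : List (Arc n)) (e : Equiv.Perm (Fin n)) (c : Fin n → ℤ) :
    ArrowTangle n :=
  L.foldr (fun t T => if h : t.src ≠ t.tgt then (cap t.src t.tgt h t.lab).comp T else T)
    (strands e c)

theorem diagram_nil (e : Equiv.Perm (Fin n)) (c : Fin n → ℤ) : diagram [] e c = strands e c := rfl

theorem diagram_cons {α : Arc n} (h : α.src ≠ α.tgt) (L : List (Arc n)) (e : Equiv.Perm (Fin n))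
    (c : Fin n → ℤ) :
    diagram (α :: L) e c = (cap α.src α.tgt h α.lab).comp (diagram L e c) := dif_pos h

theorem dir_true_of_strand {T : ArrowTangle n} {x y : Fin n} {m : ℤ}
    (h : T.partner (false, x) = (true, y)) (h' : T.dir (false, x) = 2 * m) :
    T.dir (true, y) = 2 * m := by
  rw [← h, T.dir_partner, h', st_even (even_two_mul m)]

/-- The pairs of `T` are those of `diagram L e c`. -/
structure IsDiagramOf (L : List (Arc n)) (e : Equiv.Perm (Fin n)) (c : Fin n → ℤ)
    (T : ArrowTangle n) : Prop where
  cap : ∀ t ∈ L, T.partner (false, t.src) = (false, t.tgt) ∧ T.dir (false, t.src) = 2 * t.lab + 1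
  cup : ∀ t ∈ L, T.partner (true, e t.src) = (true, e t.tgt) ∧
    T.dir (true, e t.src) = 2 * c t.src + -(2 * t.lab + 1) - 2 * c t.tgt
  strand : ∀ x, (∀ t ∈ L, x ≠ t.src ∧ x ≠ t.tgt) →
    T.partner (false, x) = (true, e x) ∧ T.dir (false, x) = 2 * c x

/-- As the arcs are disjoint, each new cap meets two through strands of the part already built. -/
theorem isDiagramOf_diagram {L : List (Arc n)} (hL : IsDiagram L) (e : Equiv.Perm (Fin n))
    (c : Fin n → ℤ) : IsDiagramOf L e c (diagram L e c) := by
  induction L with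
  | nil => exact ⟨by simp, by simp, fun x _ => ⟨rfl, strands_dir_false e c x⟩⟩
  | cons α L ih =>
    obtain ⟨h1, h2, h3⟩ := isDiagram_cons.1 hL
    have hR := ih h3
    rw [diagram_cons h1]
    obtain ⟨pa, da⟩ := hR.strand α.src fun t ht => ⟨(h2 t ht).1, (h2 t ht).2.1⟩
    obtain ⟨pb, db⟩ := hR.strand α.tgt fun t ht => ⟨(h2 t ht).2.2.1, (h2 t ht).2.2.2⟩
    have hE := cap_comp_cap_end h1 α.lab (T := diagram L e c)
    have hC := cap_comp_cup h1 α.lab pa pb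
    rw [dir_true_of_strand pa da, db] at hC
    have hf : ∀ x, x ≠ α.src → x ≠ α.tgt →
        Agree ((ArrowTangle.cap α.src α.tgt h1 α.lab).comp (diagram L e c)) (diagram L e c)
          (false, x) := fun x hx hx' =>
      cap_comp_agree h1 α.lab pa pb (by simpa using hx) (by simpa using hx') (by simp) (by simp)
    have ht : ∀ x, x ≠ α.src → x ≠ α.tgt →
        Agree ((ArrowTangle.cap α.src α.tgt h1 α.lab).comp (diagram L e c)) (diagram L e c)
          (true, e x) := fun x hx hx' =>
      cap_comp_agree h1 α.lab pa pb (by simp) (by simp) (by simpa using hx) (by simpa using hx')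
    refine ⟨?_, ?_, ?_⟩
    · rw [List.forall_mem_cons]
      refine ⟨hE, fun t hm => ?_⟩
      have h4 := hf t.src (h2 t hm).1.symm (h2 t hm).2.2.1.symm
      rw [h4.1, h4.2]
      exact hR.cap t hm
    · rw [List.forall_mem_cons]
      refine ⟨hC, fun t hm => ?_⟩
      have h4 := ht t.src (h2 t hm).1.symm (h2 t hm).2.2.1.symm
      rw [h4.1, h4.2]
      exact hR.cup t hm
    · intro x hx
      rw [List.forall_mem_cons] at hx
      have h4 := hf x hx.1.1 hx.1.2
      rw [h4.1, h4.2]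
      exact hR.strand x hx.2

theorem cap_loopWeight_diagram {α : Arc n} {L : List (Arc n)} (h : IsDiagram (α :: L))
    (h1 : α.src ≠ α.tgt) (e : Equiv.Perm (Fin n)) (c : Fin n → ℤ) :
    (cap α.src α.tgt h1 α.lab).loopWeight (diagram L e c) = 1 := by
  obtain ⟨-, h2, h3⟩ := isDiagram_cons.1 h
  have hR := isDiagramOf_diagram h3 e c
  obtain ⟨pa, da⟩ := hR.strand α.src fun t ht => ⟨(h2 t ht).1, (h2 t ht).2.1⟩
  obtain ⟨pb, db⟩ := hR.strand α.tgt fun t ht => ⟨(h2 t ht).2.2.1, (h2 t ht).2.2.2⟩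
  exact cap_loopWeight_of_through h1 α.lab pa pb

/-- Opening a cap together with some cup lowers the number of cap end points on the side 0, and
composing with the cap closes them again. -/
theorem exists_eq_diagram (T : ArrowTangle n) :
    ∃ L e c, IsDiagram L ∧ T = diagram L e c := by
  obtain ⟨m, hm⟩ : ∃ m, (Finset.univ.filter fun x => (T.partner (false, x)).1 = false).card = m :=
    ⟨_, rfl⟩
  induction m using Nat.strong_induction_on generalizing T with
  | _ m ih =>
    by_cases hT : ∀ a b, T.partner (false, a) ≠ (false, b)
    · obtain ⟨e, c, h⟩ := T.exists_eq_strands hT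
      exact ⟨[], e, c, isDiagram_nil, h⟩
    push Not at hT
    obtain ⟨a, b, h⟩ := hT
    obtain ⟨a', b', h'⟩ := T.exists_cup h
    have hab : a ≠ b := by
      rintro rfl
      exact T.partner_ne _ h
    have hodd : Odd (T.dir (false, a)) := by rw [T.odd_dir, h]
    have hodd' : Odd (T.dir (true, a')) := by rw [T.odd_dir, h']
    obtain ⟨k, hk⟩ := hodd
    -- By `cap_comp_cup` the recomposed cup has the label of the strand at a' minus 2k + 1 minus the
    -- label of the strand at b. With 0 on the latter, the former has to be the label of the
    -- original cup plus 2k + 1.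
    obtain ⟨S, s1, s2, s3, s4, s5⟩ := T.exists_open h h' (hodd'.add_odd (odd_two_mul_add_one k))
    have hlt : (Finset.univ.filter fun x => (S.partner (false, x)).1 = false).card < m := by
      rw [← hm]
      refine Finset.card_lt_card ⟨fun x hx => ?_, fun hc => ?_⟩
      · rw [Finset.mem_filter] at hx ⊢
        refine ⟨Finset.mem_univ x, ?_⟩
        by_cases hxa : x = a
        · rw [hxa, h]
        · by_cases hxb : x = b
          · have hx2 := hx.2
            rw [hxb, s2] at hx2
            simp at hx2
          · rw [← (s5 (false, x) (by simpa using hxa) (by simpa using hxb) (by simp) (by simp)).1]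
            exact hx.2
      · have h1 := hc (Finset.mem_filter.2 ⟨Finset.mem_univ a, by rw [h]⟩)
        rw [Finset.mem_filter, s1] at h1
        simp at h1
    obtain ⟨L, e, c, hL, rfl⟩ := ih _ hlt S rfl
    have hR := isDiagramOf_diagram hL e c
    have hav : ∀ x y, (diagram L e c).partner (false, x) = (true, y) → ∀ t ∈ L,
        x ≠ t.src ∧ x ≠ t.tgt := by
      intro x y hx t ht
      have h1 := (hR.cap t ht).1
      have h2 : (diagram L e c).partner (false, t.tgt) = (false, t.src) := by
        rw [← h1, (diagram L e c).partner_partner]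
      constructor
      · rintro rfl
        rw [hx] at h1
        simp at h1
      · rintro rfl
        rw [hx] at h2
        simp at h2
    refine ⟨⟨a, b, k⟩ :: L, e, c, isDiagram_cons.2 ⟨hab, fun t ht => ⟨(hav _ _ s1 t ht).1,
      (hav _ _ s1 t ht).2, (hav _ _ s2 t ht).1, (hav _ _ s2 t ht).2⟩, hL⟩, ?_⟩
    rw [diagram_cons (α := ⟨a, b, k⟩) hab]
    have hE := cap_comp_cap_end hab k (T := diagram L e c)
    have hC := cap_comp_cup hab k s1 s2
    rw [s3, s4] at hC
    have A1 : Agree T ((cap a b hab k).comp (diagram L e c)) (false, a) :=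
      ⟨by rw [h, hE.1], by rw [hE.2, hk]⟩
    have A2 : Agree T ((cap a b hab k).comp (diagram L e c)) (true, a') :=
      ⟨by rw [h', hC.1], by rw [hC.2]; ring⟩
    refine ext_agree fun v => ?_
    by_cases h1 : v = (false, a)
    · rwa [h1]
    by_cases h2 : v = (false, b)
    · rw [h2]
      exact A1.of_partner h
    by_cases h3 : v = (true, a')
    · rwa [h3]
    by_cases h4 : v = (true, b')
    · rw [h4]
      exact A2.of_partner h'
    have A3 := s5 v h1 h2 h3 h4
    have A4 := cap_comp_agree hab k s1 s2 h1 h2 h3 h4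
    exact ⟨by rw [A4.1, A3.1], by rw [A4.2, A3.2]⟩

/-- Opening a cap is well defined. -/
theorem eq_of_cap_comp_eq {T T' : ArrowTangle n} {a b a' b' : Fin n} {hab : a ≠ b} {k : ℤ}
    (h : (cap a b hab k).comp T = (cap a b hab k).comp T')
    (h1 : T.partner (false, a) = (true, a')) (h2 : T.partner (false, b) = (true, b'))
    (h1' : T'.partner (false, a) = (true, a')) (h2' : T'.partner (false, b) = (true, b'))
    (h3 : T.dir (false, a) = T'.dir (false, a)) (h4 : T.dir (false, b) = T'.dir (false, b)) :
    T = T' := by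
  have A1 : Agree T T' (false, a) := ⟨by rw [h1, h1'], h3⟩
  have A2 : Agree T T' (false, b) := ⟨by rw [h2, h2'], h4⟩
  refine ext_agree fun v => ?_
  by_cases e1 : v = (false, a)
  · rwa [e1]
  by_cases e2 : v = (false, b)
  · rwa [e2]
  by_cases e3 : v = (true, a')
  · rw [e3]
    exact A1.of_partner h1
  by_cases e4 : v = (true, b')
  · rw [e4]
    exact A2.of_partner h2
  have A3 := cap_comp_agree hab k h1 h2 e1 e2 e3 e4
  have A4 := cap_comp_agree hab k h1' h2' e1 e2 e3 e4
  rw [h] at A3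
  exact ⟨by rw [← A3.1, A4.1], by rw [← A3.2, A4.2]⟩

end ArrowTangle

/-! ### Normal forms in the presented algebra and their tangles. -/

namespace Presented

open scoped ATL

/-- The product of the caps of a list of arcs. -/
noncomputable def bridges (L : List (Arc n)) : Presented n :=
  (L.map fun t => bridge t.src t.tgt t.lab).prod

/-- The normal form of `diagram L e c`. -/
noncomputable def nf (L : List (Arc n)) (e : Equiv.Perm (Fin n)) (c : Fin n → ℤ) : Presented n :=
  bridges L * braid e c

theorem bridges_nil : bridges ([] : List (Arc n)) = 1 := rfl

theorem bridges_cons (α : Arc n) (L : List (Arc n)) :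
    bridges (α :: L) = bridge α.src α.tgt α.lab * bridges L := by
  rw [bridges, List.map_cons, List.prod_cons, bridges]

theorem bridges_append (L L' : List (Arc n)) : bridges (L ++ L') = bridges L * bridges L' := by
  rw [bridges, List.map_append, List.prod_append, bridges, bridges]

theorem bridges_perm {L L' : List (Arc n)} (h : IsDiagram L) (hp : L.Perm L') :
    bridges L = bridges L' := by
  refine (hp.map _).prod_eq' ?_
  rw [List.pairwise_map]
  refine h.1.imp_of_mem fun {s t} hs ht hst => ?_
  exact bridge_comm (h.2 s hs) (h.2 t ht) hst.1 hst.2.1 hst.2.2.1 hst.2.2.2 s.lab t.lab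

theorem presentedHom_nf {L : List (Arc n)} (hL : IsDiagram L) (e : Equiv.Perm (Fin n))
    (c : Fin n → ℤ) : ATL.presentedHom n (nf L e c) = ATL.of (diagram L e c) := by
  induction L with
  | nil => rw [nf, bridges_nil, one_mul, presentedHom_braid, ATL.str, diagram_nil]
  | cons α L ih =>
    obtain ⟨h1, h2, h3⟩ := isDiagram_cons.1 hL
    have h4 := ih h3
    rw [nf] at h4 ⊢
    rw [bridges_cons, mul_assoc, map_mul, h4, presentedHom_bridge h1, ATL.capElt,
      ATL.of_mul_of_of_loopWeight (cap_loopWeight_diagram hL h1 e c), diagram_cons h1]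

/-- Distinct tangles are distinct basis elements. So a normal form may be rewritten in the presented
algebra without following the effect on the tangle. -/
theorem diagram_eq_of_nf_eq {L L' : List (Arc n)} (hL : IsDiagram L) (hL' : IsDiagram L')
    {e e' : Equiv.Perm (Fin n)} {c c' : Fin n → ℤ} (h : nf L e c = nf L' e' c') :
    diagram L e c = diagram L' e' c' := by
  have h1 := congrArg (ATL.presentedHom n) h
  rw [presentedHom_nf hL, presentedHom_nf hL'] at h1
  exact Finsupp.single_left_injective one_ne_zero h1

end Presented

end ArrowTL

namespace ArrowTL

open ArrowTangle

namespace Presented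

open scoped ATL

variable {n : ℕ}

/-! ### The normal forms span the presented algebra -/

theorem braid_mul_nf {L : List (Arc n)} (hL : IsDiagram L) (e : Equiv.Perm (Fin n))
    (c : Fin n → ℤ) : ∃ L', IsDiagram L' ∧ (∀ e' c', braid e c * nf L e' c' =
      nf L' (e' * e) (c + c' ∘ e)) := by
  obtain ⟨f, hf⟩ : ∃ f : Arc n → Arc n, ∀ t, f t = ⟨e.symm t.src, e.symm t.tgt,
      t.lab + c (e.symm t.src) - c (e.symm t.tgt)⟩ := ⟨_, fun _ => rfl⟩
  have h1 : braid e c * bridges L = bridges (L.map f) * braid e c := by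
    have h0 := hL.2
    clear hL
    induction L with
    | nil => rw [List.map_nil, bridges_nil, mul_one, one_mul]
    | cons t L ih =>
      rw [List.forall_mem_cons] at h0
      have hne : e.symm t.src ≠ e.symm t.tgt := e.symm.injective.ne h0.1
      have h2 := braid_mul_bridge hne e c t.lab
      rw [e.apply_symm_apply, e.apply_symm_apply] at h2
      rw [List.map_cons, bridges_cons, bridges_cons, ← mul_assoc, h2, mul_assoc, ih h0.2, hf,
        mul_assoc]
  refine ⟨L.map f, ⟨?_, ?_⟩, fun e' c' => ?_⟩
  · rw [List.pairwise_map]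
    refine hL.1.imp fun {s t} h => ?_
    rw [hf, hf]
    exact ⟨e.symm.injective.ne h.1, e.symm.injective.ne h.2.1, e.symm.injective.ne h.2.2.1,
      e.symm.injective.ne h.2.2.2⟩
  · intro t ht
    obtain ⟨s, hs, rfl⟩ := List.mem_map.1 ht
    rw [hf]
    exact e.symm.injective.ne (hL.2 s hs)
  · rw [nf, nf, ← mul_assoc, h1, mul_assoc, braid_mul]

theorem exists_perm_cons {α : Type*} {t : α} {L : List α} (h : t ∈ L) :
    ∃ M, L.Perm (t :: M) := by
  obtain ⟨l, r, rfl⟩ := List.append_of_mem h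
  exact ⟨l ++ r, List.perm_middle⟩

/-- By `bridge_symm` the common point can be made the second point of both caps. Either the caps
then join the same points and a cycle splits off, or the zigzag is straightened. -/
theorem exists_bridge_mul_bridge_eq_smul {a b p q : Fin n} (hab : a ≠ b) (hpq : p ≠ q)
    (h : ¬ (a ≠ p ∧ a ≠ q ∧ b ≠ p ∧ b ≠ q)) (k l : ℤ) : ∃ (r : R0a) (e : Equiv.Perm (Fin n))
      (c : Fin n → ℤ), bridge a b k * bridge p q l = r • (braid e c * bridge p q l) := by
  have key : ∀ (a p q : Fin n) (k l : ℤ), a ≠ q → p ≠ q → ∃ (r : R0a) (e : Equiv.Perm (Fin n))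
      (c : Fin n → ℤ), bridge a q k * bridge p q l = r • (braid e c * bridge p q l) := by
    intro a p q k l haq hpq
    by_cases hap : a = p
    · subst hap
      exact ⟨_, _, _, bridge_mul_self haq k l⟩
    · obtain ⟨d, -, -, hd⟩ := exists_bridge_mul_bridge haq hap hpq.symm k l
      exact ⟨1, _, d, by rw [one_smul, hd]⟩
  have key2 : ∀ (a b : Fin n) (k : ℤ), a ≠ b → b = p ∨ b = q → ∃ (r : R0a)
      (e : Equiv.Perm (Fin n)) (c : Fin n → ℤ), bridge a b k * bridge p q l =
        r • (braid e c * bridge p q l) := by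
    rintro a b k hab (rfl | rfl)
    · rw [bridge_symm hpq l]
      exact key a q b k _ hab hpq.symm
    · exact key a p b k l hab hpq
  by_cases hb : b = p ∨ b = q
  · exact key2 a b k hab hb
  · rw [bridge_symm hab k]
    refine key2 b a _ hab.symm ?_
    tauto

/-- The span of the normal forms. -/
noncomputable def nfSpan (n : ℕ) : Submodule R0a (Presented n) :=
  Submodule.span R0a {x | ∃ L e c, IsDiagram L ∧ x = nf L e c}

theorem nf_mem {L : List (Arc n)} (hL : IsDiagram L) (e : Equiv.Perm (Fin n)) (c : Fin n → ℤ) :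
    nf L e c ∈ nfSpan n := Submodule.subset_span ⟨L, e, c, hL, rfl⟩

theorem mul_mem_nfSpan {x : Presented n}
    (hx : ∀ (L : List (Arc n)) (e : Equiv.Perm (Fin n)) (c : Fin n → ℤ), IsDiagram L →
      x * nf L e c ∈ nfSpan n) {y : Presented n} (hy : y ∈ nfSpan n) : x * y ∈ nfSpan n := by
  induction hy using Submodule.span_induction with
  | mem y hy =>
    obtain ⟨L, e, c, hL, rfl⟩ := hy
    exact hx L e c hL
  | zero => rw [mul_zero]; exact zero_mem _
  | add y z _ _ h h' => rw [mul_add]; exact add_mem h h'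
  | smul r y _ h => rw [mul_smul_comm]; exact Submodule.smul_mem _ r h

theorem braid_mul_mem (e : Equiv.Perm (Fin n)) (c : Fin n → ℤ) {y : Presented n}
    (hy : y ∈ nfSpan n) : braid e c * y ∈ nfSpan n := by
  refine mul_mem_nfSpan (fun L e' c' hL => ?_) hy
  obtain ⟨L', hL', h⟩ := braid_mul_nf hL e c
  rw [h]
  exact nf_mem hL' _ _

/-- A bridge disjoint from all caps extends the list. Otherwise some cap it meets is moved to the
front, and the bridge is replaced by a scalar and a braid. -/
theorem bridge_mul_mem {a b : Fin n} (hab : a ≠ b) (k : ℤ) {y : Presented n}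
    (hy : y ∈ nfSpan n) : bridge a b k * y ∈ nfSpan n := by
  refine mul_mem_nfSpan (fun L e c hL => ?_) hy
  by_cases h : ∀ t ∈ L, (⟨a, b, k⟩ : Arc n).Apart t
  · have := nf_mem (isDiagram_cons (α := ⟨a, b, k⟩).2 ⟨hab, h, hL⟩) e c
    rwa [nf, bridges_cons, mul_assoc] at this
  · push Not at h
    obtain ⟨t, ht, hat⟩ := h
    obtain ⟨M, hM⟩ := exists_perm_cons ht
    have hL' := hL.perm hM
    obtain ⟨h1, h2, h3⟩ := isDiagram_cons.1 hL'
    obtain ⟨r, e', c', hr⟩ := exists_bridge_mul_bridge_eq_smul hab h1 hat k t.lab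
    have h4 : bridge a b k * nf L e c = r • (braid e' c' * nf L e c) := by
      rw [nf, bridges_perm hL hM, bridges_cons, ← mul_assoc, ← mul_assoc, hr, smul_mul_assoc,
        smul_mul_assoc]
      simp only [mul_assoc]
    rw [h4]
    exact Submodule.smul_mem _ r (braid_mul_mem e' c' (nf_mem hL e c))

theorem gen_mul_mem (g : Gen n) {y : Presented n} (hy : y ∈ nfSpan n) : gen g * y ∈ nfSpan n := by
  cases g with
  | F i =>
    rw [gen_F_eq, ← bridge_zero]
    exact bridge_mul_mem (lo_ne_hi i) 0 hy
  | w i =>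
    rw [← braid_swap]
    exact braid_mul_mem _ _ hy
  | t j =>
    rw [← braid_torus_single]
    exact braid_mul_mem _ _ hy
  | tInv j =>
    rw [← braid_torus_single_neg]
    exact braid_mul_mem _ _ hy

theorem mk_mul_mem (x : FreeAlgebra R0a (Gen n)) :
    ∀ y ∈ nfSpan n, RingQuot.mkAlgHom R0a (Rel n) x * y ∈ nfSpan n := by
  induction x using FreeAlgebra.induction with
  | grade0 r =>
    intro y hy
    rw [AlgHom.commutes, ← Algebra.smul_def]
    exact Submodule.smul_mem _ r hy
  | grade1 g => exact fun y hy => gen_mul_mem g hy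
  | mul x x' h h' =>
    intro y hy
    rw [map_mul, mul_assoc]
    exact h _ (h' y hy)
  | add x x' h h' =>
    intro y hy
    rw [map_add, add_mul]
    exact add_mem (h y hy) (h' y hy)

theorem nfSpan_eq_top : nfSpan n = ⊤ := by
  refine eq_top_iff.2 fun y _ => ?_
  obtain ⟨x, rfl⟩ := RingQuot.mkAlgHom_surjective R0a (Rel n) y
  have h := mk_mul_mem x _ (nf_mem isDiagram_nil 1 0)
  rwa [nf, bridges_nil, one_mul, braid_one, mul_one] at h

/-! ### Uniqueness of normal forms -/

/-- Two caps absorb a permutation that exchanges them. -/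
theorem exists_bridge_mul_bridge_mul_exchange {a b p q : Fin n} (hab : a ≠ b) (hpq : p ≠ q)
    (hap : a ≠ p) (haq : a ≠ q) (hbp : b ≠ p) (hbq : b ≠ q) (k l : ℤ) :
    ∃ (g : Equiv.Perm (Fin n)) (d : Fin n → ℤ), g a = p ∧ g b = q ∧
      bridge a b k * bridge p q l * braid g d = bridge a b k * bridge p q l := by
  -- An auxiliary cap joining b and p meets both caps. Absorbed by the first it acts as the crossing
  -- of a and p, by the second as that of q and b; the quotient of the two is absorbed and maps a to
  -- p and b to q.
  obtain ⟨d1, -, h1, -⟩ := exists_bridge_mul_bridge hab hap hbp k 0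
  obtain ⟨d2, -, h2, -⟩ := exists_bridge_mul_bridge hpq.symm hbq.symm hbp.symm (-l - 1) (-0 - 1)
  rw [← bridge_symm hpq, ← bridge_symm hbp.symm] at h2
  have hc := (bridge_comm hab hpq hap haq hbp hbq k l).eq
  have h3 : bridge a b k * bridge p q l * braid (Equiv.swap q b) d2 =
      bridge a b k * bridge p q l * braid (Equiv.swap a p) d1 := by
    rw [mul_assoc, ← h2, ← mul_assoc, hc, mul_assoc, h1, mul_assoc]
  have h4 := congrArg (fun x => x * braid (Equiv.swap a p)⁻¹
    (-(d1 ∘ ⇑(Equiv.swap a p)⁻¹))) h3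
  rw [mul_assoc _ (braid _ d2), mul_assoc _ (braid _ d1), braid_mul_inv, mul_one, braid_mul] at h4
  refine ⟨_, _, ?_, ?_, h4⟩
  · rw [Equiv.swap_inv, Equiv.Perm.mul_apply, Equiv.swap_apply_of_ne_of_ne haq hab,
      Equiv.swap_apply_left]
  · rw [Equiv.swap_inv, Equiv.Perm.mul_apply, Equiv.swap_apply_right,
      Equiv.swap_apply_of_ne_of_ne haq.symm hpq.symm]

theorem bridges_mul_of_perm {L P N : List (Arc n)} (hL : IsDiagram L) (hp : L.Perm (P ++ N))
    {x : Presented n} (hx : bridges P * x = bridges P) : bridges L * x = bridges L := by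
  rw [bridges_perm hL (hp.trans List.perm_append_comm), bridges_append, mul_assoc, hx]

/-- A cap of a diagram can be moved to the front. -/
theorem exists_cons {L : List (Arc n)} (hL : IsDiagram L) {a b : Fin n} (hab : a ≠ b) {k : ℤ}
    (h : (∃ t ∈ L, t = ⟨a, b, k⟩) ∨ ∃ t ∈ L, t = ⟨b, a, -k - 1⟩) :
    ∃ M, IsDiagram (⟨a, b, k⟩ :: M) ∧ bridges L = bridges (⟨a, b, k⟩ :: M) := by
  rcases h with ⟨t, ht, rfl⟩ | ⟨t, ht, rfl⟩
  · obtain ⟨M, hM⟩ := exists_perm_cons ht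
    exact ⟨M, hL.perm hM, bridges_perm hL hM⟩
  · obtain ⟨M, hM⟩ := exists_perm_cons ht
    obtain ⟨-, h2, h3⟩ := isDiagram_cons.1 (hL.perm hM)
    refine ⟨M, isDiagram_cons.2 ⟨hab, fun t ht => ?_, h3⟩, ?_⟩
    · obtain ⟨k1, k2, k3, k4⟩ := h2 t ht
      exact ⟨k3, k4, k1, k2⟩
    · rw [bridges_perm hL hM, bridges_cons, bridges_cons]
      dsimp only
      rw [bridge_symm hab]

theorem exists_cons_of_cap {L : List (Arc n)} (hL : IsDiagram L) {e : Equiv.Perm (Fin n)}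
    {c : Fin n → ℤ} {a b : Fin n} {k : ℤ}
    (h : (diagram L e c).partner (false, a) = (false, b))
    (h' : (diagram L e c).dir (false, a) = 2 * k + 1) :
    ∃ M, IsDiagram (⟨a, b, k⟩ :: M) ∧ bridges L = bridges (⟨a, b, k⟩ :: M) := by
  have hR := isDiagramOf_diagram hL e c
  have hab : a ≠ b := by
    rintro rfl
    exact (diagram L e c).partner_ne _ h
  have h1 : ∃ t ∈ L, a = t.src ∨ a = t.tgt := by
    by_contra! hc
    have := (hR.strand a hc).1
    rw [h] at this
    simp at this
  obtain ⟨t, ht, rfl | rfl⟩ := h1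
  · refine exists_cons hL hab (Or.inl ⟨t, ht, ?_⟩)
    obtain ⟨h2, h3⟩ := hR.cap t ht
    rw [h] at h2
    rw [h'] at h3
    obtain ⟨x, y, z⟩ := t
    simp only [Prod.mk.injEq, true_and] at h2
    simp only [Arc.mk.injEq, true_and]
    exact ⟨h2.symm, by dsimp only at h3; omega⟩
  · refine exists_cons hL hab (Or.inr ⟨t, ht, ?_⟩)
    obtain ⟨h2, h3⟩ := hR.cap t ht
    have h4 : (diagram L e c).dir (false, t.tgt) = -(2 * t.lab + 1) := by
      rw [← h2, (diagram L e c).dir_partner, h3, st_odd (odd_two_mul_add_one _)]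
    have h5 : (diagram L e c).partner (false, t.tgt) = (false, t.src) := by
      rw [← h2, (diagram L e c).partner_partner]
    rw [h] at h5
    rw [h'] at h4
    obtain ⟨x, y, z⟩ := t
    simp only [Prod.mk.injEq, true_and] at h5
    simp only [Arc.mk.injEq, true_and]
    exact ⟨h5.symm, by dsimp only at h4; omega⟩

/-- The normal form of a diagram can be chosen so that a given cap on the side `0` and a given
cup on the side `1` correspond to each other. -/
theorem exists_nf_eq {α : Arc n} {M : List (Arc n)} (hL : IsDiagram (α :: M))
    (e : Equiv.Perm (Fin n)) (c : Fin n → ℤ) {a' b' : Fin n}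
    (h : (diagram (α :: M) e c).partner (true, a') = (true, b')) :
    ∃ (e' : Equiv.Perm (Fin n)) (c' : Fin n → ℤ), e' α.src = a' ∧ e' α.tgt = b' ∧
      nf (α :: M) e c = nf (α :: M) e' c' := by
  have hR := isDiagramOf_diagram hL e c
  obtain ⟨h1, h2, h3⟩ := isDiagram_cons.1 hL
  obtain ⟨x, rfl⟩ := e.surjective a'
  -- the permutation `g` suffices
  have key : ∀ (g : Equiv.Perm (Fin n)) (d : Fin n → ℤ), g α.src = x → e (g α.tgt) = b' →
      bridges (α :: M) * braid g d = bridges (α :: M) →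
      ∃ (e' : Equiv.Perm (Fin n)) (c' : Fin n → ℤ), e' α.src = e x ∧ e' α.tgt = b' ∧
        nf (α :: M) e c = nf (α :: M) e' c' := by
    intro g d hg1 hg2 hg
    refine ⟨e * g, d + c ∘ g, by rw [Equiv.Perm.mul_apply, hg1], by rw [Equiv.Perm.mul_apply, hg2],
      ?_⟩
    rw [nf, nf, ← braid_mul, ← mul_assoc, hg]
  have h4 : ∃ t ∈ α :: M, x = t.src ∨ x = t.tgt := by
    by_contra! hc
    have h5 := (hR.strand x hc).1
    have h6 : (diagram (α :: M) e c).partner (true, e x) = (false, x) := by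
      rw [← h5, (diagram (α :: M) e c).partner_partner]
    rw [h] at h6
    simp at h6
  obtain ⟨t, ht, hx⟩ := h4
  have h5 : (x = t.src ∧ b' = e t.tgt) ∨ (x = t.tgt ∧ b' = e t.src) := by
    have h6 := (hR.cup t ht).1
    rcases hx with rfl | rfl
    · rw [h] at h6
      exact Or.inl ⟨rfl, congrArg Prod.snd h6⟩
    · have h7 : (diagram (α :: M) e c).partner (true, e t.tgt) = (true, e t.src) := by
        rw [← h6, (diagram (α :: M) e c).partner_partner]
      rw [h] at h7
      exact Or.inr ⟨rfl, congrArg Prod.snd h7⟩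
  -- If the cup belongs to the first cap, at most a flip is needed. If it belongs to another cap,
  -- the two are exchanged, the latter being reversed when the cup is.
  rcases List.mem_cons.1 ht with rfl | htM
  · rcases h5 with ⟨rfl, rfl⟩ | ⟨rfl, rfl⟩
    · exact key 1 0 rfl rfl (by rw [braid_one, mul_one])
    · obtain ⟨d, -, hd⟩ := exists_bridge_mul_flip h1 t.lab
      refine key (Equiv.swap t.src t.tgt) d (Equiv.swap_apply_left _ _)
        (by rw [Equiv.swap_apply_right]) (bridges_mul_of_perm (P := [t]) (N := M) hL (List.Perm.refl _) ?_)
      rw [bridges_cons, bridges_nil, mul_one, hd]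
  · obtain ⟨N, hN⟩ := exists_perm_cons htM
    obtain ⟨k1, k2, k3, k4⟩ := h2 t htM
    have hp : (α :: M).Perm ([α, t] ++ N) := hN.cons α
    have ht1 := hL.2 t ht
    have hb : bridges [α, t] = bridge α.src α.tgt α.lab * bridge t.src t.tgt t.lab := by
      rw [bridges_cons, bridges_cons, bridges_nil, mul_one]
    rcases h5 with ⟨rfl, rfl⟩ | ⟨rfl, rfl⟩
    · obtain ⟨g, d, hg1, hg2, hg⟩ :=
        exists_bridge_mul_bridge_mul_exchange h1 ht1 k1 k2 k3 k4 α.lab t.lab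
      exact key g d hg1 (by rw [hg2]) (bridges_mul_of_perm hL hp (by rw [hb, hg]))
    · obtain ⟨g, d, hg1, hg2, hg⟩ :=
        exists_bridge_mul_bridge_mul_exchange h1 ht1.symm k2 k1 k4 k3 α.lab (-t.lab - 1)
      rw [← bridge_symm ht1] at hg
      exact key g d hg1 (by rw [hg2]) (bridges_mul_of_perm hL hp (by rw [hb, hg]))

/-- Induction on the caps of `L`. The second normal form is rewritten inside the presented algebra
until its first cap, the cup attached to it and the two labels of `c` there are those of `L`; then
the common cap can be removed from both tangles. -/
theorem nf_eq_of_diagram_eq {L : List (Arc n)} : ∀ {L' : List (Arc n)}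
    {e e' : Equiv.Perm (Fin n)} {c c' : Fin n → ℤ}, IsDiagram L → IsDiagram L' →
    diagram L e c = diagram L' e' c' → nf L e c = nf L' e' c' := by
  induction L with
  | nil =>
    intro L' e e' c c' hL hL' h
    have hR := isDiagramOf_diagram hL' e' c'
    rw [← h, diagram_nil] at hR
    cases L' with
    | cons t M =>
      have := (hR.cap t List.mem_cons_self).1
      simp at this
    | nil =>
      have he : e = e' := by
        ext x
        have := (hR.strand x (by simp)).1
        rw [strands_partner_false] at this
        exact congrArg (fun v : Vertex n => (v.2 : ℕ)) this
      have hc : c = c' := by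
        ext x
        have := (hR.strand x (by simp)).2
        rw [strands_dir_false] at this
        omega
      rw [he, hc]
  | cons α L ih =>
    intro L' e e' c c' hL hL' h
    have hR := isDiagramOf_diagram hL e c
    obtain ⟨h1, h2, h3⟩ := isDiagram_cons.1 hL
    -- the first cap of `L` is moved to the front of `L'`
    obtain ⟨pa, da⟩ := hR.cap α List.mem_cons_self
    obtain ⟨pc, dc⟩ := hR.cup α List.mem_cons_self
    obtain ⟨M, hM, hM'⟩ := exists_cons_of_cap hL' (a := α.src) (b := α.tgt) (k := α.lab)
      (by rw [← h, pa]) (by rw [← h, da])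
    change IsDiagram (α :: M) at hM
    change bridges L' = bridges (α :: M) at hM'
    have e1 : nf L' e' c' = nf (α :: M) e' c' := by rw [nf, nf, hM']
    rw [diagram_eq_of_nf_eq hL' hM e1] at h
    -- its cup is made to agree
    obtain ⟨f, d, hf1, hf2, hf⟩ := exists_nf_eq hM e' c' (by rw [← h, pc])
    rw [diagram_eq_of_nf_eq hM hM hf] at h
    obtain ⟨m1, m2, m3⟩ := isDiagram_cons.1 hM
    have hR' := isDiagramOf_diagram hM f d
    obtain ⟨-, dc'⟩ := hR'.cup α List.mem_cons_self
    rw [← h, hf1, dc] at dc'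
    -- and its labels
    obtain ⟨d', hd', hd1, hd2⟩ : ∃ d' : Fin n → ℤ, nf (α :: M) f d = nf (α :: M) f d' ∧
        d' α.src = c α.src ∧ d' α.tgt = c α.tgt := by
      -- The label of the cup determines only the difference of `c` at the two ends, so `c` and `d`
      -- differ there by a common amount m, which a slide removes.
      obtain ⟨m, hm⟩ : ∃ m, m = c α.src - d α.src := ⟨_, rfl⟩
      obtain ⟨u, hu⟩ : ∃ u : Fin n → ℤ, u = Pi.single α.src m + Pi.single α.tgt m := ⟨_, rfl⟩
      have h4 := bridge_mul_slide m1 α.lab m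
      rw [← hu] at h4
      have h5 : bridges (α :: M) * braid 1 u = bridges (α :: M) :=
        bridges_mul_of_perm (P := [α]) (N := M) hM (List.Perm.refl _) (by
          rw [bridges_cons, bridges_nil, mul_one, h4])
      have u1 : u α.src = m := by
        rw [hu]
        simp [m1]
      have u2 : u α.tgt = m := by
        rw [hu]
        simp [m1.symm]
      refine ⟨u + d ∘ (1 : Equiv.Perm (Fin n)), ?_, ?_, ?_⟩
      · have h6 := braid_mul 1 f u d
        rw [mul_one] at h6
        rw [nf, nf, ← h6, ← mul_assoc, h5]
      · change u α.src + d α.src = _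
        omega
      · change u α.tgt + d α.tgt = _
        omega
    rw [diagram_eq_of_nf_eq hM hM hd'] at h
    -- the cap is opened
    have hS := isDiagramOf_diagram h3 e c
    have hS' := isDiagramOf_diagram m3 f d'
    have s1 := hS.strand α.src fun t ht => ⟨(h2 t ht).1, (h2 t ht).2.1⟩
    have s2 := hS.strand α.tgt fun t ht => ⟨(h2 t ht).2.2.1, (h2 t ht).2.2.2⟩
    have s1' := hS'.strand α.src fun t ht => ⟨(m2 t ht).1, (m2 t ht).2.1⟩
    have s2' := hS'.strand α.tgt fun t ht => ⟨(m2 t ht).2.2.1, (m2 t ht).2.2.2⟩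
    rw [diagram_cons h1, diagram_cons h1] at h
    have h6 := eq_of_cap_comp_eq h s1.1 s2.1 (by rw [s1'.1, hf1]) (by rw [s2'.1, hf2])
      (by rw [s1.2, s1'.2, hd1]) (by rw [s2.2, s2'.2, hd2])
    have h7 := ih h3 m3 h6
    rw [nf, nf] at h7
    rw [e1, hf, hd', nf, nf, bridges_cons, bridges_cons, mul_assoc, mul_assoc, h7]

/-! ### The isomorphism -/

/-- A diagram is chosen for each tangle. By uniqueness of normal forms the choice is immaterial, so
the chosen normal forms are all of them and span. -/
theorem exists_section : ∃ s : ArrowTangle n → Presented n,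
    (∀ T, ATL.presentedHom n (s T) = ATL.of T) ∧ Submodule.span R0a (Set.range s) = ⊤ := by
  choose L e c hL hT using fun T : ArrowTangle n => T.exists_eq_diagram
  refine ⟨fun T => nf (L T) (e T) (c T), fun T => ?_, ?_⟩
  · rw [presentedHom_nf (hL T), ← hT T]
  · rw [← nfSpan_eq_top, nfSpan]
    congr 1
    ext x
    constructor
    · rintro ⟨T, rfl⟩
      exact ⟨_, _, _, hL T, rfl⟩
    · rintro ⟨L', e', c', hL', rfl⟩
      exact ⟨diagram L' e' c', nf_eq_of_diagram_eq (hL _) hL' (hT _).symm⟩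

/-- The linear extension of the section is a right inverse of `presentedHom`, and it is surjective
because the normal forms span; so it is a two-sided inverse. -/
theorem presentedHom_bijective : Function.Bijective (ATL.presentedHom n) := by
  obtain ⟨s, hs, hspan⟩ := exists_section (n := n)
  let ψ : ATL n →ₗ[R0a] Presented n := (Finsupp.linearCombination R0a s :
    (ArrowTangle n →₀ R0a) →ₗ[R0a] Presented n)
  have h1 : ∀ T, ψ (ATL.of T) = s T := fun T =>
    (Finsupp.linearCombination_single R0a (1 : R0a) T).trans (one_smul R0a _)
  have h2 : ∀ x, ATL.presentedHom n (ψ x) = x := by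
    intro x
    induction x using ATL.induction with
    | h0 => rw [map_zero, map_zero]
    | hadd x y hx hy => rw [map_add, map_add, hx, hy]
    | hs r F => rw [map_smul, map_smul, h1, hs]
  have h3 : Function.Surjective ψ := by
    have : LinearMap.range ψ = ⊤ := (Finsupp.range_linearCombination (R := R0a) (v := s)).trans hspan
    exact LinearMap.range_eq_top.1 this
  refine ⟨fun x y hxy => ?_, fun x => ⟨ψ x, h2 x⟩⟩
  obtain ⟨x, rfl⟩ := h3 x
  obtain ⟨y, rfl⟩ := h3 y
  rw [h2, h2] at hxy
  rw [hxy]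

end Presented

end ArrowTL

theorem proposition3p2 (n : ℕ) (hn : 2 ≤ n) :
    -- `ATL n` is an associative algebra with unit `1`
    (∀ x y z : ArrowTL.ATL n, x * y * z = x * (y * z)) ∧
    (∀ x : ArrowTL.ATL n, 1 * x = x ∧ x * 1 = x) ∧
    -- the presented algebra is isomorphic to it, by the map that sends each generator to its diagram
    ∃ φ : ArrowTL.Presented n ≃ₗ[ArrowTL.R0a] ArrowTL.ATL n,
      φ 1 = 1 ∧ (∀ a b : ArrowTL.Presented n, φ (a * b) = φ a * φ b) ∧
      (∀ i : Fin (n - 1),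
        φ (ArrowTL.gen (.F i)) = ArrowTL.ATL.of (ArrowTL.ArrowTangle.FTangle i)) ∧
      (∀ i : Fin (n - 1),
        φ (ArrowTL.gen (.w i)) = ArrowTL.ATL.of (ArrowTL.ArrowTangle.wTangle i)) ∧
      (∀ j : Fin n,
        φ (ArrowTL.gen (.t j)) = ArrowTL.ATL.of (ArrowTL.ArrowTangle.tTangle j)) ∧
      (∀ j : Fin n,
        φ (ArrowTL.gen (.tInv j)) = ArrowTL.ATL.of (ArrowTL.ArrowTangle.tInvTangle j)) := by
  open scoped ArrowTL.ATL in
  refine ⟨ArrowTL.ATL.mul_assoc', fun x => ⟨ArrowTL.ATL.one_mul' x, ArrowTL.ATL.mul_one' x⟩,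
    LinearEquiv.ofBijective (ArrowTL.ATL.presentedHom n).toLinearMap
      ArrowTL.Presented.presentedHom_bijective, ?_, fun a b => ?_, fun i => ?_, fun i => ?_,
    fun j => ?_, fun j => ?_⟩
  -- The scoped ring structure has the given unit and multiplication by definition, so the laws of
  -- the algebra homomorphism apply to them.
  · open scoped ArrowTL.ATL in
    exact map_one (ArrowTL.ATL.presentedHom n)
  · open scoped ArrowTL.ATL in
    exact map_mul (ArrowTL.ATL.presentedHom n) a b
  · exact ArrowTL.Presented.presentedHom_gen _
  · exact ArrowTL.Presented.presentedHom_gen _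
  · exact ArrowTL.Presented.presentedHom_gen _
  · exact ArrowTL.Presented.presentedHom_gen _
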